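/- Let $d\in\{2,3\}$, $\Omega=(0,1)^d$, $T>0$, and let $(\mathsf u,\mathsf p)$ be a solution of the time-dependent Stokes problem $$\mathsf u_t-\Delta \mathsf u+\nabla \mathsf p=f,\qquad \nabla\!\cdot\mathsf u=0 \ \text{ in }\Omega,\qquad \mathsf u|_{\partial\Omega}=0,$$ on $[0,T]$, with $f\in W^{2,\infty}(0,T;L^2(\Omega)^d)$ (for instance $f$ smooth). For $\tau>0$ let $B_\tau=\partial_{xxyy}$ if $d=2$ and $B_\tau=\partial_{xxyy}+\partial_{yyzz}+\partial_{zzxx}-\frac\tau2\partial_{xxyyzz}$ if $d=3$, with domain $D(B_\tau)=\{v\in H^1_0(\Omega)^d: B_\tau v\in L^2(\Omega)^d\}$ and the graph norm; let $Y$ be the space of zero-mean $q\in H^1(\Omega)$ with $\partial_{xy}q\in L^2(\Omega)$ if $d=2$, and with $\partial_{xy}q,\partial_{yz}q,\partial_{zx}q,\partial_{xyz}q\in L^2(\Omega)$ if $d=3$. Let $A=(1-\partial_{xx})(1-\partial_{yy})$ if $d=2$ and $A=(1-\partial_{xx})(1-\partial_{yy})(1-\partial_{zz})$ if $d=3$,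 acting on zero-mean functions, where each one-dimensional factor is taken with homogeneous Neumann conditions on the two faces orthogonal to its direction. Assume $$\mathsf u\in W^{2,\infty}(0,T;H^2(\Omega)^d),\qquad \mathsf u\in W^{1,\infty}(0,T;D(B_\tau))\ \text{ for all }\tau>0,\qquad \mathsf p\in W^{2,\infty}(0,T;Y).$$ Let $0<\chi\le 1$. For a time step $\tau>0$ put $t_k=k\tau$ and $f^{k+\frac12}=f(t_k+\frac\tau2)$, and consider the rotational direction-splitting scheme: $u^0=\mathsf u(0)$, $p^{-\frac12}=\mathsf p(0)$, $\phi^{-\frac12}=\phi^\star$ given, and for each $k\ge0$ with $t_{k+1}\le T$: 1. $p^{\star,k+\frac12}=p^{k-\frac12}+\phi^{k-\frac12}$. 2. If $d=2$, find $u^{k+\frac12},u^{k+1}$ with $$\tfrac{u^{k+\frac12}-u^k}{\tau/2}-\partial_{xx}u^{k+\frac12}-\partial_{yy}u^k+\nabla p^{\star,k+\frac12}=f^{k+\frac12},\quad u^{k+\frac12}|_{x=0,1}=0,$$ $$\tfrac{u^{k+1}-u^{k+\frac12}}{\tau/2}-\partial_{xx}u^{k+\frac12}-\partial_{yy}u^{k+1}+\nabla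 p^{\star,k+\frac12}=f^{k+\frac12},\quad u^{k+1}|_{y=0,1}=0.$$ If $d=3$, find $\xi^{k+1},\eta^{k+1},\zeta^{k+1},u^{k+1}$ with $$\tfrac{\xi^{k+1}-u^k}{\tau}-\Delta u^k+\nabla p^{\star,k+\frac12}=f^{k+\frac12},$$ $$\tfrac{\eta^{k+1}-\xi^{k+1}}{\tau}-\tfrac12\partial_{xx}(\eta^{k+1}-u^k)=0,\quad \eta^{k+1}|_{x=0,1}=0,$$ $$\tfrac{\zeta^{k+1}-\eta^{k+1}}{\tau}-\tfrac12\partial_{yy}(\zeta^{k+1}-u^k)=0,\quad \zeta^{k+1}|_{y=0,1}=0,$$ $$\tfrac{u^{k+1}-\zeta^{k+1}}{\tau}-\tfrac12\partial_{zz}(u^{k+1}-u^k)=0,\quad u^{k+1}|_{z=0,1}=0.$$ 3. $A\phi^{k+\frac12}=-\frac1\tau\nabla\!\cdot u^{k+1}$. 4. $p^{k+\frac12}=p^{k-\frac12}+\phi^{k+\frac12}-\chi\,\nabla\!\cdot\bar u^{k+\frac12}$, where $\bar u^{k+\frac12}=\frac12(u^{k+1}+u^k)$. The equations are understood in $L^2(\Omega)$,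 with weak derivatives. Then for every $C_0$ there is a constant $c$, independent of $\tau$, of $\phi^\star$ and of the discrete solution, such that for every $\tau>0$, every $\phi^\star$ with $\|\mathsf p(\frac\tau2)-p^{\star,\frac12}\|_{L^2}\le C_0\tau$, and every solution of the scheme, $$\max_{k\ge 0,\ t_{k+1}\le T}\ \bigl\|\nabla\bigl(\bar{\mathsf u}^{k+\frac12}-\bar u^{k+\frac12}\bigr)\bigr\|_{L^2}\le c\,\tau,\qquad \bar{\mathsf u}^{k+\frac12}=\tfrac12\bigl(\mathsf u(t_{k+1})+\mathsf u(t_k)\bigr),$$ and $\bar{\mathsf u}^{k+\frac12}-\bar u^{k+\frac12}\in H^1_0(\Omega)^d$; that is, $\|\bar{\mathsf u}_\tau-\bar u_\tau\|_{\ell^\infty(\mathbf H^1)}\le c\tau$. -/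

import Mathlib

open MeasureTheory Set
open scoped ContDiff

namespace DirSplit

noncomputable section

/-- The open unit cube `(0,1)^d`. -/
def cube (d : ℕ) : Set (Fin d → ℝ) := Set.pi univ fun _ => Ioo (0 : ℝ) 1

/-- `L²((0,1)^d)`; vector fields are `Fin d → L2 d`. -/
abbrev L2 (d : ℕ) := Lp ℝ 2 ((volume : Measure (Fin d → ℝ)).restrict (cube d))

/-- Classical partial derivative in the direction `i`. -/
def pd {d : ℕ} (i : Fin d) (φ : (Fin d → ℝ) → ℝ) : (Fin d → ℝ) → ℝ :=
  fun x => fderiv ℝ φ x (Pi.single i 1)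

/-- Iterated partial derivative along a list of directions. -/
def pds {d : ℕ} (l : List (Fin d)) (φ : (Fin d → ℝ) → ℝ) : (Fin d → ℝ) → ℝ :=
  l.foldr pd φ

/-- Test functions: `C^∞`, with compact support contained in the open cube. -/
def IsTest {d : ℕ} (φ : (Fin d → ℝ) → ℝ) : Prop :=
  ContDiff ℝ ∞ φ ∧ HasCompactSupport φ ∧ tsupport φ ⊆ cube d

/-- `g` is the weak derivative of `v` along the list `l` (e.g. `[0, 0]` for `∂_{xx}`). -/
def HasWeakDeriv {d : ℕ} (l : List (Fin d)) (v g : L2 d) : Prop :=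
  ∀ φ : (Fin d → ℝ) → ℝ, IsTest φ →
    ∫ x in cube d, v x * pds l φ x = (-1) ^ l.length * ∫ x in cube d, g x * φ x

/-- `g` is the weak derivative `∂_i v`, and `v` has zero trace on the two faces
`x_i = 0` and `x_i = 1`: Green's formula has no boundary term for any function `φ` that is
smooth up to the boundary of the cube. -/
def HasDerivZeroTrace {d : ℕ} (i : Fin d) (v g : L2 d) : Prop :=
  ∀ φ : (Fin d → ℝ) → ℝ, ContDiff ℝ ∞ φ → HasCompactSupport φ →
    ∫ x in cube d, v x * pd i φ x = - ∫ x in cube d, g x * φ x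

/-- `v|_{x_i = 0, 1} = 0`. -/
def ZeroOnFaces {d : ℕ} (i : Fin d) (v : L2 d) : Prop :=
  ∃ g, HasDerivZeroTrace i v g

/-- `v ∈ H¹₀`: weak gradient in `L²` and zero trace on the whole boundary. -/
def MemH10 {d : ℕ} (v : L2 d) : Prop := ∀ i, ZeroOnFaces i v

/-- `D = div v` in the weak sense. -/
def HasWeakDiv {d : ℕ} (v : Fin d → L2 d) (D : L2 d) : Prop :=
  ∀ φ : (Fin d → ℝ) → ℝ, IsTest φ →
    ∑ i, ∫ x in cube d, v i x * pd i φ x = - ∫ x in cube d, D x * φ x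

/-- `w = Δ v`, the sum of the weak derivatives `∂_{ii} v ∈ L²`. -/
def HasLaplacian {d : ℕ} (v w : L2 d) : Prop :=
  ∃ h : Fin d → L2 d, (∀ i, HasWeakDeriv [i, i] v (h i)) ∧ w = ∑ i, h i

/-! ### Function spaces in time -/

/-- `w ∈ W^{m,∞}((0,T); L²)`; for `m ≥ 1`, `w` is the representative that is the primitive of
its derivative at every point of `[0,T]`. -/
def TimeSobolev {d : ℕ} (T : ℝ) : ℕ → (ℝ → L2 d) → Prop
  | 0, w => MemLp w ⊤ (volume.restrict (Ioo 0 T))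
  | m + 1, w => ∃ w' : ℝ → L2 d, TimeSobolev T m w' ∧
      ∀ t ∈ Icc 0 T, w t = w 0 + ∫ s in (0 : ℝ)..t, w' s

/-- For every `l ∈ S`, the weak derivative of `v` along `l` exists in `L²` on `[0,T]` and belongs
to `W^{m,∞}((0,T); L²)`. -/
def TimeSobolevDerivs {d : ℕ} (T : ℝ) (m : ℕ) (S : Set (List (Fin d))) (v : ℝ → L2 d) : Prop :=
  ∀ l ∈ S, ∃ g : ℝ → L2 d,
    (∀ t ∈ Icc 0 T, HasWeakDeriv l (v t) (g t)) ∧ TimeSobolev T m g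

/-- `v ∈ W^{m,∞}((0,T); H²)`. -/
def TimeH2 {d : ℕ} (T : ℝ) (m : ℕ) (v : ℝ → L2 d) : Prop :=
  TimeSobolevDerivs T m {l | l.length ≤ 2} v

/-- `q ∈ W^{m,∞}((0,T); Y)`, where `Y` is the space of the zero-mean functions in `H¹` all of whose
mixed derivatives in pairwise distinct directions (`∂_{xy}` in 2D; `∂_{xy}`, `∂_{yz}`, `∂_{zx}`,
`∂_{xyz}` in 3D) are in `L²`. -/
def TimeY {d : ℕ} (T : ℝ) (m : ℕ) (q : ℝ → L2 d) : Prop :=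
  TimeSobolevDerivs T m {l | l.Nodup} q ∧ ∀ t ∈ Icc 0 T, ∫ x in cube d, q t x = 0

/-- The direction splitting velocity operator on smooth functions:
`∂_{xxyy}` in 2D and `∂_{xxyy} + ∂_{yyzz} + ∂_{zzxx} - (τ/2) ∂_{xxyyzz}` in 3D. -/
def splitB : (d : ℕ) → ℝ → ((Fin d → ℝ) → ℝ) → (Fin d → ℝ) → ℝ
  | 2, _, φ => pds [0, 0, 1, 1] φ
  | 3, τ, φ => fun x =>
      pds [0, 0, 1, 1] φ x + pds [1, 1, 2, 2] φ x + pds [2, 2, 0, 0] φ x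
        - τ / 2 * pds [0, 0, 1, 1, 2, 2] φ x
  | _, _, _ => 0

/-- `v ∈ D(B)` and `w = B v`: `v ∈ H¹₀` and `B v = w ∈ L²` in the sense of distributions (all
derivatives in `B` have even order, so `B` is formally symmetric). -/
def HasB {d : ℕ} (τ : ℝ) (v w : L2 d) : Prop :=
  MemH10 v ∧ ∀ φ : (Fin d → ℝ) → ℝ, IsTest φ →
    ∫ x in cube d, v x * splitB d τ φ x = ∫ x in cube d, w x * φ x

/-- `v ∈ W^{m,∞}((0,T); D(B))`, `D(B)` with the graph norm. -/
def TimeDB {d : ℕ} (T : ℝ) (m : ℕ) (τ : ℝ) (v : ℝ → L2 d) : Prop :=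
  TimeSobolev T m v ∧
    ∃ w : ℝ → L2 d, (∀ t ∈ Icc 0 T, HasB τ (v t) (w t)) ∧ TimeSobolev T m w

/-! ### The Stokes problem -/

/-- `(u, p)` solves the time-dependent Stokes problem on `[0,T]` with source `f` (and initial
velocity `u 0`). -/
structure IsStokesSolution {d : ℕ} (T : ℝ) (f u : ℝ → Fin d → L2 d) (p : ℝ → L2 d) : Prop where
  momentum : ∀ t ∈ Ioc 0 T, ∀ j, ∃ lap grad : L2 d,
    HasLaplacian (u t j) lap ∧ HasWeakDeriv [j] (p t) grad ∧
      HasDerivWithinAt (fun s => u s j) (f t j + lap - grad) (Icc 0 T) t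
  incompressible : ∀ t ∈ Icc 0 T, HasWeakDiv (u t) 0
  boundary : ∀ t ∈ Ioc 0 T, ∀ j, MemH10 (u t j)

/-! ### The scheme -/

/-- `h = ∂_{ii} ψ` with the Neumann condition `∂_i ψ|_{x_i = 0, 1} = 0`. -/
def HasNeumannD2 {d : ℕ} (i : Fin d) (ψ h : L2 d) : Prop :=
  ∃ r, HasWeakDeriv [i] ψ r ∧ HasDerivZeroTrace i r h

/-- `q ∈ D(A)` and `A q = g`, with `A = (1 - ∂_{xx})(1 - ∂_{yy})` in 2D and
`A = (1 - ∂_{xx})(1 - ∂_{yy})(1 - ∂_{zz})` in 3D. The factors are applied from the last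
direction to the first, each with its Neumann condition; `ψ` lists the intermediate functions. -/
def HasA {d : ℕ} (q g : L2 d) : Prop :=
  ∫ x in cube d, q x = 0 ∧
    ∃ ψ : Fin (d + 1) → L2 d, ψ (Fin.last d) = q ∧ ψ 0 = g ∧
      ∀ i : Fin d, ∃ h, HasNeumannD2 i (ψ i.succ) h ∧ ψ i.castSucc = ψ i.succ - h

/-- One velocity update `u ↦ u'` with predicted pressure `ps` and source value `F`.
In 2D: the Peaceman-Rachford splitting with the half-step velocity `uh`.
In 3D: the Douglas splitting with intermediate fields `ξ`, `η`, `ζ`; here `ξ` is given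
explicitly by its equation, so that no boundary condition is imposed on it. -/
def VelocityUpdate : (d : ℕ) → ℝ → (Fin d → L2 d) → L2 d → (Fin d → L2 d) → (Fin d → L2 d) → Prop
  | 2, τ, F, ps, u, u' =>
      ∃ uh : Fin 2 → L2 2, ∀ j, ∃ uhxx uyy uyy' grad : L2 2,
        HasWeakDeriv [0, 0] (uh j) uhxx ∧ HasWeakDeriv [1, 1] (u j) uyy ∧
        HasWeakDeriv [1, 1] (u' j) uyy' ∧ HasWeakDeriv [j] ps grad ∧
        ZeroOnFaces 0 (uh j) ∧ ZeroOnFaces 1 (u' j) ∧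
        (τ / 2)⁻¹ • (uh j - u j) - uhxx - uyy + grad = F j ∧
        (τ / 2)⁻¹ • (u' j - uh j) - uhxx - uyy' + grad = F j
  | 3, τ, F, ps, u, u' =>
      ∃ ξ η ζ : Fin 3 → L2 3, ∀ j, ∃ lap grad a b c : L2 3,
        HasLaplacian (u j) lap ∧ HasWeakDeriv [j] ps grad ∧
        HasWeakDeriv [0, 0] (η j - u j) a ∧ HasWeakDeriv [1, 1] (ζ j - u j) b ∧
        HasWeakDeriv [2, 2] (u' j - u j) c ∧
        ZeroOnFaces 0 (η j) ∧ ZeroOnFaces 1 (ζ j) ∧ ZeroOnFaces 2 (u' j) ∧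
        τ⁻¹ • (ξ j - u j) - lap + grad = F j ∧
        τ⁻¹ • (η j - ξ j) - (1 / 2 : ℝ) • a = 0 ∧
        τ⁻¹ • (ζ j - η j) - (1 / 2 : ℝ) • b = 0 ∧
        τ⁻¹ • (u' j - ζ j) - (1 / 2 : ℝ) • c = 0
  | _, _, _, _, _, _ => False

/-- The time average `(ψ^{k+1} + ψ^k)/2` of a sequence of vector fields. -/
def avg {d : ℕ} (ψ : ℕ → Fin d → L2 d) (k : ℕ) : Fin d → L2 d :=
  fun j => (1 / 2 : ℝ) • (ψ (k + 1) j + ψ k j)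

/-- The direction splitting scheme with time step `τ` and parameter `χ`, started from the velocity
`u₀`, the pressure `p₀` and the pressure correction `φs`, and run as long as `t_{k+1} ≤ T`.
`u k`, `p k`, `φ k` stand for `u^k`, `p^{k-1/2}`, `φ^{k-1/2}`. -/
structure IsScheme {d : ℕ} (T τ χ : ℝ) (f : ℝ → Fin d → L2 d) (u₀ : Fin d → L2 d) (p₀ φs : L2 d)
    (u : ℕ → Fin d → L2 d) (p φ : ℕ → L2 d) : Prop where
  init_u : u 0 = u₀
  init_p : p 0 = p₀
  init_φ : φ 0 = φs
  velocity : ∀ k : ℕ, (k + 1) * τ ≤ T →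
    VelocityUpdate d τ (f ((k + 1 / 2) * τ)) (p k + φ k) (u k) (u (k + 1))
  penalty : ∀ k : ℕ, (k + 1) * τ ≤ T →
    ∃ D, HasWeakDiv (u (k + 1)) D ∧ HasA (φ (k + 1)) (-(1 / τ) • D)
  pressure : ∀ k : ℕ, (k + 1) * τ ≤ T →
    ∃ D, HasWeakDiv (avg u k) D ∧ p (k + 1) = p k + φ (k + 1) - χ • D

/-- `v ∈ H¹₀` (componentwise) and `‖v‖_{H¹} = ‖∇v‖_{L²} ≤ C`. -/
def H10NormLE {d : ℕ} (v : Fin d → L2 d) (C : ℝ) : Prop :=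
  ∃ G : Fin d → Fin d → L2 d, (∀ i j, HasDerivZeroTrace i (v j) (G i j)) ∧
    Real.sqrt (∑ i, ∑ j, ‖G i j‖ ^ 2) ≤ C

end

end DirSplit

open DirSplit

/-!
Eliminating the intermediate velocities turns one velocity step into the inversion of
`τ⁻¹ ∏ᵢ (1 - (τ/2) ∂ᵢᵢ) = τ⁻¹ - Δ/2 + (τ/4) B_τ` with Dirichlet conditions, which is diagonal in the
products of sines, while `A` is diagonal in the products of cosines. In these bases the weak
equations become identities between Fourier coefficients, and the errors solve an abstract system
whose operators satisfy `‖div v‖ ≤ ‖∇v‖` and `⟨div v, q⟩ ≤ ‖v‖ ⟨A q, q⟩^{1/2}`.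

Testing the error equation with the new velocity error, the pressure terms telescope, because the
second inequality absorbs the increment of the pressure corrections into the increment of the
velocity. This gives an energy estimate for the square root of the energy, hence a bound `O(τ)` for
the errors and, since the increments of the errors solve a system of the same form, `O(τ²)` for the
increments. Testing once more with the averaged velocity error then bounds its gradient by the
geometric mean of the two bounds, divided by `√τ`, which is `O(τ)`. The defect of the initial
pressure is only in `L²`, out of reach of this argument; by linearity its contribution is separated,
and it is small because the defect enters in the first step only.
-/

namespace DirSplit

open Filter Topology
open scoped InnerProductSpace NNReal

section Scalar

theorem le_add_of_sq_le {x y c : ℝ} (hy : 0 ≤ y) (hc : 0 ≤ c)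
    (h : x ^ 2 ≤ y ^ 2 + 2 * c * x) : x ≤ y + 2 * c := by
  by_contra! hlt
  nlinarith [mul_nonneg hy hc]

theorem le_of_mul_sq_le_mul {a b x : ℝ} (hb : 0 ≤ b) (hx : 0 ≤ x)
    (h : a * x ^ 2 ≤ b * x) : a * x ≤ b := by
  rcases hx.eq_or_lt with rfl | hx
  · simpa using hb
  · exact le_of_mul_le_mul_right (by linarith) hx

variable {F : Type*} [NormedAddCommGroup F]

theorem norm_half_smul_add_le [NormedSpace ℝ F] {x y : F} {C : ℝ} (hx : ‖x‖ ≤ C) (hy : ‖y‖ ≤ C) :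
    ‖(1 / 2 : ℝ) • (x + y)‖ ≤ C := by
  rw [norm_smul, Real.norm_of_nonneg one_half_pos.le]
  linarith [norm_add_le x y]

variable [InnerProductSpace ℝ F]

theorem two_mul_inner_sub_left (x y : F) :
    2 * ⟪x - y, x⟫_ℝ = ‖x‖ ^ 2 - ‖y‖ ^ 2 + ‖x - y‖ ^ 2 := by
  rw [norm_sub_sq_real, inner_sub_left, real_inner_self_eq_norm_sq, real_inner_comm]
  ring

theorem two_mul_inner_add_left (x y : F) :
    2 * ⟪x + y, x⟫_ℝ = ‖x‖ ^ 2 - ‖y‖ ^ 2 + ‖x + y‖ ^ 2 := by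
  rw [norm_add_sq_real, inner_add_left, real_inner_self_eq_norm_sq, real_inner_comm]
  ring

theorem neg_inner_le_of_norm_le {x y : F} {a b : ℝ} (hx : ‖x‖ ≤ a) (hy : ‖y‖ ≤ b) :
    -⟪x, y⟫_ℝ ≤ a * b :=
  calc -⟪x, y⟫_ℝ ≤ ‖x‖ * ‖y‖ := (neg_le_abs _).trans (abs_real_inner_le_norm x y)
    _ ≤ a * b := mul_le_mul hx hy (norm_nonneg y) ((norm_nonneg x).trans hx)

theorem inner_le_of_norm_le {x y : F} {a b : ℝ} (hx : ‖x‖ ≤ a) (hy : ‖y‖ ≤ b) :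
    ⟪x, y⟫_ℝ ≤ a * b :=
  (real_inner_le_norm x y).trans
    (mul_le_mul hx hy (norm_nonneg y) ((norm_nonneg x).trans hx))

end Scalar

/-! ### The abstract error system -/

section AbstractScheme

variable {V H G K Q Y : Type*}
  [NormedAddCommGroup V] [InnerProductSpace ℝ V] [NormedAddCommGroup H] [InnerProductSpace ℝ H]
  [NormedAddCommGroup G] [InnerProductSpace ℝ G] [NormedAddCommGroup K] [InnerProductSpace ℝ K]
  [NormedAddCommGroup Q] [InnerProductSpace ℝ Q] [NormedAddCommGroup Y] [InnerProductSpace ℝ Y]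

/-- The operators of an abstract direction splitting scheme with time step `τ`. The inner product
of the velocity space `V` is the form inverted in one velocity step, that of the space `Y` of the
pressure corrections is the form of the penalty operator `A`. -/
structure SplittingOperators (τ : ℝ) (V H G K Q Y : Type*)
    [NormedAddCommGroup V] [InnerProductSpace ℝ V] [NormedAddCommGroup H] [InnerProductSpace ℝ H]
    [NormedAddCommGroup G] [InnerProductSpace ℝ G] [NormedAddCommGroup K] [InnerProductSpace ℝ K]
    [NormedAddCommGroup Q] [InnerProductSpace ℝ Q] [NormedAddCommGroup Y]
    [InnerProductSpace ℝ Y] where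
  /-- the embedding of the velocities in `L²` -/
  emb : V →L[ℝ] H
  /-- the velocity gradient -/
  grad : V →L[ℝ] G
  /-- a square root of the splitting operator `B` -/
  split : V →L[ℝ] K
  /-- the divergence -/
  div : V →L[ℝ] Q
  /-- the embedding of the pressure corrections in `L²` -/
  press : Y →L[ℝ] Q
  step_pos : 0 < τ
  inner_eq : ∀ v w, ⟪v, w⟫_ℝ =
    τ⁻¹ * ⟪emb v, emb w⟫_ℝ + 1 / 2 * ⟪grad v, grad w⟫_ℝ + τ / 4 * ⟪split v, split w⟫_ℝ
  norm_div_le : ∀ v, ‖div v‖ ≤ ‖grad v‖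
  inner_div_press_le : ∀ v q, ⟪div v, press q⟫_ℝ ≤ ‖emb v‖ * ‖q‖

variable {τ χ : ℝ} {N : ℕ}

/-- A solution of the error equations of the abstract scheme, up to the time level `N`. -/
structure ErrorSystem (O : SplittingOperators τ V H G K Q Y) (χ : ℝ) (N : ℕ) where
  /-- the velocity errors `e^k` -/
  vel : ℕ → V
  /-- the pressure corrections `φ^{k-1/2}` -/
  corr : ℕ → Y
  /-- the pressure errors, with the divergence terms of the rotational update removed -/
  press : ℕ → Y
  /-- the sums of the divergences of the averaged velocity errors -/
  divSum : ℕ → Q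
  /-- the increments of the exact pressure -/
  incr : ℕ → Y
  /-- the part of the pressure error which is not in `Y` -/
  defect : ℕ → Q
  /-- the truncation errors -/
  res : ℕ → H
  vel_zero : vel 0 = 0
  corr_zero : corr 0 = 0
  press_zero : press 0 = 0
  divSum_zero : divSum 0 = 0
  incr_zero : incr 0 = 0
  press_succ : ∀ k < N, press (k + 1) = press k + incr (k + 1) - corr (k + 1)
  divSum_succ : ∀ k < N, divSum (k + 1) = divSum k + (1 / 2 : ℝ) • O.div (vel (k + 1) + vel k)
  momentum : ∀ k < N, ∀ w, τ⁻¹ * ⟪O.emb (vel (k + 1) - vel k), O.emb w⟫_ℝ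
    + 1 / 2 * ⟪O.grad (vel (k + 1) + vel k), O.grad w⟫_ℝ
    + τ / 4 * ⟪O.split (vel (k + 1) - vel k), O.split w⟫_ℝ
    - ⟪O.press (press k - corr k) - χ • divSum k + defect k, O.div w⟫_ℝ = ⟪res k, O.emb w⟫_ℝ
  penalty : ∀ k < N, ∀ q, ⟪O.div (vel (k + 1)), O.press q⟫_ℝ = τ * ⟪corr (k + 1), q⟫_ℝ

variable {O : SplittingOperators τ V H G K Q Y}

theorem SplittingOperators.mul_sq_norm_div_le (O : SplittingOperators τ V H G K Q Y)
    (hχ' : χ ≤ 1) (v : V) : χ * ‖O.div v‖ ^ 2 ≤ ‖O.grad v‖ ^ 2 :=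
  calc χ * ‖O.div v‖ ^ 2 ≤ 1 * ‖O.div v‖ ^ 2 := by gcongr
    _ ≤ ‖O.grad v‖ ^ 2 := by rw [one_mul]; gcongr; exact O.norm_div_le v

namespace ErrorSystem

/-! ### Energy estimate -/

/-- The energy of the time level `k`. The summand `divSum k + div (vel k) / 2`, and not `divSum k`,
is what the rotational term controls. -/
noncomputable def energy (s : ErrorSystem O χ N) (k : ℕ) : ℝ :=
  ‖O.emb (s.vel k)‖ ^ 2 + τ / 2 * (‖O.grad (s.vel k)‖ ^ 2 - χ * ‖O.div (s.vel k)‖ ^ 2)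
    + τ * χ * ‖s.divSum k + (1 / 2 : ℝ) • O.div (s.vel k)‖ ^ 2
    + τ ^ 2 / 4 * ‖O.split (s.vel k)‖ ^ 2 + τ ^ 2 * ‖s.press k‖ ^ 2

/-- The square root of the energy of the time level `k`. -/
noncomputable def energyNorm (s : ErrorSystem O χ N) (k : ℕ) : ℝ := √(s.energy k)

variable (s : ErrorSystem O χ N) {k : ℕ}

theorem penalty_sub (hk : k < N) (q : Y) :
    ⟪O.div (s.vel (k + 1) - s.vel k), O.press q⟫_ℝ = τ * ⟪s.corr (k + 1) - s.corr k, q⟫_ℝ := by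
  have penalty_here := s.penalty k hk q
  rcases k with _ | k
  · simpa only [s.vel_zero, s.corr_zero, sub_zero] using penalty_here
  · have penalty_before := s.penalty k (by omega) q
    rw [map_sub, inner_sub_left, inner_sub_left, penalty_here, penalty_before, mul_sub]

theorem mul_norm_corr_sub_le (hk : k < N) :
    τ * ‖s.corr (k + 1) - s.corr k‖ ≤ ‖O.emb (s.vel (k + 1) - s.vel k)‖ := by
  refine le_of_mul_sq_le_mul (norm_nonneg _) (norm_nonneg _) ?_
  rw [← real_inner_self_eq_norm_sq, ← s.penalty_sub hk]
  exact O.inner_div_press_le _ _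

theorem divSum_succ_add_half_div (hk : k < N) :
    s.divSum (k + 1) + (1 / 2 : ℝ) • O.div (s.vel (k + 1))
      = s.divSum k + (1 / 2 : ℝ) • O.div (s.vel k) + O.div (s.vel (k + 1)) := by
  rw [s.divSum_succ k hk, map_add]
  module

theorem two_mul_inner_corr_succ (hk : k < N) :
    2 * ⟪s.corr (k + 1), s.press k - s.corr k⟫_ℝ
      = ‖s.press k‖ ^ 2 - ‖s.press (k + 1)‖ ^ 2 + 2 * ⟪s.press (k + 1), s.incr (k + 1)⟫_ℝ
        - ‖s.incr (k + 1)‖ ^ 2 + ‖s.corr (k + 1) - s.corr k‖ ^ 2 - ‖s.corr k‖ ^ 2 := by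
  have press_eq : s.press k = s.press (k + 1) - s.incr (k + 1) + s.corr (k + 1) := by
    rw [s.press_succ k hk]; abel
  rw [press_eq, norm_add_sq_real, norm_sub_sq_real (s.press (k + 1)),
    norm_sub_sq_real (s.corr (k + 1)), inner_sub_right, inner_add_right,
    real_inner_self_eq_norm_sq, real_inner_comm (s.corr (k + 1))]
  ring

theorem two_mul_inner_divSum (hk : k < N) :
    2 * ⟪s.divSum k, O.div (s.vel (k + 1))⟫_ℝ
      = ‖s.divSum (k + 1) + (1 / 2 : ℝ) • O.div (s.vel (k + 1))‖ ^ 2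
        - ‖s.divSum k + (1 / 2 : ℝ) • O.div (s.vel k)‖ ^ 2
        - 1 / 2 * (‖O.div (s.vel (k + 1))‖ ^ 2 - ‖O.div (s.vel k)‖ ^ 2
          + ‖O.div (s.vel (k + 1) + s.vel k)‖ ^ 2) := by
  rw [s.divSum_succ_add_half_div hk, norm_add_sq_real _ (O.div (s.vel (k + 1))), map_add,
    ← two_mul_inner_add_left, inner_add_left, inner_add_left, real_inner_smul_left,
    real_inner_self_eq_norm_sq]
  ring

theorem energy_succ_add_dissipation (hk : k < N) :
    s.energy (k + 1)
      + (‖O.emb (s.vel (k + 1) - s.vel k)‖ ^ 2 - τ ^ 2 * ‖s.corr (k + 1) - s.corr k‖ ^ 2)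
      + τ / 2 * (‖O.grad (s.vel (k + 1) + s.vel k)‖ ^ 2
        - χ * ‖O.div (s.vel (k + 1) + s.vel k)‖ ^ 2)
      + τ ^ 2 / 4 * ‖O.split (s.vel (k + 1) - s.vel k)‖ ^ 2
      + τ ^ 2 * (‖s.corr k‖ ^ 2 + ‖s.incr (k + 1)‖ ^ 2)
    = s.energy k + 2 * τ * ⟪s.res k, O.emb (s.vel (k + 1))⟫_ℝ
      + 2 * τ ^ 2 * ⟪s.press (k + 1), s.incr (k + 1)⟫_ℝ
      + 2 * τ * ⟪s.defect k, O.div (s.vel (k + 1))⟫_ℝ := by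
  have tested := congrArg (2 * τ * ·) (s.momentum k hk (s.vel (k + 1)))
  have time_term := two_mul_inner_sub_left (O.emb (s.vel (k + 1))) (O.emb (s.vel k))
  have grad_term := two_mul_inner_add_left (O.grad (s.vel (k + 1))) (O.grad (s.vel k))
  have split_term := two_mul_inner_sub_left (O.split (s.vel (k + 1))) (O.split (s.vel k))
  have corr_term := s.penalty k hk (s.press k - s.corr k)
  have press_term := s.two_mul_inner_corr_succ hk
  have div_term := s.two_mul_inner_divSum hk
  have cancel : τ * τ⁻¹ = 1 := mul_inv_cancel₀ O.step_pos.ne'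
  rw [real_inner_comm] at corr_term
  simp only [← map_add, ← map_sub] at time_term grad_term split_term
  simp only [inner_add_left, inner_sub_left _ _ (O.div _), real_inner_smul_left,
    corr_term] at tested
  unfold energy
  linear_combination tested - time_term - τ / 2 * grad_term - τ ^ 2 / 4 * split_term
    + τ ^ 2 * press_term - τ * χ * div_term
    - 2 * ⟪O.emb (s.vel (k + 1) - s.vel k), O.emb (s.vel (k + 1))⟫_ℝ * cancel

theorem energy_succ_le (hχ' : χ ≤ 1) (hk : k < N) :
    s.energy (k + 1) ≤ s.energy k + 2 * τ * ⟪s.res k, O.emb (s.vel (k + 1))⟫_ℝ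
      + 2 * τ ^ 2 * ⟪s.press (k + 1), s.incr (k + 1)⟫_ℝ
      + 2 * τ * ⟪s.defect k, O.div (s.vel (k + 1))⟫_ℝ := by
  have hτ := O.step_pos
  rw [← s.energy_succ_add_dissipation hk]
  have corr_absorbed :
      τ ^ 2 * ‖s.corr (k + 1) - s.corr k‖ ^ 2 ≤ ‖O.emb (s.vel (k + 1) - s.vel k)‖ ^ 2 := by
    rw [← mul_pow]
    gcongr
    exact s.mul_norm_corr_sub_le hk
  have div_absorbed : 0 ≤ ‖O.grad (s.vel (k + 1) + s.vel k)‖ ^ 2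
      - χ * ‖O.div (s.vel (k + 1) + s.vel k)‖ ^ 2 := sub_nonneg.2 (O.mul_sq_norm_div_le hχ' _)
  have := mul_nonneg (half_pos hτ).le div_absorbed
  have split_nonneg : 0 ≤ τ ^ 2 / 4 * ‖O.split (s.vel (k + 1) - s.vel k)‖ ^ 2 := by positivity
  have press_nonneg : 0 ≤ τ ^ 2 * (‖s.corr k‖ ^ 2 + ‖s.incr (k + 1)‖ ^ 2) := by positivity
  linarith

theorem energyNorm_nonneg : 0 ≤ s.energyNorm k := Real.sqrt_nonneg _

theorem energyNorm_zero : s.energyNorm 0 = 0 := by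
  simp [energyNorm, energy, s.vel_zero, s.press_zero, s.divSum_zero]

section EnergyNorm

variable (hχ : 0 < χ) (hχ' : χ ≤ 1)

include hχ hχ'

theorem sq_energyNorm : s.energyNorm k ^ 2 = s.energy k := by
  have hτ := O.step_pos
  have := sub_nonneg.2 (O.mul_sq_norm_div_le hχ' (s.vel k))
  refine Real.sq_sqrt ?_
  unfold energy
  positivity

theorem sum_sq_le_sq_energyNorm :
    ‖O.emb (s.vel k)‖ ^ 2 + (√(τ * χ) * ‖s.divSum k + (1 / 2 : ℝ) • O.div (s.vel k)‖) ^ 2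
      + (τ / 2 * ‖O.split (s.vel k)‖) ^ 2 + (τ * ‖s.press k‖) ^ 2 ≤ s.energyNorm k ^ 2 := by
  have hτ := O.step_pos
  have div_absorbed := sub_nonneg.2 (O.mul_sq_norm_div_le hχ' (s.vel k))
  have := mul_nonneg (half_pos hτ).le div_absorbed
  rw [s.sq_energyNorm hχ hχ', energy, mul_pow √_, Real.sq_sqrt (by positivity)]
  linarith

theorem norm_emb_vel_le : ‖O.emb (s.vel k)‖ ≤ s.energyNorm k :=
  le_of_sq_le_sq (by nlinarith [s.sum_sq_le_sq_energyNorm hχ hχ' (k := k)]) s.energyNorm_nonneg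

theorem sqrt_mul_norm_div_le :
    √(τ * χ) * ‖s.divSum k + (1 / 2 : ℝ) • O.div (s.vel k)‖ ≤ s.energyNorm k :=
  le_of_sq_le_sq (by nlinarith [s.sum_sq_le_sq_energyNorm hχ hχ' (k := k)]) s.energyNorm_nonneg

theorem mul_norm_split_vel_le : τ / 2 * ‖O.split (s.vel k)‖ ≤ s.energyNorm k :=
  le_of_sq_le_sq (by nlinarith [s.sum_sq_le_sq_energyNorm hχ hχ' (k := k)]) s.energyNorm_nonneg

theorem mul_norm_press_le : τ * ‖s.press k‖ ≤ s.energyNorm k :=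
  le_of_sq_le_sq (by nlinarith [s.sum_sq_le_sq_energyNorm hχ hχ' (k := k)]) s.energyNorm_nonneg

theorem mul_sq_norm_grad_vel_le :
    τ / 2 * ‖O.grad (s.vel k)‖ ^ 2
      ≤ s.energyNorm k ^ 2 + τ / 2 * (χ * ‖O.div (s.vel k)‖ ^ 2) := by
  have hτ := O.step_pos
  have rest_nonneg : 0 ≤ ‖O.emb (s.vel k)‖ ^ 2
      + τ * χ * ‖s.divSum k + (1 / 2 : ℝ) • O.div (s.vel k)‖ ^ 2
      + τ ^ 2 / 4 * ‖O.split (s.vel k)‖ ^ 2 + τ ^ 2 * ‖s.press k‖ ^ 2 := by positivity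
  rw [s.sq_energyNorm hχ hχ', energy]
  linarith

theorem energyNorm_succ_le (hk : k < N) (hdefect : s.defect k = 0) :
    s.energyNorm (k + 1) ≤ s.energyNorm k + 2 * (τ * (‖s.res k‖ + ‖s.incr (k + 1)‖)) := by
  have hτ := O.step_pos
  refine le_add_of_sq_le s.energyNorm_nonneg (by positivity) ?_
  have energy_le := s.energy_succ_le hχ' hk
  rw [← s.sq_energyNorm hχ hχ', ← s.sq_energyNorm hχ hχ', hdefect, inner_zero_left] at energy_le
  have res_le : ⟪s.res k, O.emb (s.vel (k + 1))⟫_ℝ ≤ ‖s.res k‖ * s.energyNorm (k + 1) :=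
    inner_le_of_norm_le le_rfl (s.norm_emb_vel_le hχ hχ')
  have incr_le : τ * ⟪s.press (k + 1), s.incr (k + 1)⟫_ℝ
      ≤ s.energyNorm (k + 1) * ‖s.incr (k + 1)‖ := by
    rw [← real_inner_smul_left]
    refine inner_le_of_norm_le ?_ le_rfl
    rw [norm_smul, Real.norm_of_nonneg hτ.le]
    exact s.mul_norm_press_le hχ hχ'
  linarith [mul_le_mul_of_nonneg_left res_le hτ.le, mul_le_mul_of_nonneg_left incr_le hτ.le]

theorem energyNorm_le_sum (hdefect : ∀ k < N, s.defect k = 0) (hk : k ≤ N) :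
    s.energyNorm k ≤ 2 * τ * ∑ i ∈ Finset.range k, (‖s.res i‖ + ‖s.incr (i + 1)‖) := by
  induction k with
  | zero => simp only [s.energyNorm_zero, Finset.range_zero, Finset.sum_empty, mul_zero, le_refl]
  | succ k ih =>
    have step := s.energyNorm_succ_le hχ hχ' (k := k) (by omega) (hdefect k (by omega))
    have previous := ih (by omega)
    rw [Finset.sum_range_succ]
    linarith

/-! ### Response to the initial pressure error -/

section Initial

variable (hincr : ∀ k < N, s.incr (k + 1) = 0) (hres : ∀ k < N, s.res k = 0)

include hincr hres

theorem sqrt_mul_energyNorm_one_le (hN : 0 < N) :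
    √(τ * χ) * s.energyNorm 1 ≤ 2 * τ * ‖s.defect 0‖ := by
  have hτ := O.step_pos
  refine le_of_mul_sq_le_mul (by positivity) s.energyNorm_nonneg ?_
  have energy_le := s.energy_succ_le hχ' hN
  rw [← s.sq_energyNorm hχ hχ', ← s.sq_energyNorm hχ hχ', s.energyNorm_zero, hincr 0 hN,
    hres 0 hN, inner_zero_left, inner_zero_right, zero_add] at energy_le
  have div_le := s.sqrt_mul_norm_div_le hχ hχ' (k := 1)
  have div_eq := s.divSum_succ_add_half_div hN
  rw [zero_add, s.divSum_zero, s.vel_zero, map_zero, smul_zero, zero_add, zero_add] at div_eq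
  rw [div_eq] at div_le
  calc √(τ * χ) * s.energyNorm 1 ^ 2
      ≤ √(τ * χ) * (2 * τ * ⟪s.defect 0, O.div (s.vel 1)⟫_ℝ) := by
        gcongr; linarith
    _ ≤ √(τ * χ) * (2 * τ * (‖s.defect 0‖ * ‖O.div (s.vel 1)‖)) := by
        gcongr; exact real_inner_le_norm _ _
    _ = 2 * τ * ‖s.defect 0‖ * (√(τ * χ) * ‖O.div (s.vel 1)‖) := by ring
    _ ≤ 2 * τ * ‖s.defect 0‖ * s.energyNorm 1 := by gcongr

variable (hdefect : ∀ k < N, s.defect (k + 1) = 0)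

include hdefect

theorem sqrt_mul_energyNorm_le_of_initial (hk : k ≤ N) :
    √(τ * χ) * s.energyNorm k ≤ 2 * τ * ‖s.defect 0‖ := by
  have hτ := O.step_pos
  induction k with
  | zero => rw [s.energyNorm_zero, mul_zero]; positivity
  | succ k ih =>
    rcases k with _ | k
    · exact s.sqrt_mul_energyNorm_one_le hχ hχ' hincr hres hk
    · have step := s.energyNorm_succ_le hχ hχ' (k := k + 1) hk (hdefect k (by omega))
      rw [hincr _ hk, hres _ hk, norm_zero, norm_zero, add_zero, mul_zero, mul_zero,
        add_zero] at step
      exact (mul_le_mul_of_nonneg_left step (Real.sqrt_nonneg _)).trans (ih (by omega))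

theorem mul_norm_divSum_add_half_div_le_of_initial (hk : k ≤ N) :
    χ * ‖s.divSum k + (1 / 2 : ℝ) • O.div (s.vel k)‖ ≤ 2 * ‖s.defect 0‖ := by
  have hτ := O.step_pos
  refine le_of_mul_le_mul_left ?_ hτ
  calc τ * (χ * ‖s.divSum k + (1 / 2 : ℝ) • O.div (s.vel k)‖)
      = √(τ * χ) * (√(τ * χ) * ‖s.divSum k + (1 / 2 : ℝ) • O.div (s.vel k)‖) := by
        rw [← mul_assoc, ← mul_assoc, Real.mul_self_sqrt (by positivity)]
    _ ≤ √(τ * χ) * s.energyNorm k := by gcongr; exact s.sqrt_mul_norm_div_le hχ hχ'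
    _ ≤ τ * (2 * ‖s.defect 0‖) := by
        linarith [s.sqrt_mul_energyNorm_le_of_initial hχ hχ' hincr hres hdefect hk]

theorem mul_norm_div_vel_le_of_initial (hk : k < N) :
    χ * ‖O.div (s.vel (k + 1))‖ ≤ 4 * ‖s.defect 0‖ := by
  have bound_succ :=
    s.mul_norm_divSum_add_half_div_le_of_initial hχ hχ' hincr hres hdefect (k := k + 1) hk
  have bound :=
    s.mul_norm_divSum_add_half_div_le_of_initial hχ hχ' hincr hres hdefect (k := k) hk.le
  rw [eq_sub_of_add_eq' (s.divSum_succ_add_half_div hk).symm]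
  refine (mul_le_mul_of_nonneg_left (norm_sub_le _ _) hχ.le).trans ?_
  linarith

theorem mul_norm_grad_vel_le_of_initial (hk : k ≤ N) :
    χ * ‖O.grad (s.vel k)‖ ≤ 5 * ‖s.defect 0‖ := by
  rcases k with _ | k
  · rw [s.vel_zero, map_zero, norm_zero, mul_zero]; positivity
  have hτ := O.step_pos
  set z := ‖s.defect 0‖
  have energy_sq : τ * (χ * s.energyNorm (k + 1) ^ 2) ≤ τ * (4 * τ * z ^ 2) :=
    calc τ * (χ * s.energyNorm (k + 1) ^ 2) = (√(τ * χ) * s.energyNorm (k + 1)) ^ 2 := by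
          rw [mul_pow, Real.sq_sqrt (by positivity), mul_assoc]
      _ ≤ (2 * τ * z) ^ 2 :=
          pow_le_pow_left₀ (mul_nonneg (Real.sqrt_nonneg _) s.energyNorm_nonneg)
            (s.sqrt_mul_energyNorm_le_of_initial hχ hχ' hincr hres hdefect hk) 2
      _ = τ * (4 * τ * z ^ 2) := by ring
  have div_sq : (χ * ‖O.div (s.vel (k + 1))‖) ^ 2 ≤ (4 * z) ^ 2 :=
    pow_le_pow_left₀ (by positivity)
      (s.mul_norm_div_vel_le_of_initial hχ hχ' hincr hres hdefect hk) 2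
  refine le_of_sq_le_sq (le_of_mul_le_mul_left ?_ (half_pos hτ)) (by positivity)
  calc τ / 2 * (χ * ‖O.grad (s.vel (k + 1))‖) ^ 2
      = χ ^ 2 * (τ / 2 * ‖O.grad (s.vel (k + 1))‖ ^ 2) := by ring
    _ ≤ χ ^ 2 * (s.energyNorm (k + 1) ^ 2 + τ / 2 * (χ * ‖O.div (s.vel (k + 1))‖ ^ 2)) := by
        gcongr; exact s.mul_sq_norm_grad_vel_le hχ hχ'
    _ = χ * (χ * s.energyNorm (k + 1) ^ 2)
        + χ * (τ / 2 * (χ * ‖O.div (s.vel (k + 1))‖) ^ 2) := by ring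
    _ ≤ 1 * (4 * τ * z ^ 2) + 1 * (τ / 2 * (4 * z) ^ 2) :=
        add_le_add
          (mul_le_mul hχ' (le_of_mul_le_mul_left energy_sq hτ) (by positivity) one_pos.le)
          (mul_le_mul hχ' (by gcongr) (by positivity) one_pos.le)
    _ ≤ τ / 2 * (5 * z) ^ 2 := by nlinarith [mul_nonneg hτ.le (sq_nonneg z)]

end Initial

end EnergyNorm

end ErrorSystem

end AbstractScheme

/-! ### Increments of the error system -/

section Increments

/-- The backward increments of a sequence, starting with its first term. -/
def increments {M : Type*} [AddCommGroup M] (x : ℕ → M) : ℕ → M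
  | 0 => x 0
  | k + 1 => x (k + 1) - x k

variable {F : Type*} [NormedAddCommGroup F] {x : ℕ → F} {a b : ℝ} {N k : ℕ}

theorem norm_increments_le (hx : ∀ k < N, ‖x k‖ ≤ a) (hk : k < N) :
    ‖increments x k‖ ≤ 2 * a := by
  rcases k with _ | k
  · change ‖x 0‖ ≤ _
    linarith [hx 0 hk, norm_nonneg (x 0)]
  · exact (norm_sub_le _ _).trans (by linarith [hx (k + 1) hk, hx k (by omega)])

theorem sum_norm_sub_le (hx0 : x 0 = 0) (hx : ∀ k ≤ N, ‖x k‖ ≤ a) (hb : 0 ≤ b)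
    (hxb : ∀ k, k + 3 ≤ N → ‖x (k + 3) - x (k + 2)‖ ≤ b) (hk : k ≤ N) :
    ∑ i ∈ Finset.range k, ‖x (i + 1) - x i‖ ≤ 3 * a + k * b := by
  have ha : 0 ≤ a := (norm_nonneg _).trans (hx 0 (Nat.zero_le _))
  induction k with
  | zero => simpa using ha
  | succ k ih =>
    have previous := ih (by omega)
    rcases k with _ | _ | k
    · have := hx 1 hk
      norm_num [hx0]
      linarith
    · have := norm_sub_le (x 2) (x 1)
      have := hx 1 (by omega)
      have := hx 2 hk
      norm_num [Finset.sum_range_succ, hx0]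
      linarith
    · rw [Finset.sum_range_succ]
      push_cast at previous ⊢
      linarith [hxb k hk]

end Increments

section AbstractScheme

variable {V H G K Q Y : Type*}
  [NormedAddCommGroup V] [InnerProductSpace ℝ V] [NormedAddCommGroup H] [InnerProductSpace ℝ H]
  [NormedAddCommGroup G] [InnerProductSpace ℝ G] [NormedAddCommGroup K] [InnerProductSpace ℝ K]
  [NormedAddCommGroup Q] [InnerProductSpace ℝ Q] [NormedAddCommGroup Y] [InnerProductSpace ℝ Y]
  {τ χ : ℝ} {N : ℕ} {O : SplittingOperators τ V H G K Q Y}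

namespace ErrorSystem

variable (s : ErrorSystem O χ N)

/-- The difference of two error systems. -/
def sub (s s' : ErrorSystem O χ N) : ErrorSystem O χ N where
  vel := s.vel - s'.vel
  corr := s.corr - s'.corr
  press := s.press - s'.press
  divSum := s.divSum - s'.divSum
  incr := s.incr - s'.incr
  defect := s.defect - s'.defect
  res := s.res - s'.res
  vel_zero := by simp [s.vel_zero, s'.vel_zero]
  corr_zero := by simp [s.corr_zero, s'.corr_zero]
  press_zero := by simp [s.press_zero, s'.press_zero]
  divSum_zero := by simp [s.divSum_zero, s'.divSum_zero]
  incr_zero := by simp [s.incr_zero, s'.incr_zero]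
  press_succ k hk := by
    simp only [Pi.sub_apply, s.press_succ k hk, s'.press_succ k hk]
    abel
  divSum_succ k hk := by
    simp only [Pi.sub_apply, s.divSum_succ k hk, s'.divSum_succ k hk, map_add, map_sub]
    module
  momentum k hk w := by
    have minuend := s.momentum k hk w
    have subtrahend := s'.momentum k hk w
    simp only [Pi.sub_apply, map_add, map_sub, inner_add_left, inner_sub_left,
      real_inner_smul_left, smul_sub] at minuend subtrahend ⊢
    linarith
  penalty k hk q := by
    have minuend := s.penalty k hk q
    have subtrahend := s'.penalty k hk q
    simp only [Pi.sub_apply, map_sub, inner_sub_left] at minuend subtrahend ⊢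
    linarith

/-- The error system which is solved by the increments of an error system. -/
def increments : ErrorSystem O χ N where
  vel := DirSplit.increments s.vel
  corr := DirSplit.increments s.corr
  press := DirSplit.increments s.press
  divSum := DirSplit.increments s.divSum
  incr := DirSplit.increments s.incr
  defect := DirSplit.increments s.defect
  res := DirSplit.increments s.res
  vel_zero := s.vel_zero
  corr_zero := s.corr_zero
  press_zero := s.press_zero
  divSum_zero := s.divSum_zero
  incr_zero := s.incr_zero
  press_succ k hk := by
    rcases k with _ | k
    · simp [DirSplit.increments, s.press_succ 0 hk, s.press_zero, s.incr_zero, s.corr_zero]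
    · simp only [DirSplit.increments, s.press_succ (k + 1) hk, s.press_succ k (by omega)]
      abel
  divSum_succ k hk := by
    rcases k with _ | k
    · simp [DirSplit.increments, s.divSum_succ 0 hk, s.divSum_zero, s.vel_zero]
    · simp only [DirSplit.increments, s.divSum_succ (k + 1) hk, s.divSum_succ k (by omega),
        map_add, map_sub]
      module
  momentum k hk w := by
    rcases k with _ | k
    · simpa [DirSplit.increments, s.divSum_zero, s.vel_zero, s.press_zero, s.corr_zero]
        using s.momentum 0 hk w
    · have momentum_succ := s.momentum (k + 1) hk w
      have momentum_here := s.momentum k (by omega) w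
      simp only [DirSplit.increments, map_add, map_sub, inner_add_left, inner_sub_left,
        real_inner_smul_left, smul_sub] at momentum_succ momentum_here ⊢
      linarith
  penalty k hk q := s.penalty_sub hk q

end ErrorSystem

section Existence

variable [CompleteSpace V]

theorem SplittingOperators.exists_vel [CompleteSpace H] [CompleteSpace G] [CompleteSpace K]
    [CompleteSpace Q] (O : SplittingOperators τ V H G K Q Y) (v : V) (q : Q) :
    ∃ u, ∀ w, τ⁻¹ * ⟪O.emb (u - v), O.emb w⟫_ℝ + 1 / 2 * ⟪O.grad (u + v), O.grad w⟫_ℝ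
      + τ / 4 * ⟪O.split (u - v), O.split w⟫_ℝ = ⟪q, O.div w⟫_ℝ := by
  set u := τ⁻¹ • O.emb.adjoint (O.emb v) - (1 / 2 : ℝ) • O.grad.adjoint (O.grad v)
    + (τ / 4) • O.split.adjoint (O.split v) + O.div.adjoint q with u_def
  refine ⟨u, fun w => ?_⟩
  have riesz : ⟪u, w⟫_ℝ = τ⁻¹ * ⟪O.emb v, O.emb w⟫_ℝ - 1 / 2 * ⟪O.grad v, O.grad w⟫_ℝ
      + τ / 4 * ⟪O.split v, O.split w⟫_ℝ + ⟪q, O.div w⟫_ℝ := by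
    simp only [u_def, inner_add_left, inner_sub_left, real_inner_smul_left,
      ContinuousLinearMap.adjoint_inner_left]
  rw [O.inner_eq] at riesz
  simp only [map_sub, map_add, inner_sub_left, inner_add_left]
  linarith

omit [CompleteSpace V] in
theorem SplittingOperators.exists_corr [CompleteSpace Q] [CompleteSpace Y]
    (O : SplittingOperators τ V H G K Q Y) (v : V) :
    ∃ φ, ∀ q, ⟪O.div v, O.press q⟫_ℝ = τ * ⟪φ, q⟫_ℝ := by
  refine ⟨τ⁻¹ • O.press.adjoint (O.div v), fun q => ?_⟩
  rw [real_inner_smul_left, ContinuousLinearMap.adjoint_inner_left,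
    mul_inv_cancel_left₀ O.step_pos.ne']

theorem exists_errorSystem_defect_eq [CompleteSpace H] [CompleteSpace G] [CompleteSpace K]
    [CompleteSpace Q] [CompleteSpace Y] (O : SplittingOperators τ V H G K Q Y) (Z : ℕ → Q) :
    ∃ s : ErrorSystem O χ N, s.defect = Z ∧ s.incr = 0 ∧ s.res = 0 := by
  choose nextVel nextVel_spec using O.exists_vel
  choose nextCorr nextCorr_spec using O.exists_corr
  let vel (k : ℕ) (x : V × Y × Y × Q) : V :=
    nextVel x.1 (O.press (x.2.2.1 - x.2.1) - χ • x.2.2.2 + Z k)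
  let x : ℕ → V × Y × Y × Q := fun k => Nat.rec 0 (fun k x => (vel k x, nextCorr (vel k x),
    x.2.2.1 - nextCorr (vel k x), x.2.2.2 + (1 / 2 : ℝ) • O.div (vel k x + x.1))) k
  exact ⟨{
    vel := fun k => (x k).1
    corr := fun k => (x k).2.1
    press := fun k => (x k).2.2.1
    divSum := fun k => (x k).2.2.2
    incr := 0
    defect := Z
    res := 0
    vel_zero := rfl
    corr_zero := rfl
    press_zero := rfl
    divSum_zero := rfl
    incr_zero := rfl
    press_succ := fun k _ => by rw [Pi.zero_apply, add_zero]
    divSum_succ := fun k _ => rfl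
    momentum := fun k _ w => by
      rw [Pi.zero_apply, inner_zero_left, sub_eq_zero]
      exact nextVel_spec (x k).1 _ w
    penalty := fun k _ => nextCorr_spec (vel k (x k)) }, rfl, rfl, rfl⟩

end Existence

namespace ErrorSystem

variable (s : ErrorSystem O χ N) {k : ℕ}

/-! ### Gradient bound for the averaged velocity error -/

/-- The velocity error averaged over the time levels `k` and `k + 1`. -/
noncomputable def midVel (k : ℕ) : V := (1 / 2 : ℝ) • (s.vel (k + 1) + s.vel k)

theorem inner_press_div_midVel (hk : k < N) (q : Y) :
    ⟪O.press q, O.div (s.midVel k)⟫_ℝ = τ / 2 * ⟪s.corr (k + 1) + s.corr k, q⟫_ℝ := by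
  have penalty_succ := s.penalty k hk q
  have penalty_sub := s.penalty_sub hk q
  rw [real_inner_comm, midVel, map_smul, real_inner_smul_left]
  simp only [map_add, map_sub, inner_add_left, inner_sub_left] at penalty_succ penalty_sub ⊢
  linarith

theorem sq_norm_grad_midVel (hk : k < N) (hdefect : s.defect k = 0) :
    ‖O.grad (s.midVel k)‖ ^ 2 =
      τ⁻¹ * -⟪O.emb (s.vel (k + 1) - s.vel k), O.emb (s.midVel k)⟫_ℝ
        + τ / 4 * -⟪O.split (s.vel (k + 1) - s.vel k), O.split (s.midVel k)⟫_ℝ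
        + τ / 2 * ⟪s.corr (k + 1) + s.corr k, s.press k - s.corr k⟫_ℝ
        + χ * -⟪s.divSum k, O.div (s.midVel k)⟫_ℝ + ⟪s.res k, O.emb (s.midVel k)⟫_ℝ := by
  have tested := s.momentum k hk (s.midVel k)
  have grad_term : 1 / 2 * ⟪O.grad (s.vel (k + 1) + s.vel k), O.grad (s.midVel k)⟫_ℝ
      = ‖O.grad (s.midVel k)‖ ^ 2 := by
    rw [← real_inner_self_eq_norm_sq, ← real_inner_smul_left, ← map_smul, midVel]
  rw [grad_term, hdefect, add_zero, inner_sub_left, real_inner_smul_left,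
    s.inner_press_div_midVel hk] at tested
  linarith

section Bounds

variable (hχ : 0 < χ) (hχ' : χ ≤ 1)

include hχ hχ'

theorem mul_norm_corr_succ_le (hk : k < N) :
    τ * ‖s.corr (k + 1)‖ ≤ τ * ‖s.incr (k + 1)‖ + s.increments.energyNorm (k + 1) := by
  have corr_eq : s.corr (k + 1) = s.incr (k + 1) - s.increments.press (k + 1) := by
    change _ = _ - (s.press (k + 1) - s.press k)
    rw [s.press_succ k hk]
    abel
  calc τ * ‖s.corr (k + 1)‖ ≤ τ * (‖s.incr (k + 1)‖ + ‖s.increments.press (k + 1)‖) := by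
        rw [corr_eq]
        exact mul_le_mul_of_nonneg_left (norm_sub_le _ _) O.step_pos.le
    _ ≤ τ * ‖s.incr (k + 1)‖ + s.increments.energyNorm (k + 1) := by
        rw [mul_add]
        exact add_le_add_right (s.increments.mul_norm_press_le hχ hχ') _

theorem sqrt_mul_norm_div_vel_le (hk : k ≤ N) :
    √(τ * χ) * ‖O.div (s.vel k)‖ ≤ s.increments.energyNorm k := by
  rcases k with _ | k
  · rw [s.vel_zero, map_zero, norm_zero, mul_zero]
    exact s.increments.energyNorm_nonneg
  · have div_eq : s.increments.divSum (k + 1) + (1 / 2 : ℝ) • O.div (s.increments.vel (k + 1))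
        = O.div (s.vel (k + 1)) := by
      change s.divSum (k + 1) - s.divSum k + (1 / 2 : ℝ) • O.div (s.vel (k + 1) - s.vel k) = _
      rw [s.divSum_succ k hk, map_add, map_sub]
      module
    exact div_eq ▸ s.increments.sqrt_mul_norm_div_le hχ hχ'

variable {A B : ℝ} (hA : ∀ k ≤ N, s.energyNorm k ≤ A)
  (hB : ∀ k ≤ N, s.increments.energyNorm k ≤ B)

include hA

theorem norm_emb_midVel_le (hk : k < N) : ‖O.emb (s.midVel k)‖ ≤ A := by
  rw [midVel, map_smul, map_add]
  exact norm_half_smul_add_le ((s.norm_emb_vel_le hχ hχ').trans (hA _ hk))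
    ((s.norm_emb_vel_le hχ hχ').trans (hA _ hk.le))

theorem norm_split_midVel_le (hk : k < N) : ‖O.split (s.midVel k)‖ ≤ 2 * A / τ := by
  have split_le (i : ℕ) (hi : i ≤ N) : ‖O.split (s.vel i)‖ ≤ 2 * A / τ := by
    rw [le_div_iff₀ O.step_pos]
    linarith [(s.mul_norm_split_vel_le hχ hχ').trans (hA i hi)]
  rw [midVel, map_smul, map_add]
  exact norm_half_smul_add_le (split_le _ hk) (split_le _ hk.le)

include hB

theorem neg_inner_divSum_div_midVel_le (hk : k < N) :
    χ * -⟪s.divSum k, O.div (s.midVel k)⟫_ℝ ≤ (A + B) * B / τ := by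
  have hτ := O.step_pos
  set r := √(τ * χ)
  have norm_smul_r {q : Q} : ‖r • q‖ = r * ‖q‖ := by
    rw [norm_smul, Real.norm_of_nonneg (Real.sqrt_nonneg _)]
  have div_le (i : ℕ) (hi : i ≤ N) : ‖r • O.div (s.vel i)‖ ≤ B :=
    norm_smul_r.trans_le ((s.sqrt_mul_norm_div_vel_le hχ hχ' hi).trans (hB i hi))
  have div_mid_le : ‖r • O.div (s.midVel k)‖ ≤ B := by
    rw [midVel, map_smul, map_add, smul_comm, smul_add]
    exact norm_half_smul_add_le (div_le _ hk) (div_le _ hk.le)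
  have divSum_le : ‖r • s.divSum k‖ ≤ A + B := by
    have shift : r • s.divSum k = r • (s.divSum k + (1 / 2 : ℝ) • O.div (s.vel k))
        - (1 / 2 : ℝ) • r • O.div (s.vel k) := by module
    have shifted_le := norm_smul_r.trans_le ((s.sqrt_mul_norm_div_le hχ hχ').trans (hA k hk.le))
    rw [shift]
    refine (norm_sub_le _ _).trans (add_le_add shifted_le ?_)
    rw [norm_smul, Real.norm_of_nonneg one_half_pos.le]
    linarith [div_le k hk.le, norm_nonneg (r • O.div (s.vel k))]
  have scaled := neg_inner_le_of_norm_le divSum_le div_mid_le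
  rw [real_inner_smul_left, real_inner_smul_right, ← mul_assoc,
    Real.mul_self_sqrt (by positivity)] at scaled
  rw [le_div_iff₀ hτ]
  linarith

theorem sq_norm_grad_midVel_le {P r : ℝ} (hP : ∀ k ≤ N, ‖s.corr k‖ ≤ P) (hk : k < N)
    (hr : ‖s.res k‖ ≤ r) (hdefect : s.defect k = 0) :
    ‖O.grad (s.midVel k)‖ ^ 2 ≤ (3 * A * B + B ^ 2) / τ + P * (A + τ * P) + r * A := by
  have hτ := O.step_pos
  have emb_incr_le : ‖O.emb (s.vel (k + 1) - s.vel k)‖ ≤ B :=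
    (s.increments.norm_emb_vel_le hχ hχ' (k := k + 1)).trans (hB _ hk)
  have split_incr_le : ‖O.split (s.vel (k + 1) - s.vel k)‖ ≤ 2 * B / τ := by
    rw [le_div_iff₀ hτ]
    have := (s.increments.mul_norm_split_vel_le hχ hχ' (k := k + 1)).trans (hB _ hk)
    change τ / 2 * ‖O.split (s.vel (k + 1) - s.vel k)‖ ≤ B at this
    linarith
  have corr_add_le : ‖s.corr (k + 1) + s.corr k‖ ≤ 2 * P :=
    (norm_add_le _ _).trans (by linarith [hP _ hk, hP _ hk.le])
  have press_le : ‖s.press k‖ ≤ A / τ := by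
    rw [le_div_iff₀' hτ]
    exact (s.mul_norm_press_le hχ hχ').trans (hA k hk.le)
  have time_term := neg_inner_le_of_norm_le emb_incr_le (s.norm_emb_midVel_le hχ hχ' hA hk)
  have split_term := neg_inner_le_of_norm_le split_incr_le (s.norm_split_midVel_le hχ hχ' hA hk)
  have press_term := inner_le_of_norm_le corr_add_le
    ((norm_sub_le _ _).trans (add_le_add press_le (hP k hk.le)))
  have res_term := inner_le_of_norm_le hr (s.norm_emb_midVel_le hχ hχ' hA hk)
  calc ‖O.grad (s.midVel k)‖ ^ 2
      ≤ τ⁻¹ * (B * A) + τ / 4 * (2 * B / τ * (2 * A / τ)) + τ / 2 * (2 * P * (A / τ + P))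
        + (A + B) * B / τ + r * A := by
        rw [s.sq_norm_grad_midVel hk hdefect]
        have div_term := s.neg_inner_divSum_div_midVel_le hχ hχ' hA hB hk
        gcongr
    _ = (3 * A * B + B ^ 2) / τ + P * (A + τ * P) + r * A := by field_simp; ring

end Bounds

end ErrorSystem

/-! ### Error bound for the abstract scheme -/

/-- The constant in the bound of the energy norm by the time step. -/
def energyConst (T CR Cd : ℝ) : ℝ := 2 * T * (CR * T + Cd)

/-- The constant in the bound of the energy norm of the increments by the square of the time
step. -/
def incrementConst (T CR Cd : ℝ) : ℝ := 2 * (2 * T * CR + 3 * Cd + T * Cd)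

/-- The constant in the bound of the pressure corrections by the time step. -/
def corrConst (T CR Cd : ℝ) : ℝ := Cd + incrementConst T CR Cd

/-- The constant in the error bound for consistent initial data. -/
def errorConst (T CR Cd : ℝ) : ℝ :=
  let K₁ := energyConst T CR Cd
  let K₂ := incrementConst T CR Cd
  let K₃ := corrConst T CR Cd
  3 * K₁ * K₂ + K₂ ^ 2 * T + K₃ * (K₁ + K₃ * T) + CR * K₁ * T

namespace ErrorSystem

variable {k : ℕ} {T CR Cd : ℝ} (s : ErrorSystem O χ N)

section Consistent

variable (hχ : 0 < χ) (hχ' : χ ≤ 1) (hT : N * τ ≤ T) (hCR : 0 ≤ CR)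
  (hres : ∀ k < N, ‖s.res k‖ ≤ CR * τ ^ 2) (hincr : ∀ k ≤ N, ‖s.incr k‖ ≤ Cd * τ)
  (hincr' : ∀ k, k + 3 ≤ N → ‖s.incr (k + 3) - s.incr (k + 2)‖ ≤ Cd * τ ^ 2)
  (hdefect : ∀ k < N, s.defect k = 0)

theorem step_le_of_lt (O : SplittingOperators τ V H G K Q Y) (hT : N * τ ≤ T) (hk : k < N) :
    τ ≤ T := by
  have : (1 : ℝ) ≤ N := by exact_mod_cast (Nat.zero_le k).trans_lt hk
  nlinarith [O.step_pos]

include hincr in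
theorem incrBound_nonneg : 0 ≤ Cd :=
  nonneg_of_mul_nonneg_left ((norm_nonneg _).trans (hincr 0 (Nat.zero_le _))) O.step_pos

include hχ hχ' hT hCR hres hincr hdefect

theorem energyNorm_le_of_bounds (hk : k ≤ N) : s.energyNorm k ≤ energyConst T CR Cd * τ := by
  have hτ := O.step_pos
  have hCd := s.incrBound_nonneg hincr
  have hT0 : 0 ≤ T := (by positivity : 0 ≤ N * τ).trans hT
  have source_le : ∀ i ∈ Finset.range k,
      ‖s.res i‖ + ‖s.incr (i + 1)‖ ≤ (CR * T + Cd) * τ := by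
    intro i hi
    have hi := (Finset.mem_range.1 hi).trans_le hk
    have hτT := step_le_of_lt O hT hi
    calc ‖s.res i‖ + ‖s.incr (i + 1)‖ ≤ CR * (τ * τ) + Cd * τ := by
          rw [← sq]; exact add_le_add (hres i hi) (hincr _ hi)
      _ ≤ CR * (T * τ) + Cd * τ := by gcongr
      _ = (CR * T + Cd) * τ := by ring
  have sum_le := Finset.sum_le_card_nsmul _ _ _ source_le
  rw [Finset.card_range, nsmul_eq_mul] at sum_le
  calc s.energyNorm k ≤ 2 * τ * (k * ((CR * T + Cd) * τ)) :=
        (s.energyNorm_le_sum hχ hχ' hdefect hk).trans (by gcongr)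
    _ = 2 * (k * τ) * (CR * T + Cd) * τ := by ring
    _ ≤ 2 * T * (CR * T + Cd) * τ := by
        have : (k : ℝ) * τ ≤ T := le_trans (by gcongr) hT
        gcongr

include hincr'

theorem energyNorm_increments_le_of_bounds (hk : k ≤ N) :
    s.increments.energyNorm k ≤ incrementConst T CR Cd * τ ^ 2 := by
  have hτ := O.step_pos
  have hCd := s.incrBound_nonneg hincr
  have defect_eq : ∀ i < N, s.increments.defect i = 0 := fun i hi =>
    norm_le_zero_iff.1 ((norm_increments_le (a := 0)
      (fun j hj => (norm_eq_zero.2 (hdefect j hj)).le) hi).trans_eq (mul_zero 2))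
  have res_sum_le := Finset.sum_le_card_nsmul (Finset.range k) (fun i => ‖s.increments.res i‖) _
    fun i hi => norm_increments_le hres ((Finset.mem_range.1 hi).trans_le hk)
  rw [Finset.card_range, nsmul_eq_mul] at res_sum_le
  have incr_sum_le := sum_norm_sub_le s.incr_zero hincr (by positivity) hincr' hk
  have energy_le := s.increments.energyNorm_le_sum hχ hχ' defect_eq hk
  rw [Finset.sum_add_distrib] at energy_le
  calc s.increments.energyNorm k
      ≤ 2 * τ * (k * (2 * (CR * τ ^ 2)) + (3 * (Cd * τ) + k * (Cd * τ ^ 2))) :=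
        energy_le.trans (mul_le_mul_of_nonneg_left (add_le_add res_sum_le incr_sum_le)
          (by positivity))
    _ = 2 * (2 * (k * τ) * CR + 3 * Cd + k * τ * Cd) * τ ^ 2 := by ring
    _ ≤ 2 * (2 * T * CR + 3 * Cd + T * Cd) * τ ^ 2 := by
        have : (k : ℝ) * τ ≤ T := le_trans (by gcongr) hT
        gcongr

theorem norm_corr_le_of_bounds (hk : k ≤ N) : ‖s.corr k‖ ≤ corrConst T CR Cd * τ := by
  have hτ := O.step_pos
  refine le_of_mul_le_mul_left ?_ hτ
  have energy_le :=
    s.energyNorm_increments_le_of_bounds hχ hχ' hT hCR hres hincr hincr' hdefect hk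
  rcases k with _ | k
  · have := s.increments.energyNorm_nonneg.trans energy_le
    have := s.incrBound_nonneg hincr
    rw [s.corr_zero, norm_zero, mul_zero, corrConst]
    nlinarith
  · calc τ * ‖s.corr (k + 1)‖ ≤ τ * (Cd * τ) + incrementConst T CR Cd * τ ^ 2 :=
          (s.mul_norm_corr_succ_le hχ hχ' hk).trans
            (add_le_add (mul_le_mul_of_nonneg_left (hincr _ hk) hτ.le) energy_le)
      _ = τ * (corrConst T CR Cd * τ) := by rw [corrConst]; ring

theorem norm_grad_midVel_le_of_consistent (hk : k < N) :
    ‖O.grad (s.midVel k)‖ ≤ √(errorConst T CR Cd) * τ := by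
  have hτ := O.step_pos
  have hτT := step_le_of_lt O hT hk
  have hCd := s.incrBound_nonneg hincr
  have hT0 : 0 ≤ T := hτ.le.trans hτT
  have grad_le := s.sq_norm_grad_midVel_le hχ hχ'
    (fun _ => s.energyNorm_le_of_bounds hχ hχ' hT hCR hres hincr hdefect)
    (fun _ => s.energyNorm_increments_le_of_bounds hχ hχ' hT hCR hres hincr hincr' hdefect)
    (fun _ => s.norm_corr_le_of_bounds hχ hχ' hT hCR hres hincr hincr' hdefect) hk (hres k hk)
    (hdefect k hk)
  have hK₁ : 0 ≤ energyConst T CR Cd := by unfold energyConst; positivity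
  have sqrt_mul_step : √(errorConst T CR Cd * τ ^ 2) = √(errorConst T CR Cd) * τ := by
    rw [Real.sqrt_mul' _ (sq_nonneg τ), Real.sqrt_sq hτ.le]
  refine (Real.le_sqrt_of_sq_le (grad_le.trans ?_)).trans_eq sqrt_mul_step
  unfold errorConst
  set K₁ := energyConst T CR Cd
  set K₂ := incrementConst T CR Cd
  set K₃ := corrConst T CR Cd
  calc (3 * (K₁ * τ) * (K₂ * τ ^ 2) + (K₂ * τ ^ 2) ^ 2) / τ
        + K₃ * τ * (K₁ * τ + τ * (K₃ * τ)) + CR * τ ^ 2 * (K₁ * τ)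
      = 3 * K₁ * K₂ * τ ^ 2 + K₂ ^ 2 * τ ^ 2 * τ + (K₃ * K₁ * τ ^ 2 + K₃ ^ 2 * τ ^ 2 * τ)
        + CR * K₁ * τ ^ 2 * τ := by field_simp
    _ ≤ 3 * K₁ * K₂ * τ ^ 2 + K₂ ^ 2 * τ ^ 2 * T + (K₃ * K₁ * τ ^ 2 + K₃ ^ 2 * τ ^ 2 * T)
        + CR * K₁ * τ ^ 2 * T := by gcongr
    _ = _ := by ring

end Consistent

/-- The solution is the sum of one driven by the truncation errors and one driven by the initial
pressure error; the two obey different energy bounds. -/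
theorem norm_grad_midVel_le [CompleteSpace V] [CompleteSpace H] [CompleteSpace G]
    [CompleteSpace K] [CompleteSpace Q] [CompleteSpace Y] {C₀ : ℝ} (hχ : 0 < χ) (hχ' : χ ≤ 1)
    (hT : N * τ ≤ T) (hCR : 0 ≤ CR) (hres : ∀ k < N, ‖s.res k‖ ≤ CR * τ ^ 2)
    (hincr : ∀ k ≤ N, ‖s.incr k‖ ≤ Cd * τ)
    (hincr' : ∀ k, k + 3 ≤ N → ‖s.incr (k + 3) - s.incr (k + 2)‖ ≤ Cd * τ ^ 2)
    (hdefect : ∀ k < N, s.defect (k + 1) = 0) (hdefect0 : ‖s.defect 0‖ ≤ C₀ * τ) (hk : k < N) :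
    ‖O.grad (s.midVel k)‖ ≤ (√(errorConst T CR Cd) + 5 * C₀ / χ) * τ := by
  obtain ⟨b, b_defect, b_incr, b_res⟩ :=
    exists_errorSystem_defect_eq (χ := χ) (N := N) O s.defect
  have consistent_le : ‖O.grad ((s.sub b).midVel k)‖ ≤ √(errorConst T CR Cd) * τ := by
    refine (s.sub b).norm_grad_midVel_le_of_consistent hχ hχ' hT hCR ?_ ?_ ?_ ?_ hk
    · simpa [sub, b_res]
    · simpa [sub, b_incr]
    · simpa [sub, b_incr]
    · simp [sub, b_defect]
  have initial_vel_le (i : ℕ) (hi : i ≤ N) : ‖O.grad (b.vel i)‖ ≤ 5 * C₀ / χ * τ := by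
    have := b.mul_norm_grad_vel_le_of_initial hχ hχ' (by simp [b_incr]) (by simp [b_res])
      (by simpa only [b_defect]) hi
    rw [b_defect] at this
    rw [div_mul_eq_mul_div, le_div_iff₀ hχ]
    linarith
  have initial_le : ‖O.grad (b.midVel k)‖ ≤ 5 * C₀ / χ * τ := by
    rw [midVel, map_smul, map_add]
    exact norm_half_smul_add_le (initial_vel_le _ hk) (initial_vel_le _ hk.le)
  have splitting : s.midVel k = (s.sub b).midVel k + b.midVel k := by
    simp only [midVel, sub, Pi.sub_apply]
    module
  rw [splitting, map_add, add_mul]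
  exact (norm_add_le _ _).trans (add_le_add consistent_le initial_le)

end ErrorSystem

end AbstractScheme

/-! ### Tensor products of functions of one variable -/

section Tensor

variable {d : ℕ}

/-- The tensor product `x ↦ ∏ i, f i (x i)` of functions of one variable. -/
def tensor (f : Fin d → ℝ → ℝ) : (Fin d → ℝ) → ℝ := fun x => ∏ i, f i (x i)

theorem contDiff_tensor {n : WithTop ℕ∞} {f : Fin d → ℝ → ℝ} (hf : ∀ i, ContDiff ℝ n (f i)) :
    ContDiff ℝ n (tensor f) :=
  contDiff_prod fun i _ => (hf i).comp (contDiff_apply ℝ ℝ i)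

theorem continuous_tensor {f : Fin d → ℝ → ℝ} (hf : ∀ i, Continuous (f i)) :
    Continuous (tensor f) :=
  continuous_finsetProd _ fun i _ => (hf i).comp (continuous_apply i)

theorem tensor_eq_mul (f : Fin d → ℝ → ℝ) (i : Fin d) (x : Fin d → ℝ) :
    tensor f x = f i (x i) * ∏ k ∈ Finset.univ.erase i, f k (x k) :=
  (Finset.mul_prod_erase _ _ (Finset.mem_univ i)).symm

theorem tensor_update_left (f : Fin d → ℝ → ℝ) (i : Fin d) (g : ℝ → ℝ) (x : Fin d → ℝ) :
    tensor (Function.update f i g) x = g (x i) * ∏ k ∈ Finset.univ.erase i, f k (x k) := by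
  rw [tensor_eq_mul _ i, Function.update_self]
  congr 1
  exact Finset.prod_congr rfl fun k hk => by rw [Function.update_of_ne (Finset.ne_of_mem_erase hk)]

theorem tensor_update_right (f : Fin d → ℝ → ℝ) (i : Fin d) (x : Fin d → ℝ) (t : ℝ) :
    tensor f (Function.update x i t) = f i t * ∏ k ∈ Finset.univ.erase i, f k (x k) := by
  rw [tensor_eq_mul _ i, Function.update_self]
  congr 1
  exact Finset.prod_congr rfl fun k hk => by rw [Function.update_of_ne (Finset.ne_of_mem_erase hk)]

theorem hasDerivAt_pd {φ : (Fin d → ℝ) → ℝ} {x : Fin d → ℝ} (hφ : DifferentiableAt ℝ φ x)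
    (i : Fin d) : HasDerivAt (fun t => φ (Function.update x i t)) (pd i φ x) (x i) := by
  have hφ' : HasFDerivAt φ (fderiv ℝ φ x) (Function.update x i (x i)) := by
    rw [Function.update_eq_self]
    exact hφ.hasFDerivAt
  exact hφ'.comp_hasDerivAt (x i) (hasDerivAt_update x i (x i))

theorem pd_tensor {f : Fin d → ℝ → ℝ} (hf : ∀ i, Differentiable ℝ (f i)) (i : Fin d) :
    pd i (tensor f) = tensor (Function.update f i (deriv (f i))) := by
  funext x
  have hdiff : Differentiable ℝ (tensor f) := by unfold tensor; fun_prop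
  have hpd := hasDerivAt_pd (hdiff x) i
  simp only [tensor_update_right] at hpd
  rw [tensor_update_left]
  exact hpd.unique ((hf i (x i)).hasDerivAt.mul_const _)

theorem pds_tensor {f : Fin d → ℝ → ℝ} (hf : ∀ i, ContDiff ℝ ∞ (f i)) (l : List (Fin d)) :
    pds l (tensor f) = tensor fun i => deriv^[l.count i] (f i) := by
  induction l with
  | nil => rfl
  | cons a l ih =>
    change pd a (pds l (tensor f)) = _
    rw [ih, pd_tensor fun i => ((hf i).iterate_deriv _).differentiable (by simp)]
    congr 1
    funext i
    rcases eq_or_ne i a with rfl | hia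
    · rw [Function.update_self, List.count_cons_self, Function.iterate_succ_apply']
    · rw [Function.update_of_ne hia, List.count_cons_of_ne hia.symm]

/-- Test functions of one variable: smooth, with compact support in `(0,1)`. -/
def IsTestOne (f : ℝ → ℝ) : Prop := ContDiff ℝ ∞ f ∧ tsupport f ⊆ Ioo 0 1

theorem tsupport_tensor_subset (f : Fin d → ℝ → ℝ) :
    tsupport (tensor f) ⊆ Set.pi univ fun i => tsupport (f i) := by
  refine closure_minimal ?_ (isClosed_set_pi fun i _ => isClosed_tsupport _)
  intro x hx i _
  refine subset_tsupport _ fun hfi => hx ?_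
  rw [tensor_eq_mul f i, hfi, zero_mul]

theorem isTest_tensor {f : Fin d → ℝ → ℝ} (hf : ∀ i, IsTestOne (f i)) : IsTest (tensor f) := by
  have hsupp := tsupport_tensor_subset f
  refine ⟨contDiff_tensor fun i => (hf i).1, ?_, hsupp.trans (Set.pi_mono fun i _ => (hf i).2)⟩
  refine IsCompact.of_isClosed_subset (isCompact_univ_pi fun i => ?_) (isClosed_tsupport _) hsupp
  exact isCompact_Icc.of_isClosed_subset (isClosed_tsupport _) ((hf i).2.trans Ioo_subset_Icc_self)

end Tensor

/-! ### Integration over the cube -/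

section Cube

variable {d : ℕ}

theorem measurableSet_cube : MeasurableSet (cube d) :=
  MeasurableSet.univ_pi fun _ => measurableSet_Ioo

theorem volume_restrict_cube :
    (volume : Measure (Fin d → ℝ)).restrict (cube d)
      = Measure.pi fun _ => (volume : Measure ℝ).restrict (Ioo 0 1) := by
  rw [volume_pi, cube, Measure.restrict_pi_pi]

instance isFiniteMeasure_cube :
    IsFiniteMeasure ((volume : Measure (Fin d → ℝ)).restrict (cube d)) := by
  rw [volume_restrict_cube]
  infer_instance

theorem L2.integrable (v : L2 d) : Integrable v (volume.restrict (cube d)) :=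
  (Lp.memLp v).integrable (by norm_num)

theorem exists_bound_on_cube {g : (Fin d → ℝ) → ℝ} (hg : Continuous g) :
    ∃ C, ∀ x ∈ cube d, |g x| ≤ C := by
  have hcompact : IsCompact (Set.pi univ fun _ : Fin d => Icc (0 : ℝ) 1) :=
    isCompact_univ_pi fun _ => isCompact_Icc
  obtain ⟨C, hC⟩ := hcompact.exists_bound_of_continuousOn hg.continuousOn
  exact ⟨C, fun x hx => hC x fun i hi => Ioo_subset_Icc_self (hx i hi)⟩

theorem L2.integrable_mul (v : L2 d) {g : (Fin d → ℝ) → ℝ} (hg : Continuous g) :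
    IntegrableOn (fun x => v x * g x) (cube d) := by
  obtain ⟨C, hC⟩ := exists_bound_on_cube hg
  exact (L2.integrable v).mul_bdd (c := C) hg.aestronglyMeasurable
    ((ae_restrict_iff' measurableSet_cube).2 (ae_of_all _ hC))

theorem L2.tendsto_integral_tensor (v : L2 d) {F : ℕ → Fin d → ℝ → ℝ} {f : Fin d → ℝ → ℝ}
    (hF : ∀ m i, Continuous (F m i)) (hb : ∀ i, ∃ C, ∀ m, ∀ x ∈ Ioo (0 : ℝ) 1, |F m i x| ≤ C)
    (hl : ∀ i, ∀ x ∈ Ioo (0 : ℝ) 1, Tendsto (fun m => F m i x) atTop (𝓝 (f i x))) :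
    Tendsto (fun m => ∫ x in cube d, v x * tensor (F m) x) atTop
      (𝓝 (∫ x in cube d, v x * tensor f x)) := by
  choose C hC using hb
  refine tendsto_integral_of_dominated_convergence (fun x => |v x| * ∏ i, C i) ?_ ?_ ?_ ?_
  · exact fun m => (L2.integrable v).aestronglyMeasurable.mul
      (continuous_tensor (hF m)).aestronglyMeasurable
  · exact (L2.integrable v).abs.mul_const _
  · refine fun m => (ae_restrict_iff' measurableSet_cube).2 (ae_of_all _ fun x hx => ?_)
    rw [Real.norm_eq_abs, abs_mul]
    refine mul_le_mul_of_nonneg_left ?_ (abs_nonneg _)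
    rw [tensor, Finset.abs_prod]
    exact Finset.prod_le_prod (fun _ _ => abs_nonneg _) fun i _ => hC i m _ (hx i trivial)
  · refine (ae_restrict_iff' measurableSet_cube).2 (ae_of_all _ fun x hx => ?_)
    exact (tendsto_finsetProd _ fun i _ => hl i _ (hx i trivial)).const_mul _

end Cube

/-! ### Cutoff functions on the unit interval -/

section Cutoff

/-- A smooth step from `0` to `1` on a boundary layer of width of order `1/(m+1)`: it vanishes for
`x ≤ 1/(m+1)` and equals `1` for `x ≥ 2/(m+1)`. -/
noncomputable def boundaryStep (m : ℕ) (x : ℝ) : ℝ := Real.smoothTransition ((m + 1) * x - 1)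

theorem contDiff_boundaryStep (m : ℕ) : ContDiff ℝ ∞ (boundaryStep m) :=
  Real.smoothTransition.contDiff.comp (by fun_prop)

theorem abs_boundaryStep_le (m : ℕ) (x : ℝ) : |boundaryStep m x| ≤ 1 := by
  rw [boundaryStep, abs_of_nonneg (Real.smoothTransition.nonneg _)]
  exact Real.smoothTransition.le_one _

theorem le_of_boundaryStep_ne_zero {m : ℕ} {x : ℝ} (hx : boundaryStep m x ≠ 0) :
    1 / (m + 1 : ℝ) ≤ x := by
  by_contra! hlt
  refine hx (Real.smoothTransition.zero_of_nonpos ?_)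
  rw [lt_div_iff₀ (by positivity)] at hlt
  linarith

theorem boundaryStep_eventually_one {x : ℝ} (hx : 0 < x) :
    ∀ᶠ m : ℕ in atTop, boundaryStep m =ᶠ[𝓝 x] fun _ => 1 := by
  have hlarge : Tendsto (fun m : ℕ => (m + 1 : ℝ)) atTop atTop :=
    tendsto_atTop_add_const_right _ _ tendsto_natCast_atTop_atTop
  filter_upwards [hlarge.eventually_gt_atTop (2 / x)] with m hm
  rw [div_lt_iff₀ hx] at hm
  have hcont : Continuous fun y : ℝ => (m + 1 : ℝ) * y := by fun_prop
  filter_upwards [hcont.continuousAt.eventually (lt_mem_nhds hm)] with y hy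
  exact Real.smoothTransition.one_of_one_le (by linarith)

theorem deriv_smoothTransition_eq_zero {t : ℝ} (ht : t ∉ Icc (0 : ℝ) 1) :
    deriv Real.smoothTransition t = 0 := by
  rw [mem_Icc, not_and_or, not_le, not_le] at ht
  rcases ht with ht | ht
  · have hzero : Real.smoothTransition =ᶠ[𝓝 t] fun _ => 0 := by
      filter_upwards [Iio_mem_nhds ht] with x hx
      exact Real.smoothTransition.zero_of_nonpos (le_of_lt hx)
    rw [hzero.deriv_eq, deriv_const]
  · have hone : Real.smoothTransition =ᶠ[𝓝 t] fun _ => 1 := by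
      filter_upwards [Ioi_mem_nhds ht] with x hx
      exact Real.smoothTransition.one_of_one_le (le_of_lt hx)
    rw [hone.deriv_eq, deriv_const]

-- The derivative is of order `m + 1`, but only where `x` is of order `1/(m+1)`.
theorem exists_bound_deriv_boundaryStep :
    ∃ B, ∀ m x, |deriv (boundaryStep m) x * x| ≤ B := by
  have hcont : Continuous fun t => deriv Real.smoothTransition t * (t + 1) :=
    ((Real.smoothTransition.contDiff (n := ⊤)).continuous_deriv (by simp)).mul (by fun_prop)
  obtain ⟨B, hB⟩ := isCompact_Icc (a := (0 : ℝ)) (b := 1) |>.exists_bound_of_continuousOn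
    hcont.continuousOn
  refine ⟨|B|, fun m x => ?_⟩
  have hderiv : deriv (boundaryStep m) x
      = deriv Real.smoothTransition ((m + 1) * x - 1) * (m + 1) := by
    refine (HasDerivAt.comp x (DifferentiableAt.hasDerivAt ?_) ?_).deriv
    · exact (Real.smoothTransition.contDiff (n := ⊤)).differentiable (by simp) _
    · simpa using ((hasDerivAt_id x).const_mul (m + 1 : ℝ)).sub_const 1
  have hscale : deriv (boundaryStep m) x * x
      = deriv Real.smoothTransition ((m + 1) * x - 1) * ((m + 1) * x - 1 + 1) := by
    rw [hderiv]; ring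
  rw [hscale]
  by_cases ht : (m + 1) * x - 1 ∈ Icc (0 : ℝ) 1
  · exact (hB _ ht).trans (le_abs_self B)
  · rw [deriv_smoothTransition_eq_zero ht, zero_mul, abs_zero]
    exact abs_nonneg B

/-- A cutoff function that vanishes within distance `1/(m+1)` of `0` and of `1`. -/
noncomputable def cutoff (m : ℕ) (x : ℝ) : ℝ := boundaryStep m x * boundaryStep m (1 - x)

theorem contDiff_cutoff (m : ℕ) : ContDiff ℝ ∞ (cutoff m) :=
  (contDiff_boundaryStep m).mul ((contDiff_boundaryStep m).comp (by fun_prop))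

theorem abs_cutoff_le (m : ℕ) (x : ℝ) : |cutoff m x| ≤ 1 := by
  rw [cutoff, abs_mul]
  exact mul_le_one₀ (abs_boundaryStep_le m x) (abs_nonneg _) (abs_boundaryStep_le m (1 - x))

theorem tsupport_cutoff_subset (m : ℕ) : tsupport (cutoff m) ⊆ Ioo 0 1 := by
  have hsupp : tsupport (cutoff m) ⊆ Icc (1 / (m + 1 : ℝ)) (1 - 1 / (m + 1 : ℝ)) := by
    refine closure_minimal (fun x hx => ?_) isClosed_Icc
    rw [Function.mem_support, cutoff, mul_ne_zero_iff] at hx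
    exact ⟨le_of_boundaryStep_ne_zero hx.1, by linarith [le_of_boundaryStep_ne_zero hx.2]⟩
  have hpos : 0 < 1 / (m + 1 : ℝ) := by positivity
  exact hsupp.trans fun x hx => ⟨by linarith [hx.1], by linarith [hx.2]⟩

theorem cutoff_eventually_one {x : ℝ} (hx : x ∈ Ioo (0 : ℝ) 1) :
    ∀ᶠ m : ℕ in atTop, cutoff m =ᶠ[𝓝 x] fun _ => 1 := by
  filter_upwards [boundaryStep_eventually_one hx.1,
    boundaryStep_eventually_one (sub_pos.2 hx.2)] with m hleft hright
  have hcont : Continuous fun y : ℝ => 1 - y := by fun_prop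
  filter_upwards [hleft, hcont.continuousAt.eventually hright] with y hy hy'
  rw [cutoff, hy, hy', one_mul]

theorem exists_bound_deriv_cutoff :
    ∃ B, ∀ m, ∀ x ∈ Ioo (0 : ℝ) 1, |deriv (cutoff m) x| * (x * (1 - x)) ≤ B := by
  obtain ⟨B, hB⟩ := exists_bound_deriv_boundaryStep
  refine ⟨B + B, fun m x hx => ?_⟩
  have hdiff := (contDiff_boundaryStep m).differentiable (by simp)
  have hderiv : deriv (cutoff m) x = deriv (boundaryStep m) x * boundaryStep m (1 - x)
      + boundaryStep m x * -deriv (boundaryStep m) (1 - x) := by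
    have hright : HasDerivAt (fun y => boundaryStep m (1 - y))
        (-deriv (boundaryStep m) (1 - x)) x := by
      rw [← mul_neg_one]
      exact (hdiff (1 - x)).hasDerivAt.comp x ((hasDerivAt_id x).const_sub 1)
    exact ((hdiff x).hasDerivAt.mul hright).deriv
  have hx0 : 0 ≤ x := hx.1.le
  have hx1 : 0 ≤ 1 - x := by linarith [hx.2]
  have hsplit : deriv (cutoff m) x * (x * (1 - x))
      = deriv (boundaryStep m) x * x * (boundaryStep m (1 - x) * (1 - x))
        - deriv (boundaryStep m) (1 - x) * (1 - x) * (boundaryStep m x * x) := by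
    rw [hderiv]; ring
  have hterm : ∀ y z : ℝ, 0 ≤ z → z ≤ 1 →
      |deriv (boundaryStep m) y * y * (boundaryStep m z * z)| ≤ B := fun y z hz hz' => by
    rw [abs_mul]
    refine (mul_le_of_le_one_right (abs_nonneg _) ?_).trans (hB m y)
    rw [abs_mul, abs_of_nonneg hz]
    exact mul_le_one₀ (abs_boundaryStep_le m z) hz hz'
  rw [← abs_of_nonneg (mul_nonneg hx0 hx1), ← abs_mul, hsplit]
  exact (abs_sub _ _).trans (add_le_add (hterm x _ hx1 (by linarith)) (hterm (1 - x) x hx0 hx.2.le))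

theorem exists_abs_le_of_zero_boundary {f : ℝ → ℝ} (hf : ContDiff ℝ 1 f) (h0 : f 0 = 0)
    (h1 : f 1 = 0) : ∃ L, 0 ≤ L ∧ ∀ x ∈ Ioo (0 : ℝ) 1, |f x| ≤ L * (x * (1 - x)) := by
  obtain ⟨L, hL⟩ := isCompact_Icc (a := (0 : ℝ)) (b := 1) |>.exists_bound_of_continuousOn
    (hf.continuous_deriv le_rfl).continuousOn
  have hL0 : 0 ≤ L := (norm_nonneg _).trans (hL 0 (left_mem_Icc.2 zero_le_one))
  have hmvt : ∀ a ∈ Icc (0 : ℝ) 1, ∀ x ∈ Icc (0 : ℝ) 1, |f x - f a| ≤ L * |x - a| :=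
    fun a ha x hx => Convex.norm_image_sub_le_of_norm_deriv_le
      (fun y _ => hf.differentiable one_ne_zero y) hL (convex_Icc _ _) ha hx
  refine ⟨2 * L, by positivity, fun x hx => ?_⟩
  have hleft := hmvt 0 (left_mem_Icc.2 zero_le_one) x (Ioo_subset_Icc_self hx)
  have hright := hmvt 1 (right_mem_Icc.2 zero_le_one) x (Ioo_subset_Icc_self hx)
  rw [h0, sub_zero, sub_zero, abs_of_pos hx.1] at hleft
  rw [h1, sub_zero, abs_sub_comm x 1, abs_of_pos (sub_pos.2 hx.2)] at hright
  nlinarith [mul_le_mul_of_nonneg_right hleft (by linarith [hx.2] : 0 ≤ 1 - x),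
    mul_le_mul_of_nonneg_right hright hx.1.le]

theorem isTestOne_mul_cutoff {f : ℝ → ℝ} (hf : ContDiff ℝ ∞ f) (m : ℕ) :
    IsTestOne fun x => f x * cutoff m x :=
  ⟨hf.mul (contDiff_cutoff m), (closure_mono (Function.support_mul_subset_right _ _)).trans
    (tsupport_cutoff_subset m)⟩

theorem tendsto_mul_cutoff (f : ℝ → ℝ) {x : ℝ} (hx : x ∈ Ioo (0 : ℝ) 1) :
    Tendsto (fun m => f x * cutoff m x) atTop (𝓝 (f x)) := by
  refine tendsto_const_nhds.congr' ?_
  filter_upwards [cutoff_eventually_one hx] with m hm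
  rw [hm.self_of_nhds, mul_one]

theorem tendsto_deriv_mul_cutoff (f : ℝ → ℝ) {x : ℝ} (hx : x ∈ Ioo (0 : ℝ) 1) :
    Tendsto (fun m => deriv (fun x => f x * cutoff m x) x) atTop (𝓝 (deriv f x)) := by
  refine tendsto_const_nhds.congr' ?_
  filter_upwards [cutoff_eventually_one hx] with m hm
  refine Filter.EventuallyEq.deriv_eq ?_
  filter_upwards [hm] with y hy
  rw [hy, mul_one]

theorem exists_bound_mul_cutoff {f : ℝ → ℝ} (hf : Continuous f) :
    ∃ C, ∀ m, ∀ x ∈ Ioo (0 : ℝ) 1, |f x * cutoff m x| ≤ C := by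
  obtain ⟨C, hC⟩ := isCompact_Icc (a := (0 : ℝ)) (b := 1) |>.exists_bound_of_continuousOn
    hf.continuousOn
  refine ⟨C, fun m x hx => ?_⟩
  rw [abs_mul]
  exact (mul_le_of_le_one_right (abs_nonneg _) (abs_cutoff_le m x)).trans
    (hC x (Ioo_subset_Icc_self hx))

theorem exists_bound_deriv_mul_cutoff {f : ℝ → ℝ} (hf : ContDiff ℝ 1 f) (h0 : f 0 = 0)
    (h1 : f 1 = 0) :
    ∃ C, ∀ m, ∀ x ∈ Ioo (0 : ℝ) 1, |deriv (fun x => f x * cutoff m x) x| ≤ C := by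
  obtain ⟨C, hC⟩ := exists_bound_mul_cutoff (hf.continuous_deriv le_rfl)
  obtain ⟨L, hL0, hL⟩ := exists_abs_le_of_zero_boundary hf h0 h1
  obtain ⟨B, hB⟩ := exists_bound_deriv_cutoff
  refine ⟨C + L * B, fun m x hx => ?_⟩
  have hderiv : deriv (fun x => f x * cutoff m x) x
      = deriv f x * cutoff m x + f x * deriv (cutoff m) x :=
    ((hf.differentiable one_ne_zero x).hasDerivAt.mul
      ((contDiff_cutoff m).differentiable (by simp) x).hasDerivAt).deriv
  rw [hderiv]
  refine (abs_add_le _ _).trans (add_le_add (hC m x hx) ?_)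
  calc |f x * deriv (cutoff m) x|
      ≤ L * (x * (1 - x)) * |deriv (cutoff m) x| := by
        rw [abs_mul]
        gcongr
        exact hL x hx
    _ = L * (|deriv (cutoff m) x| * (x * (1 - x))) := by ring
    _ ≤ L * B := by gcongr; exact hB m x hx

end Cutoff

/-! ### Sine and cosine functions on the unit interval -/

section Trig

/-- The sine (`s = true`) or cosine (`s = false`) function of frequency `n`, not normalized. -/
noncomputable def rawTrig (s : Bool) (n : ℕ) (x : ℝ) : ℝ :=
  if s then Real.sin (n * Real.pi * x) else Real.cos (n * Real.pi * x)

/-- The factor that normalizes `rawTrig s n` in `L²(0,1)`. -/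
noncomputable def trigFactor (n : ℕ) : ℝ := if n = 0 then 1 else √2

/-- The sine and cosine functions of frequency `n`, normalized in `L²(0,1)`. -/
noncomputable def trig (s : Bool) (n : ℕ) (x : ℝ) : ℝ := trigFactor n * rawTrig s n x

theorem trigFactor_ne_zero (n : ℕ) : trigFactor n ≠ 0 := by
  unfold trigFactor
  split_ifs <;> positivity

theorem contDiff_trig (s : Bool) (n : ℕ) : ContDiff ℝ ∞ (trig s n) := by
  refine contDiff_const.mul ?_
  cases s
  · change ContDiff ℝ ∞ fun x => Real.cos (n * Real.pi * x)
    fun_prop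
  · change ContDiff ℝ ∞ fun x => Real.sin (n * Real.pi * x)
    fun_prop

theorem hasDerivAt_nat_mul_pi_mul (n : ℕ) (x : ℝ) :
    HasDerivAt (fun x : ℝ => n * Real.pi * x) (n * Real.pi) x := by
  simpa using (hasDerivAt_id x).const_mul (n * Real.pi)

theorem deriv_trig_true (n : ℕ) : deriv (trig true n) = fun x => n * Real.pi * trig false n x := by
  funext x
  have hderiv : deriv (trig true n) x = _ :=
    ((hasDerivAt_nat_mul_pi_mul n x).sin.const_mul (trigFactor n)).deriv
  rw [hderiv]
  simp only [trig, rawTrig, Bool.false_eq_true, if_false]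
  ring

theorem deriv_trig_false (n : ℕ) :
    deriv (trig false n) = fun x => -(n * Real.pi) * trig true n x := by
  funext x
  have hderiv : deriv (trig false n) x = _ :=
    ((hasDerivAt_nat_mul_pi_mul n x).cos.const_mul (trigFactor n)).deriv
  rw [hderiv]
  simp only [trig, rawTrig, if_true]
  ring

theorem trig_true_zero (n : ℕ) : trig true n 0 = 0 := by simp [trig, rawTrig]

theorem trig_true_one (n : ℕ) : trig true n 1 = 0 := by
  simp [trig, rawTrig, Real.sin_nat_mul_pi]

theorem trig_true_freq_zero (x : ℝ) : trig true 0 x = 0 := by simp [trig, rawTrig]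

theorem integral_cos_int (k : ℤ) :
    ∫ x in Ioo (0 : ℝ) 1, Real.cos (k * Real.pi * x) = if k = 0 then 1 else 0 := by
  rw [← integral_Ioc_eq_integral_Ioo, ← intervalIntegral.integral_of_le zero_le_one]
  split_ifs with hk
  · simp [hk]
  · have hfreq : (k : ℝ) * Real.pi ≠ 0 := mul_ne_zero (by exact_mod_cast hk) Real.pi_ne_zero
    rw [intervalIntegral.integral_comp_mul_left (fun x => Real.cos x) hfreq, integral_cos]
    simp [Real.sin_int_mul_pi]

theorem rawTrig_mul_rawTrig (s : Bool) (n m : ℕ) (x : ℝ) :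
    rawTrig s n x * rawTrig s m x =
      1 / 2 * Real.cos (((n : ℤ) - (m : ℤ) : ℤ) * Real.pi * x)
        + (if s then -1 else 1) * (1 / 2)
          * Real.cos (((n : ℤ) + (m : ℤ) : ℤ) * Real.pi * x) := by
  push_cast
  rw [sub_mul, sub_mul, add_mul, add_mul, Real.cos_sub, Real.cos_add]
  cases s <;> simp [rawTrig] <;> ring

theorem integral_rawTrig_mul (s : Bool) (n m : ℕ) :
    ∫ x in Ioo (0 : ℝ) 1, rawTrig s n x * rawTrig s m x
      = ((if n = m then 1 else 0)
          + (if s then -1 else 1) * (if n = 0 ∧ m = 0 then 1 else 0)) / 2 := by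
  have hint : ∀ {g : ℝ → ℝ}, Continuous g → IntegrableOn g (Ioo (0 : ℝ) 1) := fun hg =>
    hg.continuousOn.integrableOn_Icc.mono_set Ioo_subset_Icc_self
  simp only [rawTrig_mul_rawTrig]
  rw [integral_add (hint (by fun_prop)) (hint (by fun_prop)), integral_const_mul,
    integral_const_mul, integral_cos_int, integral_cos_int]
  have hsub : ((n : ℤ) - (m : ℤ) = 0) ↔ n = m := by omega
  have hadd : ((n : ℤ) + (m : ℤ) = 0) ↔ (n = 0 ∧ m = 0) := by omega
  simp only [hsub, hadd]
  ring

theorem integral_trig_mul (s : Bool) (n m : ℕ) :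
    ∫ x in Ioo (0 : ℝ) 1, trig s n x * trig s m x
      = trigFactor n * trigFactor m * ((if n = m then 1 else 0)
          + (if s then -1 else 1) * (if n = 0 ∧ m = 0 then 1 else 0)) / 2 := by
  have hfactor : ∀ x, trig s n x * trig s m x
      = trigFactor n * trigFactor m * (rawTrig s n x * rawTrig s m x) :=
    fun x => by simp only [trig]; ring
  simp only [hfactor]
  rw [integral_const_mul, integral_rawTrig_mul, mul_div_assoc]

theorem integral_trig_mul_of_ne (s : Bool) {n m : ℕ} (h : n ≠ m) :
    ∫ x in Ioo (0 : ℝ) 1, trig s n x * trig s m x = 0 := by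
  have hzero : ¬(n = 0 ∧ m = 0) := fun hnm => h (hnm.1.trans hnm.2.symm)
  rw [integral_trig_mul, if_neg h, if_neg hzero]
  simp

theorem integral_trig_mul_self (s : Bool) {n : ℕ} (h : s = true → n ≠ 0) :
    ∫ x in Ioo (0 : ℝ) 1, trig s n x * trig s n x = 1 := by
  rw [integral_trig_mul]
  rcases eq_or_ne n 0 with rfl | hn
  · cases s
    · norm_num [trigFactor]
    · exact absurd rfl (h rfl)
  · simp [hn, trigFactor]

theorem rawTrig_mem_span (s : Bool) (n : ℕ) :
    rawTrig s n ∈ Submodule.span ℝ (range (trig s)) := by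
  have hscale : rawTrig s n = (trigFactor n)⁻¹ • trig s n := by
    funext x
    simp only [Pi.smul_apply, smul_eq_mul, trig, inv_mul_cancel_left₀ (trigFactor_ne_zero n)]
  rw [hscale]
  exact Submodule.smul_mem _ _ (Submodule.subset_span ⟨n, rfl⟩)

theorem cos_mul_rawTrig_succ (s : Bool) (n : ℕ) (x : ℝ) :
    Real.cos (Real.pi * x) * rawTrig s (n + 1) x
      = 1 / 2 * (rawTrig s (n + 2) x + rawTrig s n x) := by
  have hup : ((n + 2 : ℕ) : ℝ) * Real.pi * x = (n + 1 : ℕ) * Real.pi * x + Real.pi * x := by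
    push_cast; ring
  have hdown : (n : ℝ) * Real.pi * x = (n + 1 : ℕ) * Real.pi * x - Real.pi * x := by
    push_cast; ring
  simp only [rawTrig]
  rw [hup, hdown, Real.cos_add, Real.cos_sub, Real.sin_add, Real.sin_sub]
  split_ifs <;> ring

theorem cos_mul_rawTrig_mem_span (s : Bool) (n : ℕ) :
    (fun x => Real.cos (Real.pi * x) * rawTrig s n x) ∈ Submodule.span ℝ (range (trig s)) := by
  rcases n with _ | n
  · cases s
    · convert rawTrig_mem_span false 1 using 1
      funext x
      simp [rawTrig]
    · convert Submodule.zero_mem _ using 1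
      funext x
      simp [rawTrig]
  · convert Submodule.smul_mem _ (1 / 2 : ℝ)
      (Submodule.add_mem _ (rawTrig_mem_span s (n + 2)) (rawTrig_mem_span s n)) using 1
    exact funext (cos_mul_rawTrig_succ s n)

theorem cos_mul_mem_span (s : Bool) {g : ℝ → ℝ} (hg : g ∈ Submodule.span ℝ (range (trig s))) :
    (fun x => Real.cos (Real.pi * x) * g x) ∈ Submodule.span ℝ (range (trig s)) := by
  suffices hle : Submodule.span ℝ (range (trig s)) ≤ (Submodule.span ℝ (range (trig s))).comap
      (LinearMap.mulLeft ℝ fun x => Real.cos (Real.pi * x)) from hle hg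
  rw [Submodule.span_le]
  rintro _ ⟨n, rfl⟩
  have hscale : (fun x => Real.cos (Real.pi * x)) * trig s n
      = trigFactor n • fun x => Real.cos (Real.pi * x) * rawTrig s n x :=
    funext fun x => mul_left_comm _ _ _
  change (fun x => Real.cos (Real.pi * x)) * trig s n ∈ Submodule.span ℝ (range (trig s))
  rw [hscale]
  exact Submodule.smul_mem _ _ (cos_mul_rawTrig_mem_span s n)

/-- The lowest sine function or the constant function. -/
noncomputable def baseTrig (s : Bool) (x : ℝ) : ℝ := if s then Real.sin (Real.pi * x) else 1

theorem continuous_baseTrig (s : Bool) : Continuous (baseTrig s) := by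
  cases s
  · exact continuous_const
  · change Continuous fun x => Real.sin (Real.pi * x)
    fun_prop

theorem baseTrig_ne_zero (s : Bool) {x : ℝ} (hx : x ∈ Ioo (0 : ℝ) 1) : baseTrig s x ≠ 0 := by
  cases s
  · exact one_ne_zero
  · have hpos : 0 < Real.pi * x := mul_pos Real.pi_pos hx.1
    have hlt : Real.pi * x < Real.pi := mul_lt_of_lt_one_right Real.pi_pos hx.2
    exact (Real.sin_pos_of_pos_of_lt_pi hpos hlt).ne'

theorem baseTrig_mul_cos_pow_mem_span (s : Bool) (k : ℕ) :
    (fun x => baseTrig s x * Real.cos (Real.pi * x) ^ k) ∈ Submodule.span ℝ (range (trig s)) := by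
  induction k with
  | zero =>
    cases s
    · convert rawTrig_mem_span false 0 using 1
      funext x
      simp [rawTrig, baseTrig]
    · convert rawTrig_mem_span true 1 using 1
      funext x
      simp [rawTrig, baseTrig]
  | succ k ih =>
    convert cos_mul_mem_span s ih using 1
    funext x
    ring

end Trig

/-! ### Trigonometric modes and coefficients on the cube -/

section Coefficients

variable {d : ℕ}

/-- The product of one-dimensional sine (`σ i = true`) and cosine (`σ i = false`) functions. -/
noncomputable def mode (σ : Fin d → Bool) (n : Fin d → ℕ) : (Fin d → ℝ) → ℝ :=
  tensor fun i => trig (σ i) (n i)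

/-- The coefficient of `v` in the trigonometric system `σ`. -/
noncomputable def coef (σ : Fin d → Bool) (n : Fin d → ℕ) (v : L2 d) : ℝ :=
  ∫ x in cube d, v x * mode σ n x

theorem contDiff_mode (σ : Fin d → Bool) (n : Fin d → ℕ) : ContDiff ℝ ∞ (mode σ n) :=
  contDiff_tensor fun i => contDiff_trig (σ i) (n i)

theorem continuous_mode (σ : Fin d → Bool) (n : Fin d → ℕ) : Continuous (mode σ n) :=
  (contDiff_mode σ n).continuous

theorem memLp_of_continuous {g : (Fin d → ℝ) → ℝ} (hg : Continuous g) :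
    MemLp g 2 (volume.restrict (cube d)) := by
  obtain ⟨C, hC⟩ := exists_bound_on_cube hg
  exact MemLp.of_bound hg.aestronglyMeasurable C
    ((ae_restrict_iff' measurableSet_cube).2 (ae_of_all _ hC))

/-- A continuous function as an element of `L²((0,1)^d)`. -/
noncomputable def toL2 {g : (Fin d → ℝ) → ℝ} (hg : Continuous g) : L2 d :=
  (memLp_of_continuous hg).toLp g

theorem coeFn_toL2 {g : (Fin d → ℝ) → ℝ} (hg : Continuous g) :
    toL2 hg =ᵐ[volume.restrict (cube d)] g := MemLp.coeFn_toLp _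

theorem inner_eq_integral (v w : L2 d) : inner ℝ v w = ∫ x in cube d, v x * w x := by
  rw [MeasureTheory.L2.inner_def]
  simp [mul_comm]

theorem inner_toL2 (v : L2 d) {g : (Fin d → ℝ) → ℝ} (hg : Continuous g) :
    inner ℝ v (toL2 hg) = ∫ x in cube d, v x * g x := by
  rw [inner_eq_integral]
  refine integral_congr_ae ?_
  filter_upwards [coeFn_toL2 hg] with x hx
  rw [hx]

theorem inner_toL2_toL2 {g h : (Fin d → ℝ) → ℝ} (hg : Continuous g) (hh : Continuous h) :
    inner ℝ (toL2 hg) (toL2 hh) = ∫ x in cube d, g x * h x := by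
  rw [inner_toL2]
  refine integral_congr_ae ?_
  filter_upwards [coeFn_toL2 hg] with x hx
  rw [hx]

theorem coef_eq_inner (σ : Fin d → Bool) (n : Fin d → ℕ) (v : L2 d) :
    coef σ n v = inner ℝ v (toL2 (continuous_mode σ n)) := (inner_toL2 v _).symm

theorem coef_add (σ : Fin d → Bool) (n : Fin d → ℕ) (v w : L2 d) :
    coef σ n (v + w) = coef σ n v + coef σ n w := by
  simp only [coef_eq_inner, inner_add_left]

theorem coef_sub (σ : Fin d → Bool) (n : Fin d → ℕ) (v w : L2 d) :
    coef σ n (v - w) = coef σ n v - coef σ n w := by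
  simp only [coef_eq_inner, inner_sub_left]

theorem coef_smul (σ : Fin d → Bool) (n : Fin d → ℕ) (a : ℝ) (v : L2 d) :
    coef σ n (a • v) = a * coef σ n v := by
  simp only [coef_eq_inner, real_inner_smul_left]

theorem coef_zero (σ : Fin d → Bool) (n : Fin d → ℕ) : coef σ n (0 : L2 d) = 0 := by
  simp only [coef_eq_inner, inner_zero_left]

theorem coef_sum {ι : Type*} (σ : Fin d → Bool) (n : Fin d → ℕ) (s : Finset ι) (v : ι → L2 d) :
    coef σ n (∑ i ∈ s, v i) = ∑ i ∈ s, coef σ n (v i) := by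
  simp only [coef_eq_inner, sum_inner]

theorem mode_eq_zero {σ : Fin d → Bool} {n : Fin d → ℕ} {i : Fin d} (hσ : σ i = true)
    (hn : n i = 0) : mode σ n = 0 := by
  funext x
  rw [mode, tensor_eq_mul _ i, hσ, hn, trig_true_freq_zero, zero_mul, Pi.zero_apply]

theorem coef_eq_zero {σ : Fin d → Bool} {n : Fin d → ℕ} {i : Fin d} (hσ : σ i = true)
    (hn : n i = 0) (v : L2 d) : coef σ n v = 0 := by
  simp [coef, mode_eq_zero hσ hn]

theorem integral_tensor_mul_tensor (f g : Fin d → ℝ → ℝ) :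
    ∫ x in cube d, tensor f x * tensor g x = ∏ i, ∫ x in Ioo (0 : ℝ) 1, f i x * g i x := by
  rw [volume_restrict_cube, ← integral_fintype_prod_eq_prod]
  simp only [tensor, Finset.prod_mul_distrib]

/-- The frequencies of the nonzero modes of the system `σ`. -/
abbrev ModeIndex (σ : Fin d → Bool) := {n : Fin d → ℕ // ∀ i, σ i = true → n i ≠ 0}

theorem orthonormal_mode (σ : Fin d → Bool) :
    Orthonormal ℝ fun n : ModeIndex σ => toL2 (continuous_mode σ n.1) := by
  classical
  rw [orthonormal_iff_ite]
  intro n m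
  rw [inner_toL2_toL2, mode, mode, integral_tensor_mul_tensor]
  split_ifs with hnm
  · subst hnm
    exact Finset.prod_eq_one fun i _ => integral_trig_mul_self _ (n.2 i)
  · obtain ⟨i, hi⟩ := Function.ne_iff.1 fun heq : n.1 = m.1 => hnm (Subtype.ext heq)
    exact Finset.prod_eq_zero (Finset.mem_univ i) (integral_trig_mul_of_ne _ hi)

end Coefficients

/-! ### Completeness of the trigonometric systems -/

section Completeness

variable {d : ℕ} {σ : Fin d → Bool} {v : L2 d}

theorem integral_mul_tensor_eq_zero (hv : ∀ n, coef σ n v = 0) {f : Fin d → ℝ → ℝ}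
    (hf : ∀ i, f i ∈ Submodule.span ℝ (range (trig (σ i)))) :
    ∫ x in cube d, v x * tensor f x = 0 := by
  choose c hc using fun i => (Finsupp.mem_span_range_iff_exists_finsupp).1 (hf i)
  have hexpand : ∀ x, v x * tensor f x = ∑ p ∈ Fintype.piFinset fun i => (c i).support,
      (∏ i, c i (p i)) * (v x * mode σ p x) := by
    intro x
    have hfactors : tensor f x = ∏ i, ∑ n ∈ (c i).support, c i n * trig (σ i) n (x i) := by
      refine Finset.prod_congr rfl fun i _ => ?_
      conv_lhs => rw [← hc i]
      simp [Finsupp.sum]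
    rw [hfactors, Finset.prod_univ_sum, Finset.mul_sum]
    refine Finset.sum_congr rfl fun p _ => ?_
    rw [Finset.prod_mul_distrib, mode, tensor]
    ring
  simp only [hexpand]
  rw [integral_finsetSum _
    fun p _ => (L2.integrable_mul v (continuous_mode σ p)).const_mul _]
  refine Finset.sum_eq_zero fun p _ => ?_
  rw [integral_const_mul, ← coef, hv, mul_zero]

/-- The polynomial `p` in the functions `x ↦ cos (π x_i)`. -/
noncomputable def cosPolynomial (p : MvPolynomial (Fin d) ℝ) (x : Fin d → ℝ) : ℝ :=
  MvPolynomial.eval (fun i => Real.cos (Real.pi * x i)) p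

theorem continuous_cosPolynomial (p : MvPolynomial (Fin d) ℝ) : Continuous (cosPolynomial p) := by
  unfold cosPolynomial
  simp only [MvPolynomial.eval_eq']
  fun_prop

-- Stone-Weierstrass on the closed cube, whose points are separated by the functions `cos (π x_i)`.
theorem exists_cosPolynomial_near {g : (Fin d → ℝ) → ℝ} (hg : Continuous g) {ε : ℝ} (hε : 0 < ε) :
    ∃ p : MvPolynomial (Fin d) ℝ, ∀ x ∈ cube d, |g x - cosPolynomial p x| ≤ ε := by
  let K : Set (Fin d → ℝ) := Set.pi univ fun _ => Icc 0 1
  have : CompactSpace K := isCompact_iff_compactSpace.1 (isCompact_univ_pi fun _ => isCompact_Icc)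
  let c : Fin d → C(K, ℝ) := fun i => ⟨fun x => Real.cos (Real.pi * x.1 i),
    Real.continuous_cos.comp (continuous_const.mul
      ((continuous_apply i).comp continuous_subtype_val))⟩
  have hsep : (MvPolynomial.aeval (R := ℝ) c).range.SeparatesPoints := by
    intro x y hxy
    obtain ⟨i, hi⟩ := Function.ne_iff.1 (fun h => hxy (Subtype.ext h))
    refine ⟨c i, ⟨c i, ⟨MvPolynomial.X i, MvPolynomial.aeval_X _ _⟩, rfl⟩, fun h => hi ?_⟩
    have hangle : ∀ z : K, Real.pi * z.1 i ∈ Icc 0 Real.pi := fun z =>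
      ⟨mul_nonneg Real.pi_pos.le (z.2 i trivial).1,
        mul_le_of_le_one_right Real.pi_pos.le (z.2 i trivial).2⟩
    exact mul_left_cancel₀ Real.pi_ne_zero (Real.injOn_cos (hangle x) (hangle y) h)
  obtain ⟨⟨_, p, rfl⟩, hp⟩ :=
    ContinuousMap.exists_mem_subalgebra_near_continuousMap_of_separatesPoints
      _ hsep ⟨fun x : K => g x.1, by fun_prop⟩ ε hε
  refine ⟨p, fun x hx => ?_⟩
  have hxK : x ∈ K := fun i hi => Ioo_subset_Icc_self (hx i hi)
  have heval : ∀ q : MvPolynomial (Fin d) ℝ,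
      (MvPolynomial.aeval c q : C(K, ℝ)) ⟨x, hxK⟩ = cosPolynomial q x := by
    intro q
    induction q using MvPolynomial.induction_on with
    | C a => simp [cosPolynomial]
    | add p q hp hq => simp_all [cosPolynomial]
    | mul_X p i hp => simp_all [cosPolynomial, c]
  rw [← heval p, abs_sub_comm]
  exact (ContinuousMap.norm_coe_le_norm _ (⟨x, hxK⟩ : K)).trans hp.le

theorem integral_mul_eq_zero_of_cosPolynomial {w : (Fin d → ℝ) → ℝ}
    (hw : ∀ {g : (Fin d → ℝ) → ℝ}, Continuous g → IntegrableOn (fun x => w x * g x) (cube d))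
    (hpoly : ∀ p, ∫ x in cube d, w x * cosPolynomial p x = 0)
    {g : (Fin d → ℝ) → ℝ} (hg : Continuous g) : ∫ x in cube d, w x * g x = 0 := by
  have hwi : IntegrableOn w (cube d) := by simpa using hw (continuous_const (y := (1 : ℝ)))
  set I := ∫ x in cube d, |w x|
  have hI : 0 ≤ I := integral_nonneg fun _ => abs_nonneg _
  have hsmall : ∀ ε > 0, |∫ x in cube d, w x * g x| ≤ ε * I := by
    intro ε hε
    obtain ⟨p, hp⟩ := exists_cosPolynomial_near hg hε
    have hpc := continuous_cosPolynomial p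
    have hdiff : ∫ x in cube d, w x * g x = ∫ x in cube d, w x * (g x - cosPolynomial p x) := by
      simp only [mul_sub]
      rw [integral_sub (hw hg) (hw hpc), hpoly p, sub_zero]
    rw [hdiff, ← integral_const_mul]
    refine abs_integral_le_integral_abs.trans (setIntegral_mono_on (hw (hg.sub hpc)).abs
      (hwi.abs.const_mul _) measurableSet_cube fun x hx => ?_)
    rw [abs_mul, mul_comm ε]
    exact mul_le_mul_of_nonneg_left (hp x hx) (abs_nonneg _)
  refine abs_nonpos_iff.1 (le_of_forall_pos_le_add fun δ hδ => ?_)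
  have hI' : 0 < I + 1 := by linarith
  refine (hsmall (δ / (I + 1)) (by positivity)).trans ?_
  rw [zero_add, div_mul_eq_mul_div, div_le_iff₀ hI']
  nlinarith

theorem integral_mul_baseTrig_mul_cosPolynomial (hv : ∀ n, coef σ n v = 0)
    (p : MvPolynomial (Fin d) ℝ) :
    ∫ x in cube d, v x * tensor (fun i => baseTrig (σ i)) x * cosPolynomial p x = 0 := by
  have hexpand : ∀ x, v x * tensor (fun i => baseTrig (σ i)) x * cosPolynomial p x
      = ∑ k ∈ p.support, p.coeff k *
        (v x * tensor (fun i t => baseTrig (σ i) t * Real.cos (Real.pi * t) ^ k i) x) := by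
    intro x
    rw [cosPolynomial, MvPolynomial.eval_eq', Finset.mul_sum]
    refine Finset.sum_congr rfl fun k _ => ?_
    simp only [tensor, Finset.prod_mul_distrib]
    ring
  simp only [hexpand]
  rw [integral_finsetSum]
  · refine Finset.sum_eq_zero fun k _ => ?_
    rw [integral_const_mul, integral_mul_tensor_eq_zero hv
      fun i => baseTrig_mul_cos_pow_mem_span (σ i) (k i), mul_zero]
  · refine fun k _ => (L2.integrable_mul v (continuous_tensor fun i => ?_)).const_mul _
    exact (continuous_baseTrig _).mul (by fun_prop)

/- A polynomial in the `cos (π x_i)` times the lowest mode is a combination of modes. So the product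
of `v` and the lowest mode is orthogonal to all these polynomials, hence zero, and the lowest mode
has no zeros in the cube. -/
theorem eq_zero_of_coef_eq_zero (hv : ∀ n, coef σ n v = 0) : v = 0 := by
  have hbase : Continuous (tensor fun i => baseTrig (σ i)) :=
    continuous_tensor fun i => continuous_baseTrig _
  have hint : ∀ {g : (Fin d → ℝ) → ℝ}, Continuous g →
      IntegrableOn (fun x => v x * tensor (fun i => baseTrig (σ i)) x * g x) (cube d) := by
    intro g hg
    simpa only [mul_assoc, Pi.mul_apply] using L2.integrable_mul v (hbase.mul hg)
  have hprod := ae_eq_zero_of_integral_contDiff_smul_eq_zero (μ := volume.restrict (cube d))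
    (L2.integrable_mul v hbase).locallyIntegrable fun g hg _ => by
      simpa only [smul_eq_mul, mul_comm] using integral_mul_eq_zero_of_cosPolynomial hint
        (integral_mul_baseTrig_mul_cosPolynomial hv) hg.continuous
  rw [Lp.eq_zero_iff_ae_eq_zero]
  filter_upwards [hprod, ae_restrict_mem measurableSet_cube] with x hx hxc
  refine (mul_eq_zero.1 hx).resolve_right ?_
  exact Finset.prod_ne_zero_iff.2 fun i _ => baseTrig_ne_zero _ (hxc i trivial)

theorem eq_of_coef_eq {w : L2 d} (h : ∀ n, coef σ n v = coef σ n w) : v = w :=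
  sub_eq_zero.1 (eq_zero_of_coef_eq_zero (σ := σ) fun n => by rw [coef_sub, h, sub_self])

variable (σ)

/-- The trigonometric system `σ` as a Hilbert basis. -/
noncomputable def modeBasis : HilbertBasis (ModeIndex σ) ℝ (L2 d) :=
  HilbertBasis.mkOfOrthogonalEqBot (orthonormal_mode σ) <| by
    rw [Submodule.eq_bot_iff]
    intro v hv
    refine eq_zero_of_coef_eq_zero (σ := σ) fun n => ?_
    by_cases hn : ∀ i, σ i = true → n i ≠ 0
    · rw [coef_eq_inner, real_inner_comm]
      exact hv _ (Submodule.subset_span ⟨⟨n, hn⟩, rfl⟩)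
    · push Not at hn
      obtain ⟨i, hσ, hni⟩ := hn
      exact coef_eq_zero hσ hni v

theorem modeBasis_apply (n : ModeIndex σ) : modeBasis σ n = toL2 (continuous_mode σ n.1) := by
  rw [modeBasis, HilbertBasis.coe_mkOfOrthogonalEqBot]

theorem hasSum_coef_mul_coef (v w : L2 d) :
    HasSum (fun n => coef σ n v * coef σ n w) (inner ℝ v w) := by
  have hsupp : Function.support (fun n => coef σ n v * coef σ n w)
      ⊆ {n | ∀ i, σ i = true → n i ≠ 0} :=
    fun n hn i hσ hni => hn (by simp [coef_eq_zero hσ hni])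
  rw [← hasSum_subtype_iff_of_support_subset hsupp]
  refine ((modeBasis σ).hasSum_inner_mul_inner v w).congr_fun ?_
  intro n
  rw [modeBasis_apply, real_inner_comm w, ← coef_eq_inner, ← coef_eq_inner]
  rfl

theorem hasSum_coef_sq (v : L2 d) : HasSum (fun n => coef σ n v ^ 2) (‖v‖ ^ 2) := by
  rw [← real_inner_self_eq_norm_sq]
  simpa only [sq] using hasSum_coef_mul_coef σ v v

theorem exists_coef_eq {a : (Fin d → ℕ) → ℝ} (ha : Summable fun n => a n ^ 2)
    (h0 : ∀ n i, σ i = true → n i = 0 → a n = 0) : ∃ v : L2 d, ∀ n, coef σ n v = a n := by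
  have hmem : Memℓp (fun n : ModeIndex σ => a n.1) 2 := by
    refine memℓp_gen ?_
    have hsub : Summable fun n : ModeIndex σ => a n.1 ^ 2 :=
      ha.comp_injective Subtype.val_injective
    simpa using hsub
  refine ⟨(modeBasis σ).repr.symm ⟨_, hmem⟩, fun n => ?_⟩
  by_cases hn : ∀ i, σ i = true → n i ≠ 0
  · have hrepr := (modeBasis σ).repr_apply_apply ((modeBasis σ).repr.symm ⟨_, hmem⟩) ⟨n, hn⟩
    rw [LinearIsometryEquiv.apply_symm_apply, modeBasis_apply, real_inner_comm,
      ← coef_eq_inner] at hrepr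
    exact hrepr.symm
  · push Not at hn
    obtain ⟨i, hσ, hni⟩ := hn
    rw [coef_eq_zero hσ hni, h0 n i hσ hni]

end Completeness

/-! ### Weak derivatives and Fourier coefficients -/

section WeakDerivatives

variable {d : ℕ}

theorem HasWeakDeriv.integral_tensor_of_isTestOne {l : List (Fin d)} (hl : l.Nodup) {v g : L2 d}
    (h : HasWeakDeriv l v g) {f : Fin d → ℝ → ℝ} (hf : ∀ i, IsTestOne (f i)) :
    ∫ x in cube d, v x * tensor (fun i => if i ∈ l then deriv (f i) else f i) x
      = (-1) ^ l.length * ∫ x in cube d, g x * tensor f x := by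
  have hderiv : (fun i => if i ∈ l then deriv (f i) else f i)
      = fun i => deriv^[l.count i] (f i) := by
    funext i
    split_ifs with hi
    · rw [List.count_eq_one_of_mem hl hi, Function.iterate_one]
    · rw [List.count_eq_zero_of_not_mem hi, Function.iterate_zero, id]
  rw [← h _ (isTest_tensor hf), pds_tensor fun i => (hf i).1, hderiv]

theorem L2.tendsto_integral_tensor_mul_cutoff (l : List (Fin d)) (v : L2 d) {f : Fin d → ℝ → ℝ}
    (hf : ∀ i, ContDiff ℝ 1 (f i)) (hboundary : ∀ i ∈ l, f i 0 = 0 ∧ f i 1 = 0) :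
    Tendsto (fun m => ∫ x in cube d, v x * tensor (fun i => if i ∈ l then
        deriv (fun x => f i x * cutoff m x) else fun x => f i x * cutoff m x) x) atTop
      (𝓝 (∫ x in cube d, v x * tensor (fun i => if i ∈ l then deriv (f i) else f i) x)) := by
  refine L2.tendsto_integral_tensor v (fun m i => ?_) (fun i => ?_) fun i x hx => ?_
  · have hsmooth : ContDiff ℝ 1 fun x => f i x * cutoff m x :=
      (hf i).mul ((contDiff_cutoff m).of_le (by simp))
    split_ifs
    · exact hsmooth.continuous_deriv le_rfl
    · exact hsmooth.continuous
  · split_ifs with hi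
    · exact exists_bound_deriv_mul_cutoff (hf i) (hboundary i hi).1 (hboundary i hi).2
    · exact exists_bound_mul_cutoff (hf i).continuous
  · split_ifs
    · exact tendsto_deriv_mul_cutoff _ hx
    · exact tendsto_mul_cutoff _ hx

theorem HasWeakDeriv.integral_tensor {l : List (Fin d)} (hl : l.Nodup) {v g : L2 d}
    (h : HasWeakDeriv l v g) {f : Fin d → ℝ → ℝ} (hf : ∀ i, ContDiff ℝ ∞ (f i))
    (hboundary : ∀ i ∈ l, f i 0 = 0 ∧ f i 1 = 0) :
    ∫ x in cube d, v x * tensor (fun i => if i ∈ l then deriv (f i) else f i) x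
      = (-1) ^ l.length * ∫ x in cube d, g x * tensor f x := by
  have hf' : ∀ i, ContDiff ℝ 1 (f i) := fun i => (hf i).of_le (by simp)
  have hleft := L2.tendsto_integral_tensor_mul_cutoff l v hf' hboundary
  have hright := L2.tendsto_integral_tensor_mul_cutoff [] g hf' (by simp)
  simp only [List.not_mem_nil, if_false] at hright
  refine tendsto_nhds_unique hleft ((hright.const_mul _).congr fun m => ?_)
  exact (h.integral_tensor_of_isTestOne hl fun i => isTestOne_mul_cutoff (hf i) m).symm

theorem integral_mul_const_mul_mode (v : L2 d) (c : ℝ) (σ : Fin d → Bool) (n : Fin d → ℕ) :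
    ∫ x in cube d, v x * (c * mode σ n x) = c * coef σ n v := by
  simp only [coef, ← integral_const_mul, mul_left_comm]

theorem HasWeakDeriv.coef_eq {l : List (Fin d)} (hl : l.Nodup) {v g : L2 d}
    (h : HasWeakDeriv l v g) {σ : Fin d → Bool} (hσ : ∀ i ∈ l, σ i = true) (n : Fin d → ℕ) :
    coef σ n g = (-1) ^ l.length * ((∏ i ∈ l.toFinset, (n i * Real.pi))
      * coef (fun i => if i ∈ l then false else σ i) n v) := by
  have hgreen := h.integral_tensor hl (f := fun i => trig (σ i) (n i))
    (fun i => contDiff_trig _ _) fun i hi => by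
      rw [hσ i hi]; exact ⟨trig_true_zero _, trig_true_one _⟩
  have hderiv : tensor (fun i => if i ∈ l then deriv (trig (σ i) (n i)) else trig (σ i) (n i))
      = fun x => (∏ i ∈ l.toFinset, (n i * Real.pi))
        * mode (fun i => if i ∈ l then false else σ i) n x := by
    funext x
    have hprod : ∏ i ∈ l.toFinset, ((n i : ℝ) * Real.pi)
        = ∏ i, if i ∈ l then n i * Real.pi else 1 := by
      rw [Finset.prod_ite, Finset.prod_const_one, mul_one]
      exact Finset.prod_congr (by ext i; simp) fun _ _ => rfl
    simp only [mode, tensor]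
    rw [hprod, ← Finset.prod_mul_distrib]
    refine Finset.prod_congr rfl fun i _ => ?_
    by_cases hi : i ∈ l
    · simp only [if_pos hi, hσ i hi, deriv_trig_true]
    · simp only [if_neg hi, one_mul]
  rw [hderiv, integral_mul_const_mul_mode] at hgreen
  rw [hgreen, ← mul_assoc, ← mul_pow, neg_one_mul, neg_neg, one_pow, one_mul]
  rfl

theorem HasWeakDeriv.coef_eq_single {i : Fin d} {v g : L2 d} (h : HasWeakDeriv [i] v g)
    {σ : Fin d → Bool} (hσ : σ i = true) (n : Fin d → ℕ) :
    coef σ n g = -(n i * Real.pi * coef (Function.update σ i false) n v) := by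
  have hupdate : (fun k => if k ∈ [i] then false else σ k) = Function.update σ i false := by
    funext k
    simp only [List.mem_singleton, Function.update_apply]
  rw [h.coef_eq (List.nodup_singleton i) (σ := σ) (by simpa using hσ) n, hupdate]
  simp

theorem L2.eq_of_integral_test {g g' : L2 d}
    (h : ∀ φ, IsTest φ → ∫ x in cube d, g x * φ x = ∫ x in cube d, g' x * φ x) : g = g' := by
  have hnil : HasWeakDeriv [] g g' := fun φ hφ => by simpa [pds] using h φ hφ
  refine eq_of_coef_eq (σ := fun _ => true) fun n => ?_
  simpa using (hnil.coef_eq List.nodup_nil (σ := fun _ => true) (by simp) n).symm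

theorem HasWeakDeriv.unique {l : List (Fin d)} {v g g' : L2 d} (h : HasWeakDeriv l v g)
    (h' : HasWeakDeriv l v g') : g = g' :=
  L2.eq_of_integral_test fun φ hφ =>
    mul_left_cancel₀ (pow_ne_zero _ (by norm_num)) ((h φ hφ).symm.trans (h' φ hφ))

theorem contDiff_pd {φ : (Fin d → ℝ) → ℝ} (hφ : ContDiff ℝ ∞ φ) (i : Fin d) :
    ContDiff ℝ ∞ (pd i φ) :=
  (hφ.fderiv_right (by simp)).clm_apply contDiff_const

theorem contDiff_pds {φ : (Fin d → ℝ) → ℝ} (hφ : ContDiff ℝ ∞ φ) (l : List (Fin d)) :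
    ContDiff ℝ ∞ (pds l φ) := by
  induction l with
  | nil => exact hφ
  | cons i l ih => exact contDiff_pd ih i

theorem hasCompactSupport_pd {φ : (Fin d → ℝ) → ℝ} (hφ : HasCompactSupport φ) (i : Fin d) :
    HasCompactSupport (pd i φ) :=
  hφ.fderiv_apply ℝ _

theorem tsupport_pd_subset (φ : (Fin d → ℝ) → ℝ) (i : Fin d) : tsupport (pd i φ) ⊆ tsupport φ :=
  tsupport_fderiv_apply_subset ℝ _

theorem HasWeakDeriv.sub {l : List (Fin d)} {v g v' g' : L2 d} (h : HasWeakDeriv l v g)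
    (h' : HasWeakDeriv l v' g') : HasWeakDeriv l (v - v') (g - g') := by
  intro φ hφ
  have hv := h φ hφ
  have hv' := h' φ hφ
  rw [← inner_toL2 _ (contDiff_pds hφ.1 l).continuous, ← inner_toL2 _ hφ.1.continuous]
    at hv hv' ⊢
  rw [inner_sub_left, inner_sub_left, hv, hv', mul_sub]

theorem HasWeakDeriv.hasWeakDiv {v g : Fin d → L2 d} (h : ∀ i, HasWeakDeriv [i] (v i) (g i)) :
    HasWeakDiv v (∑ i, g i) := by
  intro φ hφ
  have hgreen : ∀ i, ∫ x in cube d, v i x * pd i φ x = -∫ x in cube d, g i x * φ x := fun i => by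
    simpa [pds] using h i φ hφ
  simp only [hgreen]
  rw [← inner_toL2 _ hφ.1.continuous, sum_inner, ← Finset.sum_neg_distrib]
  exact Finset.sum_congr rfl fun i _ => by rw [inner_toL2 _ hφ.1.continuous]

theorem HasWeakDiv.unique {v : Fin d → L2 d} {g g' : L2 d} (h : HasWeakDiv v g)
    (h' : HasWeakDiv v g') : g = g' :=
  L2.eq_of_integral_test fun φ hφ => neg_injective ((h φ hφ).symm.trans (h' φ hφ))

end WeakDerivatives

/-! ### Derivatives with zero trace -/

section ZeroTrace

variable {d : ℕ}

theorem HasDerivZeroTrace.hasWeakDeriv {i : Fin d} {v g : L2 d} (h : HasDerivZeroTrace i v g) :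
    HasWeakDeriv [i] v g := fun φ hφ => by
  simpa [pds] using h φ hφ.1 hφ.2.1

theorem HasDerivZeroTrace.hasWeakDeriv_of_second {i : Fin d} {v g h : L2 d}
    (hv : HasDerivZeroTrace i v g) (hvv : HasWeakDeriv [i, i] v h) : HasWeakDeriv [i] g h := by
  intro φ hφ
  have hsecond : ∫ x in cube d, v x * pd i (pd i φ) x = ∫ x in cube d, h x * φ x := by
    simpa [pds] using hvv φ hφ
  have hfirst := hv (pd i φ) (contDiff_pd hφ.1 i) (hasCompactSupport_pd hφ.2.1 i)
  rw [List.length_singleton, pow_one, neg_one_mul, ← hsecond, hfirst, neg_neg]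
  rfl

/-- A smooth function of one variable with compact support that is `1` near `[0,1]`. -/
noncomputable def plateau : ContDiffBump (1 / 2 : ℝ) := ⟨1, 2, one_pos, one_lt_two⟩

theorem mul_plateau_eventuallyEq (f : ℝ → ℝ) {x : ℝ} (hx : x ∈ Ioo (0 : ℝ) 1) :
    (fun y => f y * plateau y) =ᶠ[𝓝 x] f := by
  filter_upwards [isOpen_Ioo.mem_nhds hx] with y hy
  have hone : plateau y = 1 := by
    refine plateau.one_of_mem_closedBall ?_
    rw [Metric.mem_closedBall, Real.dist_eq]
    change |y - 1 / 2| ≤ 1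
    rw [abs_le]
    exact ⟨by linarith [hy.1], by linarith [hy.2]⟩
  rw [hone, mul_one]

theorem hasCompactSupport_tensor_mul_plateau (f : Fin d → ℝ → ℝ) :
    HasCompactSupport (tensor fun k x => f k x * plateau x) := by
  refine IsCompact.of_isClosed_subset (isCompact_univ_pi fun k => ?_) (isClosed_tsupport _)
    (tsupport_tensor_subset _)
  exact HasCompactSupport.mul_left plateau.hasCompactSupport

theorem HasDerivZeroTrace.integral_tensor {i : Fin d} {v g : L2 d} (h : HasDerivZeroTrace i v g)
    {f : Fin d → ℝ → ℝ} (hf : ∀ i, ContDiff ℝ ∞ (f i)) :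
    ∫ x in cube d, v x * tensor (Function.update f i (deriv (f i))) x
      = -∫ x in cube d, g x * tensor f x := by
  let F : Fin d → ℝ → ℝ := fun k x => f k x * plateau x
  have hF : ∀ k, ContDiff ℝ ∞ (F k) := fun k => (hf k).mul plateau.contDiff
  have hFf : ∀ k, ∀ x ∈ Ioo (0 : ℝ) 1, F k =ᶠ[𝓝 x] f k := fun k x hx =>
    mul_plateau_eventuallyEq (f k) hx
  have hgreen := h _ (contDiff_tensor hF) (hasCompactSupport_tensor_mul_plateau f)
  rw [pd_tensor fun k => (hF k).differentiable (by simp)] at hgreen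
  have hleft : ∫ x in cube d, v x * tensor (Function.update F i (deriv (F i))) x
      = ∫ x in cube d, v x * tensor (Function.update f i (deriv (f i))) x := by
    refine setIntegral_congr_fun measurableSet_cube fun x hx => ?_
    simp only [tensor_update_left]
    rw [(hFf i _ (hx i trivial)).deriv_eq]
    congr 2
    exact Finset.prod_congr rfl fun k _ => (hFf k _ (hx k trivial)).self_of_nhds
  have hright : ∫ x in cube d, g x * tensor F x = ∫ x in cube d, g x * tensor f x := by
    refine setIntegral_congr_fun measurableSet_cube fun x hx => ?_
    simp only [tensor]
    congr 1
    exact Finset.prod_congr rfl fun k _ => (hFf k _ (hx k trivial)).self_of_nhds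
  rw [← hleft, ← hright, hgreen]

theorem HasDerivZeroTrace.coef_eq {i : Fin d} {v g : L2 d} (h : HasDerivZeroTrace i v g)
    {σ : Fin d → Bool} (hσ : σ i = true) (n : Fin d → ℕ) :
    coef (Function.update σ i false) n g = n i * Real.pi * coef σ n v := by
  have hgreen := h.integral_tensor (f := fun k => trig (Function.update σ i false k) (n k))
    fun k => contDiff_trig _ _
  have hderiv : tensor (Function.update (fun k => trig (Function.update σ i false k) (n k)) i
      (deriv (trig (Function.update σ i false i) (n i))))
      = fun x => -(n i * Real.pi) * mode σ n x := by
    funext x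
    rw [tensor_update_left, mode, tensor_eq_mul _ i, Function.update_self, deriv_trig_false, hσ,
      ← mul_assoc]
    congr 1
    exact Finset.prod_congr rfl fun k hk => by
      rw [Function.update_of_ne (Finset.ne_of_mem_erase hk)]
  rw [hderiv, integral_mul_const_mul_mode, neg_mul] at hgreen
  exact (neg_injective hgreen).symm

theorem HasDerivZeroTrace.coef_second_eq {i : Fin d} {v g h : L2 d}
    (hv : HasDerivZeroTrace i v g) (hvv : HasWeakDeriv [i, i] v h) {σ : Fin d → Bool}
    (hσ : σ i = true) (n : Fin d → ℕ) : coef σ n h = -((n i * Real.pi) ^ 2 * coef σ n v) := by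
  rw [(hv.hasWeakDeriv_of_second hvv).coef_eq_single hσ, hv.coef_eq hσ]
  ring

theorem integral_toL2_mul {g h : (Fin d → ℝ) → ℝ} (hg : Continuous g) (hh : tsupport h ⊆ cube d) :
    ∫ x in cube d, toL2 hg x * h x = ∫ x, g x * h x := by
  have hcongr : ∫ x in cube d, toL2 hg x * h x = ∫ x in cube d, g x * h x := by
    refine integral_congr_ae ?_
    filter_upwards [coeFn_toL2 hg] with x hx
    rw [hx]
  rw [hcongr]
  refine setIntegral_eq_integral_of_forall_compl_eq_zero fun x hx => ?_
  rw [image_eq_zero_of_notMem_tsupport fun hx' => hx (hh hx'), mul_zero]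

theorem integral_mul_pd {φ θ : (Fin d → ℝ) → ℝ} (hφ : ContDiff ℝ ∞ φ) (hθ : ContDiff ℝ ∞ θ)
    (hsupp : HasCompactSupport θ) (i : Fin d) :
    ∫ x, φ x * pd i θ x = -∫ x, pd i φ x * θ x :=
  integral_mul_fderiv_eq_neg_fderiv_mul_of_integrable
    (((contDiff_pd hφ i).continuous.mul hθ.continuous).integrable_of_hasCompactSupport
      hsupp.mul_left)
    ((hφ.continuous.mul (contDiff_pd hθ i).continuous).integrable_of_hasCompactSupport
      (hasCompactSupport_pd hsupp i).mul_left)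
    ((hφ.continuous.mul hθ.continuous).integrable_of_hasCompactSupport hsupp.mul_left)
    (fun x _ => hφ.differentiable (by simp) x) (fun x _ => hθ.differentiable (by simp) x)

theorem hasWeakDeriv_toL2 {φ : (Fin d → ℝ) → ℝ} (hφ : ContDiff ℝ ∞ φ) (i : Fin d) :
    HasWeakDeriv [i] (toL2 hφ.continuous) (toL2 (contDiff_pd hφ i).continuous) := by
  intro θ hθ
  rw [List.length_singleton, pow_one, neg_one_mul, integral_toL2_mul _ hθ.2.2,
    ← integral_mul_pd hφ hθ.1 hθ.2.1 i]
  exact integral_toL2_mul hφ.continuous ((tsupport_pd_subset θ i).trans hθ.2.2)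

theorem HasDerivZeroTrace.inner_eq {i : Fin d} {v g w h : L2 d} (hv : HasDerivZeroTrace i v g)
    (hw : HasWeakDeriv [i] w h) : inner ℝ v h = -inner ℝ g w := by
  let σ : Fin d → Bool := fun _ => true
  have hsum := (hasSum_coef_mul_coef (Function.update σ i false) g w).neg
  refine (hasSum_coef_mul_coef σ v h).unique (hsum.congr_fun fun n => ?_)
  rw [hv.coef_eq (σ := σ) rfl, hw.coef_eq_single (σ := σ) rfl]
  ring

theorem hasDerivZeroTrace_of_coef {i : Fin d} {v g : L2 d} {σ : Fin d → Bool} (hσ : σ i = true)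
    (h : ∀ n, coef (Function.update σ i false) n g = n i * Real.pi * coef σ n v) :
    HasDerivZeroTrace i v g := by
  intro φ hφ _
  rw [← inner_toL2 _ (contDiff_pd hφ i).continuous, ← inner_toL2 _ hφ.continuous]
  have hsum := (hasSum_coef_mul_coef (Function.update σ i false) g (toL2 hφ.continuous)).neg
  refine (hasSum_coef_mul_coef σ v _).unique (hsum.congr_fun fun n => ?_)
  rw [h, (hasWeakDeriv_toL2 hφ i).coef_eq_single hσ]
  ring

end ZeroTrace

/-! ### The symbol of the splitting operator -/

section Symbols

variable {d : ℕ}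

/-- The symbol `(n i π)²` of `-∂_{ii}`. -/
noncomputable def freqSq (n : Fin d → ℕ) (i : Fin d) : ℝ := (n i * Real.pi) ^ 2

/-- The symbol of `-Δ`. -/
noncomputable def lapSymbol (n : Fin d → ℕ) : ℝ := ∑ i, freqSq n i

/-- The symbol of the splitting operator `B`: the remainder of `∏ᵢ (1 - (τ/2) ∂_{ii})` after the
terms of order at most two, divided by `τ²/4`. -/
noncomputable def splitSymbol (τ : ℝ) (n : Fin d → ℕ) : ℝ :=
  4 / τ ^ 2 * (∏ i, (1 + τ / 2 * freqSq n i) - 1 - τ / 2 * lapSymbol n)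

theorem freqSq_nonneg (n : Fin d → ℕ) (i : Fin d) : 0 ≤ freqSq n i := sq_nonneg _

theorem lapSymbol_nonneg (n : Fin d → ℕ) : 0 ≤ lapSymbol n :=
  Finset.sum_nonneg fun i _ => freqSq_nonneg n i

theorem one_add_sum_le_prod_one_add {ι : Type*} (s : Finset ι) {x : ι → ℝ}
    (hx : ∀ i ∈ s, 0 ≤ x i) : 1 + ∑ i ∈ s, x i ≤ ∏ i ∈ s, (1 + x i) := by
  classical
  induction s using Finset.induction_on with
  | empty => simp
  | insert i s hi ih =>
    obtain ⟨hxi, hxs⟩ := Finset.forall_mem_insert _ _ _ |>.1 hx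
    rw [Finset.sum_insert hi, Finset.prod_insert hi]
    calc 1 + (x i + ∑ k ∈ s, x k) ≤ (1 + x i) * (1 + ∑ k ∈ s, x k) := by
          nlinarith [mul_nonneg hxi (Finset.sum_nonneg hxs)]
      _ ≤ (1 + x i) * ∏ k ∈ s, (1 + x k) :=
          mul_le_mul_of_nonneg_left (ih hxs) (by linarith)

theorem splitSymbol_nonneg {τ : ℝ} (hτ : 0 < τ) (n : Fin d → ℕ) : 0 ≤ splitSymbol τ n := by
  refine mul_nonneg (by positivity) ?_
  have hprod : 1 + ∑ i, τ / 2 * freqSq n i ≤ ∏ i, (1 + τ / 2 * freqSq n i) :=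
    one_add_sum_le_prod_one_add _ fun i _ => mul_nonneg (by positivity) (freqSq_nonneg n i)
  rw [← Finset.mul_sum] at hprod
  rw [lapSymbol]
  linarith

theorem splitSymbol_two {τ : ℝ} (hτ : τ ≠ 0) (n : Fin 2 → ℕ) :
    splitSymbol τ n = freqSq n 0 * freqSq n 1 := by
  simp only [splitSymbol, lapSymbol, Fin.prod_univ_two, Fin.sum_univ_two]
  field_simp
  ring

theorem splitSymbol_three {τ : ℝ} (hτ : τ ≠ 0) (n : Fin 3 → ℕ) :
    splitSymbol τ n = freqSq n 0 * freqSq n 1 + freqSq n 1 * freqSq n 2 + freqSq n 2 * freqSq n 0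
      + τ / 2 * (freqSq n 0 * freqSq n 1 * freqSq n 2) := by
  simp only [splitSymbol, lapSymbol, Fin.prod_univ_three, Fin.sum_univ_three]
  field_simp
  ring

theorem iterate_deriv_two_trig_true (n : ℕ) :
    deriv^[2] (trig true n) = fun x => -(n * Real.pi) ^ 2 * trig true n x := by
  have hconst : deriv (fun x => n * Real.pi * trig false n x)
      = fun x => n * Real.pi * deriv (trig false n) x :=
    funext fun x => deriv_const_mul _ ((contDiff_trig false n).differentiable (by simp) x)
  rw [Function.iterate_succ_apply', Function.iterate_one, deriv_trig_true, hconst,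
    deriv_trig_false]
  funext x
  ring

theorem pds_mode_of_count {l : List (Fin d)} (hl : ∀ i, l.count i = 0 ∨ l.count i = 2)
    (n : Fin d → ℕ) (x : Fin d → ℝ) :
    pds l (mode (fun _ => true) n) x
      = (∏ i, if l.count i = 2 then -freqSq n i else 1) * mode (fun _ => true) n x := by
  rw [show mode (fun _ => true) n = tensor fun i => trig true (n i) from rfl,
    pds_tensor fun i => contDiff_trig _ _]
  simp only [tensor]
  rw [← Finset.prod_mul_distrib]
  refine Finset.prod_congr rfl fun i _ => ?_
  rcases hl i with hi | hi
  · simp [hi]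
  · rw [if_pos hi, hi, iterate_deriv_two_trig_true, freqSq]

theorem splitB_mode (hd : d = 2 ∨ d = 3) {τ : ℝ} (hτ : τ ≠ 0) (n : Fin d → ℕ) :
    splitB d τ (mode (fun _ => true) n)
      = fun x => splitSymbol τ n * mode (fun _ => true) n x := by
  funext x
  rcases hd with rfl | rfl
  · rw [splitB, pds_mode_of_count (by decide), splitSymbol_two hτ]
    simp [Fin.prod_univ_two]
  · simp only [splitB]
    rw [pds_mode_of_count (by decide), pds_mode_of_count (by decide),
      pds_mode_of_count (by decide), pds_mode_of_count (by decide), splitSymbol_three hτ]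
    simp [Fin.prod_univ_three]
    ring

theorem pds_tensor_update {f : Fin d → ℝ → ℝ} (hf : ∀ i, ContDiff ℝ ∞ (f i)) {p : ℝ → ℝ}
    (hp : ContDiff ℝ ∞ p) (l : List (Fin d)) (i : Fin d) :
    pds l (tensor (Function.update f i p))
      = tensor (Function.update (fun k => deriv^[l.count k] (f k)) i (deriv^[l.count i] p)) := by
  rw [pds_tensor ((Function.forall_update_iff f fun _ q => ContDiff ℝ ∞ q).2
    ⟨hp, fun k _ => hf k⟩)]
  congr 1
  funext k
  exact Function.apply_update (fun k => deriv^[l.count k]) f i p k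

theorem L2.tendsto_integral_tensor_update (w : L2 d) {f : Fin d → ℝ → ℝ}
    (hf : ∀ k, Continuous (f k)) (i : Fin d) {P : ℕ → ℝ → ℝ} {p : ℝ → ℝ}
    (hP : ∀ m, Continuous (P m)) (hbound : ∃ C, ∀ m, ∀ x ∈ Ioo (0 : ℝ) 1, |P m x| ≤ C)
    (hlim : ∀ x ∈ Ioo (0 : ℝ) 1, Tendsto (fun m => P m x) atTop (𝓝 (p x))) :
    Tendsto (fun m => ∫ x in cube d, w x * tensor (Function.update f i (P m)) x) atTop
      (𝓝 (∫ x in cube d, w x * tensor (Function.update f i p) x)) := by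
  refine L2.tendsto_integral_tensor w (fun m k => ?_) (fun k => ?_) (fun k x hx => ?_)
  · rcases eq_or_ne k i with rfl | hk
    · rw [Function.update_self]; exact hP m
    · rw [Function.update_of_ne hk]; exact hf k
  · rcases eq_or_ne k i with rfl | hk
    · simpa only [Function.update_self] using hbound
    · simp only [Function.update_of_ne hk]
      obtain ⟨C, hC⟩ := isCompact_Icc (a := (0 : ℝ)) (b := 1) |>.exists_bound_of_continuousOn
        (hf k).continuousOn
      exact ⟨C, fun _ x hx => hC x (Ioo_subset_Icc_self hx)⟩
  · rcases eq_or_ne k i with rfl | hk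
    · simpa only [Function.update_self] using hlim x hx
    · simp only [Function.update_of_ne hk]
      exact tendsto_const_nhds

theorem HasDerivZeroTrace.integral_tensor_update {i : Fin d} {v g : L2 d}
    (hv : HasDerivZeroTrace i v g) {f : Fin d → ℝ → ℝ} (hf : ∀ k, ContDiff ℝ ∞ (f k))
    {p : ℝ → ℝ} (hp : ContDiff ℝ ∞ p) :
    ∫ x in cube d, v x * tensor (Function.update f i (deriv p)) x
      = -∫ x in cube d, g x * tensor (Function.update f i p) x := by
  have hsmooth : ∀ k, ContDiff ℝ ∞ (Function.update f i p k) :=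
    (Function.forall_update_iff f fun _ q => ContDiff ℝ ∞ q).2 ⟨hp, fun k _ => hf k⟩
  have hgreen := hv.integral_tensor hsmooth
  rwa [Function.update_self, Function.update_idem] at hgreen

theorem HasDerivZeroTrace.tendsto_integral_pds {i : Fin d} {v g : L2 d}
    (hv : HasDerivZeroTrace i v g) {f : Fin d → ℝ → ℝ} (hf : ∀ i, ContDiff ℝ ∞ (f i))
    (h0 : f i 0 = 0) (h1 : f i 1 = 0) {l : List (Fin d)} (hl : l.count i = 0 ∨ l.count i = 2) :
    Tendsto (fun m => ∫ x in cube d,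
        v x * pds l (tensor (Function.update f i fun x => f i x * cutoff m x)) x) atTop
      (𝓝 (∫ x in cube d, v x * pds l (tensor f) x)) := by
  let F : ℕ → ℝ → ℝ := fun m x => f i x * cutoff m x
  have hF : ∀ m, ContDiff ℝ ∞ (F m) := fun m => (hf i).mul (contDiff_cutoff m)
  let G : Fin d → ℝ → ℝ := fun k => deriv^[l.count k] (f k)
  have hG : ∀ k, ContDiff ℝ ∞ (G k) := fun k => (hf k).iterate_deriv _
  have hpds : ∀ m, pds l (tensor (Function.update f i (F m)))
      = tensor (Function.update G i (deriv^[l.count i] (F m))) := fun m =>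
    pds_tensor_update hf (hF m) l i
  have hlimit : pds l (tensor f) = tensor (Function.update G i (deriv^[l.count i] (f i))) := by
    rw [← pds_tensor_update hf (hf i), Function.update_eq_self]
  change Tendsto (fun m => ∫ x in cube d, v x * pds l (tensor (Function.update f i (F m))) x) _ _
  simp only [hlimit, hpds]
  rcases hl with hl | hl
  · simp only [hl, Function.iterate_zero, id]
    exact L2.tendsto_integral_tensor_update v (fun k => (hG k).continuous) i
      (fun m => (hF m).continuous) (exists_bound_mul_cutoff (hf i).continuous)
      fun x hx => tendsto_mul_cutoff _ hx
  · -- One derivative is moved onto `v`: only the first derivatives of `F m` are bounded in `m`.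
    have hparts : ∀ p : ℝ → ℝ, ContDiff ℝ ∞ p →
        ∫ x in cube d, v x * tensor (Function.update G i (deriv^[2] p)) x
          = -∫ x in cube d, g x * tensor (Function.update G i (deriv p)) x := fun p hp =>
      hv.integral_tensor_update hG (hp.iterate_deriv 1)
    simp only [hl, hparts _ (hf i), fun m => hparts _ (hF m)]
    exact (L2.tendsto_integral_tensor_update g (fun k => (hG k).continuous) i
      (fun m => (hF m).continuous_deriv (by simp))
      (exists_bound_deriv_mul_cutoff ((hf i).of_le (by simp)) h0 h1)
      fun x hx => tendsto_deriv_mul_cutoff _ hx).neg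

theorem integral_mul_splitB_three (τ : ℝ) (v : L2 3) {φ : (Fin 3 → ℝ) → ℝ}
    (hφ : ContDiff ℝ ∞ φ) :
    ∫ x in cube 3, v x * splitB 3 τ φ x = (∫ x in cube 3, v x * pds [0, 0, 1, 1] φ x)
      + (∫ x in cube 3, v x * pds [1, 1, 2, 2] φ x) + (∫ x in cube 3, v x * pds [2, 2, 0, 0] φ x)
      - τ / 2 * ∫ x in cube 3, v x * pds [0, 0, 1, 1, 2, 2] φ x := by
  have hint := fun l => L2.integrable_mul v (contDiff_pds hφ l).continuous
  simp only [splitB, mul_sub, mul_add, mul_left_comm _ (τ / 2)]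
  rw [integral_sub, integral_add, integral_add (hint _) (hint _), integral_const_mul]
  · exact (hint _).add (hint _)
  · exact hint _
  · exact ((hint _).add (hint _)).add (hint _)
  · exact (hint _).const_mul _

theorem HasDerivZeroTrace.tendsto_integral_splitB (hd : d = 2 ∨ d = 3) (τ : ℝ) {i : Fin d}
    {v g : L2 d} (hv : HasDerivZeroTrace i v g) {f : Fin d → ℝ → ℝ}
    (hf : ∀ i, ContDiff ℝ ∞ (f i)) (h0 : f i 0 = 0) (h1 : f i 1 = 0) :
    Tendsto (fun m => ∫ x in cube d,
        v x * splitB d τ (tensor (Function.update f i fun x => f i x * cutoff m x)) x) atTop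
      (𝓝 (∫ x in cube d, v x * splitB d τ (tensor f) x)) := by
  rcases hd with rfl | rfl
  · exact hv.tendsto_integral_pds hf h0 h1 (by fin_cases i <;> simp)
  · have hsmooth : ∀ m,
        ContDiff ℝ ∞ (tensor (Function.update f i fun x => f i x * cutoff m x)) := fun m =>
      contDiff_tensor ((Function.forall_update_iff f fun _ q => ContDiff ℝ ∞ q).2
        ⟨(hf i).mul (contDiff_cutoff m), fun k _ => hf k⟩)
    simp only [integral_mul_splitB_three τ v (hsmooth _),
      integral_mul_splitB_three τ v (contDiff_tensor hf)]
    refine (((hv.tendsto_integral_pds hf h0 h1 ?_).add (hv.tendsto_integral_pds hf h0 h1 ?_)).add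
      (hv.tendsto_integral_pds hf h0 h1 ?_)).sub
      ((hv.tendsto_integral_pds hf h0 h1 ?_).const_mul _) <;> fin_cases i <;> simp

/- The cutoffs are removed one direction at a time, so that the zero trace of `v` in that direction
absorbs the derivatives of the cutoff; `s` is the set of directions already treated. -/
theorem HasB.integral_tensor_of_isTestOne_compl (hd : d = 2 ∨ d = 3) {τ : ℝ} {v w : L2 d}
    (h : HasB τ v w) (s : Finset (Fin d)) {f : Fin d → ℝ → ℝ} (hf : ∀ i, ContDiff ℝ ∞ (f i))
    (hboundary : ∀ i ∈ s, f i 0 = 0 ∧ f i 1 = 0) (htest : ∀ i ∉ s, IsTestOne (f i)) :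
    ∫ x in cube d, v x * splitB d τ (tensor f) x = ∫ x in cube d, w x * tensor f x := by
  induction s using Finset.induction_on generalizing f with
  | empty => exact h.2 _ (isTest_tensor fun i => htest i (Finset.notMem_empty i))
  | insert i s hi ih =>
    obtain ⟨g, hg⟩ := h.1 i
    obtain ⟨⟨h0, h1⟩, hboundary⟩ := Finset.forall_mem_insert _ _ _ |>.1 hboundary
    have hleft := hg.tendsto_integral_splitB hd τ hf h0 h1
    have hright := L2.tendsto_integral_tensor_update w (fun k => (hf k).continuous) i
      (fun m => ((hf i).mul (contDiff_cutoff m)).continuous)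
      (exists_bound_mul_cutoff (hf i).continuous) fun x hx => tendsto_mul_cutoff (f i) hx
    rw [Function.update_eq_self] at hright
    refine tendsto_nhds_unique (hleft.congr fun m => ih ?_ (fun k hk => ?_) fun k hk => ?_) hright
    · exact (Function.forall_update_iff f fun _ q => ContDiff ℝ ∞ q).2
        ⟨(hf i).mul (contDiff_cutoff m), fun k _ => hf k⟩
    · rw [Function.update_of_ne (ne_of_mem_of_not_mem hk hi)]
      exact hboundary k hk
    · rcases eq_or_ne k i with rfl | hki
      · rw [Function.update_self]; exact isTestOne_mul_cutoff (hf k) m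
      · rw [Function.update_of_ne hki]; exact htest k (by simp [hki, hk])

theorem HasB.coef_eq (hd : d = 2 ∨ d = 3) {τ : ℝ} (hτ : τ ≠ 0) {v w : L2 d} (h : HasB τ v w)
    (n : Fin d → ℕ) :
    coef (fun _ => true) n w = splitSymbol τ n * coef (fun _ => true) n v := by
  have hmode : ∫ x in cube d, v x * splitB d τ (mode (fun _ => true) n) x
      = coef (fun _ => true) n w :=
    h.integral_tensor_of_isTestOne_compl hd Finset.univ (fun i => contDiff_trig _ _)
      (fun i _ => ⟨trig_true_zero _, trig_true_one _⟩) (by simp)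
  rw [← hmode, splitB_mode hd hτ, integral_mul_const_mul_mode]

end Symbols

/-! ### Diagonal operators -/

section DiagonalOperators

variable {d : ℕ}

theorem exists_multiplier (σ σ' : Fin d → Bool) {m : (Fin d → ℕ) → ℝ} {C : ℝ}
    (hm : ∀ n, |m n| ≤ C) (h0 : ∀ n i, σ' i = true → n i = 0 → σ i = true ∨ m n = 0) :
    ∃ M : L2 d →L[ℝ] L2 d, ∀ v n, coef σ' n (M v) = m n * coef σ n v := by
  have hbound : ∀ (v : L2 d) n, (m n * coef σ n v) ^ 2 ≤ C ^ 2 * coef σ n v ^ 2 := fun v n => by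
    rw [mul_pow]
    exact mul_le_mul_of_nonneg_right (sq_le_sq' (abs_le.1 (hm n)).1 (abs_le.1 (hm n)).2)
      (sq_nonneg _)
  have hsummable : ∀ v : L2 d, Summable fun n => (m n * coef σ n v) ^ 2 := fun v =>
    Summable.of_nonneg_of_le (fun _ => sq_nonneg _) (hbound v)
      ((hasSum_coef_sq σ v).summable.mul_left _)
  choose f hf using fun v : L2 d => exists_coef_eq σ' (hsummable v) fun n i hσ hn => by
    rcases h0 n i hσ hn with h | h
    · rw [coef_eq_zero h hn, mul_zero]
    · rw [h, zero_mul]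
  let L : L2 d →ₗ[ℝ] L2 d :=
    { toFun := f
      map_add' := fun v w => eq_of_coef_eq (σ := σ') fun n => by
        rw [coef_add, hf, hf, hf, coef_add, mul_add]
      map_smul' := fun a v => eq_of_coef_eq (σ := σ') fun n => by
        rw [RingHom.id_apply, coef_smul, hf, hf, coef_smul]; ring }
  have hC : 0 ≤ C := (abs_nonneg _).trans (hm 0)
  refine ⟨L.mkContinuous C fun v => abs_le_of_sq_le_sq' ?_ (by positivity) |>.2, hf⟩
  rw [mul_pow]
  exact hasSum_le (fun n => by rw [hf]; exact hbound v n) (hasSum_coef_sq σ' (f v))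
    ((hasSum_coef_sq σ v).mul_left (C ^ 2))

/-- The symbol `τ⁻¹ ∏ᵢ (1 + (τ/2) (n i π)²)` of the operator inverted in one velocity step. -/
noncomputable def stepSymbol (τ : ℝ) (n : Fin d → ℕ) : ℝ := τ⁻¹ * ∏ i, (1 + τ / 2 * freqSq n i)

theorem stepSymbol_eq {τ : ℝ} (hτ : τ ≠ 0) (n : Fin d → ℕ) :
    stepSymbol τ n = τ⁻¹ + 1 / 2 * lapSymbol n + τ / 4 * splitSymbol τ n := by
  rw [stepSymbol, splitSymbol]
  field_simp
  ring

theorem stepSymbol_pos {τ : ℝ} (hτ : 0 < τ) (n : Fin d → ℕ) : 0 < stepSymbol τ n := by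
  refine mul_pos (by positivity) (Finset.prod_pos fun i _ => ?_)
  have hfreq := freqSq_nonneg n i
  positivity

theorem inv_le_stepSymbol {τ : ℝ} (hτ : 0 < τ) (n : Fin d → ℕ) : τ⁻¹ ≤ stepSymbol τ n := by
  rw [stepSymbol_eq hτ.ne']
  have hsplit : 0 ≤ τ / 4 * splitSymbol τ n := mul_nonneg (by positivity) (splitSymbol_nonneg hτ n)
  linarith [lapSymbol_nonneg n]

theorem lapSymbol_le_stepSymbol {τ : ℝ} (hτ : 0 < τ) (n : Fin d → ℕ) :
    lapSymbol n ≤ 2 * stepSymbol τ n := by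
  rw [stepSymbol_eq hτ.ne']
  have hsplit : 0 ≤ τ / 4 * splitSymbol τ n := mul_nonneg (by positivity) (splitSymbol_nonneg hτ n)
  linarith [inv_pos.2 hτ]

theorem splitSymbol_le_stepSymbol {τ : ℝ} (hτ : 0 < τ) (n : Fin d → ℕ) :
    splitSymbol τ n ≤ 4 / τ * stepSymbol τ n := by
  have hlap := lapSymbol_nonneg n
  calc splitSymbol τ n = 4 / τ * (τ / 4 * splitSymbol τ n) := by field_simp
    _ ≤ 4 / τ * stepSymbol τ n := by
      rw [stepSymbol_eq hτ.ne']
      gcongr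
      exact le_add_of_nonneg_left (by positivity)

theorem freqSq_le_lapSymbol (n : Fin d → ℕ) (i : Fin d) : freqSq n i ≤ lapSymbol n :=
  Finset.single_le_sum (fun k _ => freqSq_nonneg n k) (Finset.mem_univ i)

theorem prod_le_prod_one_add_of_subset {ι : Type*} {s t : Finset ι} (hts : t ⊆ s) {x : ι → ℝ}
    (hx : ∀ i ∈ s, 0 ≤ x i) : ∏ i ∈ t, x i ≤ ∏ i ∈ s, (1 + x i) := by
  rw [Finset.prod_one_add]
  exact Finset.single_le_sum (f := fun t => ∏ i ∈ t, x i)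
    (fun t ht => Finset.prod_nonneg fun i hi => hx i (Finset.mem_powerset.1 ht hi))
    (Finset.mem_powerset.2 hts)

theorem freqSq_mul_freqSq_le {τ : ℝ} (hτ : 0 < τ) (n : Fin d → ℕ) {i k : Fin d} (hik : i ≠ k) :
    freqSq n i * freqSq n k ≤ 4 / τ * stepSymbol τ n := by
  have hprod := prod_le_prod_one_add_of_subset (Finset.subset_univ {i, k})
    (x := fun i => τ / 2 * freqSq n i) fun i _ => mul_nonneg (by positivity) (freqSq_nonneg n i)
  rw [Finset.prod_pair hik] at hprod
  calc freqSq n i * freqSq n k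
      = 4 / τ ^ 2 * (τ / 2 * freqSq n i * (τ / 2 * freqSq n k)) := by field_simp; ring
    _ ≤ 4 / τ ^ 2 * ∏ i, (1 + τ / 2 * freqSq n i) := by gcongr
    _ = 4 / τ * stepSymbol τ n := by rw [stepSymbol]; field_simp

/-- The symbol `∏ᵢ (1 + (n i π)²)` of the operator `A`. -/
noncomputable def pressSymbol (n : Fin d → ℕ) : ℝ := ∏ i, (1 + freqSq n i)

theorem one_add_lapSymbol_le (n : Fin d → ℕ) : 1 + lapSymbol n ≤ pressSymbol n :=
  one_add_sum_le_prod_one_add Finset.univ fun i _ => freqSq_nonneg n i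

theorem pressSymbol_pos (n : Fin d → ℕ) : 0 < pressSymbol n := by
  linarith [one_add_lapSymbol_le n, lapSymbol_nonneg n]

theorem abs_mul_inv_sqrt_le {a s C : ℝ} (hs : 0 < s) (hC : 0 ≤ C) (h : a ^ 2 ≤ C ^ 2 * s) :
    |a * (√s)⁻¹| ≤ C := by
  have hsqrt : 0 < √s := Real.sqrt_pos.2 hs
  rw [abs_mul, abs_of_pos (inv_pos.2 hsqrt), ← div_eq_mul_inv, div_le_iff₀ hsqrt]
  refine abs_le_of_sq_le_sq ?_ (by positivity)
  rwa [mul_pow, Real.sq_sqrt hs.le]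

/-- Velocity fields. -/
abbrev VelSpace (d : ℕ) := PiLp 2 fun _ : Fin d => L2 d

/-- Gradients of velocity fields; the entry at `(i, k)` is `∂ᵢ` of the component `k`. -/
abbrev GradSpace (d : ℕ) := PiLp 2 fun _ : Fin d × Fin d => L2 d

/-- The operators of the direction splitting scheme, diagonal in trigonometric systems. The velocity
space is parametrized by `L²`, through the square root of the operator inverted in one velocity
step, and so is the space of pressure corrections, through the square root of `A`. -/
structure SpectralOperators (d : ℕ) (τ : ℝ) where
  emb : VelSpace d →L[ℝ] VelSpace d
  grad : VelSpace d →L[ℝ] GradSpace d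
  split : VelSpace d →L[ℝ] VelSpace d
  press : L2 d →L[ℝ] L2 d
  coef_emb : ∀ w k n, coef (fun _ => true) n (emb w k)
    = (√(stepSymbol τ n))⁻¹ * coef (fun _ => true) n (w k)
  coef_grad : ∀ w i k n, coef (Function.update (fun _ => true) i false) n (grad w (i, k))
    = n i * Real.pi * (√(stepSymbol τ n))⁻¹ * coef (fun _ => true) n (w k)
  coef_split : ∀ w k n, coef (fun _ => true) n (split w k)
    = √(splitSymbol τ n) * (√(stepSymbol τ n))⁻¹ * coef (fun _ => true) n (w k)
  coef_press : ∀ ψ n, coef (fun _ => false) n (press ψ)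
    = (√(pressSymbol n))⁻¹ * coef (fun _ => false) n ψ

theorem exists_multiplier_inv_sqrt_stepSymbol (σ : Fin d → Bool) {τ : ℝ} (hτ : 0 < τ)
    {a : (Fin d → ℕ) → ℝ} {C : ℝ} (hC : 0 ≤ C) (ha : ∀ n, a n ^ 2 ≤ C * stepSymbol τ n) :
    ∃ M : L2 d →L[ℝ] L2 d, ∀ v n,
      coef σ n (M v) = a n * (√(stepSymbol τ n))⁻¹ * coef (fun _ => true) n v :=
  exists_multiplier _ _ (C := √C) (fun n => abs_mul_inv_sqrt_le (stepSymbol_pos hτ n)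
    (Real.sqrt_nonneg _) (by rw [Real.sq_sqrt hC]; exact ha n)) fun _ _ _ _ => Or.inl rfl

theorem exists_multiplier_inv_sqrt_pressSymbol (d : ℕ) :
    ∃ M : L2 d →L[ℝ] L2 d, ∀ v n,
      coef (fun _ => false) n (M v) = (√(pressSymbol n))⁻¹ * coef (fun _ => false) n v := by
  refine exists_multiplier _ _ (C := 1) (fun n => ?_) (by simp)
  rw [← one_mul (√_)⁻¹]
  refine abs_mul_inv_sqrt_le (pressSymbol_pos n) zero_le_one ?_
  linarith [one_add_lapSymbol_le n, lapSymbol_nonneg n]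

/-- The operator acting on the components of a velocity field, where the entry at `b` of the result
is obtained by applying `M b` to the component `π b`. -/
noncomputable def componentwise {β : Type*} (π : β → Fin d)
    (M : β → L2 d →L[ℝ] L2 d) : VelSpace d →L[ℝ] PiLp 2 fun _ : β => L2 d :=
  (PiLp.continuousLinearEquiv 2 ℝ fun _ : β => L2 d).symm.toContinuousLinearMap ∘L
    ContinuousLinearMap.pi fun b => M b ∘L PiLp.proj 2 (fun _ : Fin d => L2 d) (π b)

theorem SpectralOperators.nonempty (d : ℕ) {τ : ℝ} (hτ : 0 < τ) :
    Nonempty (SpectralOperators d τ) := by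
  obtain ⟨E, hE⟩ := exists_multiplier_inv_sqrt_stepSymbol (d := d) (fun _ => true) hτ (a := 1)
    (C := τ) hτ.le fun n => by
      rw [Pi.one_apply, one_pow]
      exact (mul_inv_cancel₀ hτ.ne').symm.le.trans
        (mul_le_mul_of_nonneg_left (inv_le_stepSymbol hτ n) hτ.le)
  choose D hD using fun i : Fin d => exists_multiplier_inv_sqrt_stepSymbol
    (Function.update (fun _ => true) i false) hτ (a := fun n => n i * Real.pi) (C := 2)
    zero_le_two fun n => (freqSq_le_lapSymbol n i).trans (lapSymbol_le_stepSymbol hτ n)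
  obtain ⟨B, hB⟩ := exists_multiplier_inv_sqrt_stepSymbol (d := d) (fun _ => true) hτ
    (a := fun n => √(splitSymbol τ n)) (C := 4 / τ) (by positivity) fun n => by
      rw [Real.sq_sqrt (splitSymbol_nonneg hτ n)]
      exact splitSymbol_le_stepSymbol hτ n
  obtain ⟨P, hP⟩ := exists_multiplier_inv_sqrt_pressSymbol d
  exact ⟨{
    emb := componentwise id fun _ => E
    grad := componentwise Prod.snd fun b => D b.1
    split := componentwise id fun _ => B
    press := P
    coef_emb := fun w k n => (hE (w k) n).trans (by rw [Pi.one_apply, one_mul])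
    coef_grad := fun w i k n => hD i (w k) n
    coef_split := fun w k n => hB (w k) n
    coef_press := hP }⟩

namespace SpectralOperators

variable {τ : ℝ} (O : SpectralOperators d τ)

/-- The divergence of a velocity field. -/
noncomputable def div : VelSpace d →L[ℝ] L2 d :=
  ∑ i, PiLp.proj 2 (fun _ : Fin d × Fin d => L2 d) (i, i) ∘L O.grad

theorem div_apply (w : VelSpace d) : O.div w = ∑ i, O.grad w (i, i) := by
  simp [div]

theorem hasDerivZeroTrace (w : VelSpace d) (i k : Fin d) :
    HasDerivZeroTrace i (O.emb w k) (O.grad w (i, k)) :=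
  hasDerivZeroTrace_of_coef (σ := fun _ => true) rfl fun n => by
    rw [O.coef_grad, O.coef_emb]; ring

-- Both sides are the integral of `∂ᵢ wₖ ∂ₖ wᵢ` after two integrations by parts, through `∂ᵢ∂ₖ wᵢ`.
theorem inner_grad_comm (hτ : 0 < τ) (w : VelSpace d) (i k : Fin d) :
    inner ℝ (O.grad w (i, i)) (O.grad w (k, k)) = inner ℝ (O.grad w (k, i)) (O.grad w (i, k)) := by
  rcases eq_or_ne i k with rfl | hik
  · rfl
  obtain ⟨M, hM⟩ := exists_multiplier_inv_sqrt_stepSymbol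
    (Function.update (Function.update (fun _ => true) i false) k false) hτ
    (a := fun n => n i * Real.pi * (n k * Real.pi)) (C := 4 / τ) (by positivity) fun n => by
      rw [mul_pow]
      exact freqSq_mul_freqSq_le hτ n hik
  have hki : HasDerivZeroTrace k (O.grad w (i, i)) (M (w i)) := by
    refine hasDerivZeroTrace_of_coef (σ := Function.update (fun _ => true) i false)
      (by rw [Function.update_of_ne hik.symm]) fun n => ?_
    rw [hM, O.coef_grad]; ring
  have hik' : HasDerivZeroTrace i (O.grad w (k, i)) (M (w i)) := by
    refine hasDerivZeroTrace_of_coef (σ := Function.update (fun _ => true) k false)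
      (by rw [Function.update_of_ne hik]) fun n => ?_
    rw [Function.update_comm hik.symm, hM, O.coef_grad]; ring
  rw [hki.inner_eq (O.hasDerivZeroTrace w k k).hasWeakDeriv,
    hik'.inner_eq (O.hasDerivZeroTrace w i k).hasWeakDeriv]

theorem norm_div_le (hτ : 0 < τ) (w : VelSpace d) : ‖O.div w‖ ≤ ‖O.grad w‖ := by
  have hentry : ∀ i k, inner ℝ (O.grad w (i, i)) (O.grad w (k, k))
      ≤ 1 / 2 * ‖O.grad w (k, i)‖ ^ 2 + 1 / 2 * ‖O.grad w (i, k)‖ ^ 2 := fun i k => by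
    rw [O.inner_grad_comm hτ]
    nlinarith [real_inner_le_norm (O.grad w (k, i)) (O.grad w (i, k)),
      sq_nonneg (‖O.grad w (k, i)‖ - ‖O.grad w (i, k)‖)]
  refine abs_le_of_sq_le_sq' ?_ (norm_nonneg _) |>.2
  calc ‖O.div w‖ ^ 2 = ∑ i, ∑ k, inner ℝ (O.grad w (i, i)) (O.grad w (k, k)) := by
        simp only [← real_inner_self_eq_norm_sq, O.div_apply, sum_inner, inner_sum]
        exact Finset.sum_comm
    _ ≤ ∑ i, ∑ k, (1 / 2 * ‖O.grad w (k, i)‖ ^ 2 + 1 / 2 * ‖O.grad w (i, k)‖ ^ 2) :=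
        Finset.sum_le_sum fun i _ => Finset.sum_le_sum fun k _ => hentry i k
    _ = ‖O.grad w‖ ^ 2 := by
        simp only [Finset.sum_add_distrib]
        rw [Finset.sum_comm, PiLp.norm_sq_eq_of_L2, Fintype.sum_prod_type]
        simp only [← Finset.mul_sum]
        ring

theorem stepSymbol_mul_sq_inv_sqrt (hτ : 0 < τ) (n : Fin d → ℕ) :
    (τ⁻¹ + 1 / 2 * lapSymbol n + τ / 4 * √(splitSymbol τ n) ^ 2) * (√(stepSymbol τ n))⁻¹ ^ 2
      = 1 := by
  have hpos := stepSymbol_pos hτ n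
  rw [Real.sq_sqrt (splitSymbol_nonneg hτ n), ← stepSymbol_eq hτ.ne', inv_pow,
    Real.sq_sqrt hpos.le, mul_inv_cancel₀ hpos.ne']

theorem sum_coef_grad_mul_coef_grad (v w : VelSpace d) (k : Fin d) (n : Fin d → ℕ) :
    ∑ i, coef (Function.update (fun _ => true) i false) n (O.grad v (i, k))
        * coef (Function.update (fun _ => true) i false) n (O.grad w (i, k))
      = lapSymbol n
        * (coef (fun _ => true) n (O.emb v k) * coef (fun _ => true) n (O.emb w k)) := by
  rw [lapSymbol, Finset.sum_mul]
  refine Finset.sum_congr rfl fun i _ => ?_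
  rw [O.coef_grad, O.coef_grad, O.coef_emb, O.coef_emb, freqSq]
  ring

theorem inner_component (hτ : 0 < τ) (v w : VelSpace d) (k : Fin d) :
    inner ℝ (v k) (w k) = τ⁻¹ * inner ℝ (O.emb v k) (O.emb w k)
      + 1 / 2 * ∑ i, inner ℝ (O.grad v (i, k)) (O.grad w (i, k))
      + τ / 4 * inner ℝ (O.split v k) (O.split w k) := by
  have hemb := (hasSum_coef_mul_coef (fun _ => true) (O.emb v k) (O.emb w k)).mul_left τ⁻¹
  have hgrad := (hasSum_sum fun i (_ : i ∈ Finset.univ) =>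
    hasSum_coef_mul_coef (Function.update (fun _ => true) i false) (O.grad v (i, k))
      (O.grad w (i, k))).mul_left (1 / 2)
  have hsplit := (hasSum_coef_mul_coef (fun _ => true) (O.split v k)
    (O.split w k)).mul_left (τ / 4)
  refine (hasSum_coef_mul_coef (fun _ => true) (v k) (w k)).unique
    (((hemb.add hgrad).add hsplit).congr_fun fun n => ?_)
  simp only [O.sum_coef_grad_mul_coef_grad, O.coef_emb, O.coef_split]
  linear_combination -(coef (fun _ => true) n (v k) * coef (fun _ => true) n (w k))
    * stepSymbol_mul_sq_inv_sqrt hτ n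

theorem coef_grad_cos (w : VelSpace d) (i : Fin d) (n : Fin d → ℕ) :
    coef (fun _ => false) n (O.grad w (i, i))
      = n i * Real.pi * coef (Function.update (fun _ => false) i true) n (O.emb w i) := by
  have hcoef := (O.hasDerivZeroTrace w i i).coef_eq
    (σ := Function.update (fun _ => false) i true) (by simp) n
  rwa [Function.update_idem, Function.update_eq_self i (fun _ : Fin d => false)] at hcoef

/-- `r` is the gradient of the pressure correction `O.press ψ`, up to sign: this is what the
coefficients in the systems with a sine in the differentiated direction say. -/
def IsPressGrad (ψ : L2 d) (r : VelSpace d) : Prop :=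
  ∀ i n, coef (Function.update (fun _ => false) i true) n (r i)
    = n i * Real.pi * (√(pressSymbol n))⁻¹ * coef (fun _ => false) n ψ

theorem exists_isPressGrad (ψ : L2 d) : ∃ r, IsPressGrad ψ r := by
  choose r hr using fun i : Fin d => exists_multiplier (fun _ => false)
    (Function.update (fun _ => false) i true)
    (m := fun n => n i * Real.pi * (√(pressSymbol n))⁻¹) (C := 1)
    (fun n => abs_mul_inv_sqrt_le (pressSymbol_pos n) zero_le_one (by
      have hfreq := freqSq_le_lapSymbol n i
      rw [freqSq] at hfreq
      linarith [one_add_lapSymbol_le n]))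
    fun n k hk hn => by
      rcases eq_or_ne k i with rfl | hki
      · right; simp [hn]
      · simp [Function.update_of_ne hki] at hk
  exact ⟨WithLp.toLp 2 fun i => r i ψ, fun i => hr i ψ⟩

theorem IsPressGrad.inner_div_press {ψ : L2 d} {r : VelSpace d} (hr : IsPressGrad ψ r)
    (w : VelSpace d) : inner ℝ (O.div w) (O.press ψ) = inner ℝ (O.emb w) r := by
  rw [O.div_apply, sum_inner, PiLp.inner_apply]
  refine Finset.sum_congr rfl fun i _ => ?_
  refine (hasSum_coef_mul_coef (fun _ => false) (O.grad w (i, i)) (O.press ψ)).unique ?_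
  refine (hasSum_coef_mul_coef (Function.update (fun _ => false) i true) (O.emb w i)
    (r i)).congr_fun fun n => ?_
  rw [O.coef_grad_cos, O.coef_press, hr]
  ring

theorem IsPressGrad.norm_le {ψ : L2 d} {r : VelSpace d} (hr : IsPressGrad ψ r) : ‖r‖ ≤ ‖ψ‖ := by
  refine abs_le_of_sq_le_sq' ?_ (norm_nonneg _) |>.2
  rw [PiLp.norm_sq_eq_of_L2]
  refine hasSum_le (fun n => ?_) (hasSum_sum fun i (_ : i ∈ Finset.univ) =>
    hasSum_coef_sq (Function.update (fun _ => false) i true) (r i))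
    (hasSum_coef_sq (fun _ => false) ψ)
  have hpos := pressSymbol_pos n
  calc ∑ i, coef (Function.update (fun _ => false) i true) n (r i) ^ 2
      = lapSymbol n / pressSymbol n * coef (fun _ => false) n ψ ^ 2 := by
        rw [lapSymbol, Finset.sum_div, Finset.sum_mul]
        refine Finset.sum_congr rfl fun i _ => ?_
        rw [hr, mul_pow, mul_pow, inv_pow, Real.sq_sqrt hpos.le, freqSq]
        ring
    _ ≤ coef (fun _ => false) n ψ ^ 2 :=
        mul_le_of_le_one_left (sq_nonneg _)
          ((div_le_one hpos).2 (by linarith [one_add_lapSymbol_le n]))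

theorem inner_div_press_le (w : VelSpace d) (ψ : L2 d) :
    inner ℝ (O.div w) (O.press ψ) ≤ ‖O.emb w‖ * ‖ψ‖ := by
  obtain ⟨r, hr⟩ := exists_isPressGrad ψ
  calc inner ℝ (O.div w) (O.press ψ) = inner ℝ (O.emb w) r := hr.inner_div_press O w
    _ ≤ ‖O.emb w‖ * ‖r‖ := real_inner_le_norm _ _
    _ ≤ ‖O.emb w‖ * ‖ψ‖ := mul_le_mul_of_nonneg_left hr.norm_le (norm_nonneg _)

/-- The diagonal operators as an instance of the abstract splitting operators. -/
noncomputable def splittingOperators (hτ : 0 < τ) :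
    SplittingOperators τ (VelSpace d) (VelSpace d) (GradSpace d) (VelSpace d) (L2 d) (L2 d) where
  emb := O.emb
  grad := O.grad
  split := O.split
  div := O.div
  press := O.press
  step_pos := hτ
  inner_eq v w := by
    simp only [PiLp.inner_apply]
    rw [Fintype.sum_prod_type, Finset.sum_comm, Finset.mul_sum, Finset.mul_sum, Finset.mul_sum,
      ← Finset.sum_add_distrib, ← Finset.sum_add_distrib]
    exact Finset.sum_congr rfl fun k _ => O.inner_component hτ v w k
  norm_div_le := O.norm_div_le hτ
  inner_div_press_le := O.inner_div_press_le

end SpectralOperators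

end DiagonalOperators

/-! ### Fourier coefficients of the equations of the scheme -/

section Lifts

variable {d : ℕ}

theorem HasDerivZeroTrace.sub {i : Fin d} {v g v' g' : L2 d} (h : HasDerivZeroTrace i v g)
    (h' : HasDerivZeroTrace i v' g') : HasDerivZeroTrace i (v - v') (g - g') :=
  hasDerivZeroTrace_of_coef (σ := fun _ => true) rfl fun n => by
    rw [coef_sub, coef_sub, h.coef_eq (σ := fun _ => true) rfl,
      h'.coef_eq (σ := fun _ => true) rfl]
    ring

theorem hasWeakDiv_iff_inner {v : Fin d → L2 d} {D : L2 d} :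
    HasWeakDiv v D ↔ ∀ (φ : (Fin d → ℝ) → ℝ) (hφ : IsTest φ),
      ∑ i, inner ℝ (v i) (toL2 (contDiff_pd hφ.1 i).continuous)
        = -inner ℝ D (toL2 hφ.1.continuous) := by
  simp only [HasWeakDiv, inner_toL2]

theorem HasWeakDiv.sub {v v' : Fin d → L2 d} {g g' : L2 d} (h : HasWeakDiv v g)
    (h' : HasWeakDiv v' g') : HasWeakDiv (v - v') (g - g') := by
  rw [hasWeakDiv_iff_inner] at h h' ⊢
  intro φ hφ
  simp only [Pi.sub_apply, inner_sub_left, Finset.sum_sub_distrib]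
  rw [h φ hφ, h' φ hφ]
  ring

theorem HasWeakDiv.midpoint {v v' : Fin d → L2 d} {g g' : L2 d} (h : HasWeakDiv v g)
    (h' : HasWeakDiv v' g') :
    HasWeakDiv (fun j => (1 / 2 : ℝ) • (v j + v' j)) ((1 / 2 : ℝ) • (g + g')) := by
  rw [hasWeakDiv_iff_inner] at h h' ⊢
  intro φ hφ
  simp only [inner_smul_left, inner_add_left, ← Finset.mul_sum, Finset.sum_add_distrib,
    conj_trivial]
  rw [h φ hφ, h' φ hφ]
  ring

theorem HasLaplacian.coef_eq {v w : L2 d} (hv : MemH10 v) (h : HasLaplacian v w)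
    (n : Fin d → ℕ) :
    coef (fun _ => true) n w = -(lapSymbol n * coef (fun _ => true) n v) := by
  obtain ⟨g, hg, rfl⟩ := h
  rw [coef_sum, lapSymbol, Finset.sum_mul, ← Finset.sum_neg_distrib]
  refine Finset.sum_congr rfl fun i _ => ?_
  obtain ⟨r, hr⟩ := hv i
  exact hr.coef_second_eq (hg i) rfl n

theorem HasNeumannD2.coef_eq {i : Fin d} {ψ h : L2 d} (hψ : HasNeumannD2 i ψ h) (n : Fin d → ℕ) :
    coef (fun _ => false) n h = -(freqSq n i * coef (fun _ => false) n ψ) := by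
  obtain ⟨r, hr, hrh⟩ := hψ
  have hcoef := hrh.coef_eq (σ := Function.update (fun _ => false) i true) (by simp) n
  rw [hr.coef_eq_single (by simp), Function.update_idem,
    Function.update_eq_self i (fun _ : Fin d => false)] at hcoef
  rw [hcoef, freqSq]
  ring

theorem HasA.coef_eq (hd : d = 2 ∨ d = 3) {q g : L2 d} (h : HasA q g) (n : Fin d → ℕ) :
    coef (fun _ => false) n g = pressSymbol n * coef (fun _ => false) n q := by
  obtain ⟨-, ψ, rfl, rfl, hψ⟩ := h
  have hfactor : ∀ i : Fin d, coef (fun _ => false) n (ψ i.castSucc)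
      = (1 + freqSq n i) * coef (fun _ => false) n (ψ i.succ) := fun i => by
    obtain ⟨r, hr, hsub⟩ := hψ i
    rw [hsub, coef_sub, hr.coef_eq]
    ring
  rcases hd with rfl | rfl
  · rw [pressSymbol, Fin.prod_univ_two, mul_assoc]
    exact (hfactor 0).trans (congrArg _ (hfactor 1))
  · rw [pressSymbol, Fin.prod_univ_three, mul_assoc, mul_assoc]
    exact (hfactor 0).trans (congrArg _ ((hfactor 1).trans (congrArg _ (hfactor 2))))

/-- `v` is in the domain of the operator inverted in one velocity step. -/
def IsStepRegular (τ : ℝ) (v : L2 d) : Prop :=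
  ∃ g : L2 d, ∀ n, coef (fun _ => true) n g = stepSymbol τ n * coef (fun _ => true) n v

theorem HasB.isStepRegular (hd : d = 2 ∨ d = 3) {τ : ℝ} (hτ : τ ≠ 0) {v w l : L2 d}
    (h : HasB τ v w) (hl : HasLaplacian v l) : IsStepRegular τ v :=
  ⟨τ⁻¹ • v - (1 / 2 : ℝ) • l + (τ / 4) • w, fun n => by
    rw [coef_add, coef_sub, coef_smul, coef_smul, coef_smul, h.coef_eq hd hτ, hl.coef_eq h.1,
      stepSymbol_eq hτ]
    ring⟩

theorem IsStepRegular.sub {τ : ℝ} {v w : L2 d} (hv : IsStepRegular τ v) (hw : IsStepRegular τ w) :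
    IsStepRegular τ (v - w) := by
  obtain ⟨g, hg⟩ := hv
  obtain ⟨g', hg'⟩ := hw
  exact ⟨g - g', fun n => by rw [coef_sub, hg, hg', coef_sub]; ring⟩

theorem IsStepRegular.of_step {τ : ℝ} (hτ : 0 < τ) {v v' F : L2 d} (hv : IsStepRegular τ v)
    (h : ∀ n, stepSymbol τ n * (coef (fun _ => true) n v' - coef (fun _ => true) n v)
      + lapSymbol n * coef (fun _ => true) n v = coef (fun _ => true) n F) :
    IsStepRegular τ v' := by
  obtain ⟨g, hg⟩ := hv
  obtain ⟨M, hM⟩ := exists_multiplier (d := d) (fun _ => true) (fun _ => true)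
    (m := fun n => lapSymbol n / stepSymbol τ n) (C := 2) (fun n => by
      have hpos := stepSymbol_pos hτ n
      rw [abs_of_nonneg (div_nonneg (lapSymbol_nonneg n) hpos.le), div_le_iff₀ hpos]
      exact lapSymbol_le_stepSymbol hτ n) (fun _ _ _ _ => Or.inl rfl)
  refine ⟨g - M g + F, fun n => ?_⟩
  have hpos := stepSymbol_pos hτ n
  rw [coef_add, coef_sub, hM, hg, ← h n]
  field_simp
  ring

theorem peacemanRachford_eliminate {τ X Y U Uh U' G : ℝ} (hτ : τ ≠ 0)
    (hfirst : (τ / 2)⁻¹ * (Uh - U) + X * Uh + Y * U = G)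
    (hsecond : (τ / 2)⁻¹ * (U' - Uh) + X * Uh + Y * U' = G) :
    τ⁻¹ * ((1 + τ / 2 * X) * (1 + τ / 2 * Y)) * (U' - U) + (X + Y) * U = G := by
  have hinv : τ⁻¹ * τ = 1 := inv_mul_cancel₀ hτ
  rw [inv_div, div_eq_mul_inv] at hfirst hsecond
  linear_combination (1 / 2 - τ / 4 * X) * hfirst + (1 / 2 + τ / 4 * X) * hsecond
    + (X * (Uh - U) + (1 + τ / 2 * X) * (Y / 2) * (U' - U)) * hinv

theorem douglas_eliminate {τ X Y Z U Ξ E W U' G : ℝ} (hτ : τ ≠ 0)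
    (hξ : τ⁻¹ * (Ξ - U) + (X + Y + Z) * U = G)
    (hη : τ⁻¹ * (E - Ξ) + 1 / 2 * (X * (E - U)) = 0)
    (hζ : τ⁻¹ * (W - E) + 1 / 2 * (Y * (W - U)) = 0)
    (hu : τ⁻¹ * (U' - W) + 1 / 2 * (Z * (U' - U)) = 0) :
    τ⁻¹ * ((1 + τ / 2 * X) * (1 + τ / 2 * Y) * (1 + τ / 2 * Z)) * (U' - U) + (X + Y + Z) * U
      = G := by
  have hinv : τ⁻¹ * τ = 1 := inv_mul_cancel₀ hτ
  linear_combination hξ + hη + (1 + τ / 2 * X) * hζ + (1 + τ / 2 * X) * (1 + τ / 2 * Y) * hu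
    + ((1 + τ / 2 * X) * (1 + τ / 2 * Y) * (Z / 2) * (U' - U)
      + (1 + τ / 2 * X) * (Y / 2) * (W - U) + X / 2 * (E - U)) * hinv

theorem VelocityUpdate.coef_eq_two {τ : ℝ} (hτ : τ ≠ 0) {F u u' : Fin 2 → L2 2} {ps : L2 2}
    (hu : ∀ j, MemH10 (u j)) (h : VelocityUpdate 2 τ F ps u u') (j : Fin 2) :
    ∃ grad, HasWeakDeriv [j] ps grad ∧ ∀ n,
      stepSymbol τ n * (coef (fun _ => true) n (u' j) - coef (fun _ => true) n (u j))
        + lapSymbol n * coef (fun _ => true) n (u j) = coef (fun _ => true) n (F j - grad) := by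
  obtain ⟨uh, h⟩ := h
  obtain ⟨uhxx, uyy, uyy', grad, huhxx, huyy, huyy', hgrad, ⟨ghx, hghx⟩, ⟨gy', hgy'⟩,
    hfirst, hsecond⟩ := h j
  obtain ⟨gy, hgy⟩ := hu j 1
  refine ⟨grad, hgrad, fun n => ?_⟩
  have hx := hghx.coef_second_eq huhxx (σ := fun _ => true) rfl n
  have hy := hgy.coef_second_eq huyy (σ := fun _ => true) rfl n
  have hy' := hgy'.coef_second_eq huyy' (σ := fun _ => true) rfl n
  replace hfirst := congrArg (coef (fun _ => true) n) hfirst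
  replace hsecond := congrArg (coef (fun _ => true) n) hsecond
  simp only [coef_add, coef_sub, coef_smul, hx, hy, hy'] at hfirst hsecond
  rw [coef_sub, stepSymbol, lapSymbol, Fin.prod_univ_two, Fin.sum_univ_two]
  refine peacemanRachford_eliminate (Uh := coef (fun _ => true) n (uh j)) hτ ?_ ?_
  · rw [← hfirst, freqSq, freqSq]; ring
  · rw [← hsecond, freqSq, freqSq]; ring

theorem VelocityUpdate.coef_eq_three {τ : ℝ} (hτ : τ ≠ 0) {F u u' : Fin 3 → L2 3} {ps : L2 3}
    (hu : ∀ j, MemH10 (u j)) (h : VelocityUpdate 3 τ F ps u u') (j : Fin 3) :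
    ∃ grad, HasWeakDeriv [j] ps grad ∧ ∀ n,
      stepSymbol τ n * (coef (fun _ => true) n (u' j) - coef (fun _ => true) n (u j))
        + lapSymbol n * coef (fun _ => true) n (u j) = coef (fun _ => true) n (F j - grad) := by
  obtain ⟨ξ, η, ζ, h⟩ := h
  obtain ⟨lap, grad, a, b, c, hlap, hgrad, ha, hb, hc, ⟨gη, hgη⟩, ⟨gζ, hgζ⟩, ⟨gz', hgz'⟩,
    hξeq, hηeq, hζeq, hueq⟩ := h j
  choose g hg using hu j
  refine ⟨grad, hgrad, fun n => ?_⟩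
  have hlap := hlap.coef_eq (hu j) n
  have hx := (hgη.sub (hg 0)).coef_second_eq ha (σ := fun _ => true) rfl n
  have hy := (hgζ.sub (hg 1)).coef_second_eq hb (σ := fun _ => true) rfl n
  have hz := (hgz'.sub (hg 2)).coef_second_eq hc (σ := fun _ => true) rfl n
  replace hξeq := congrArg (coef (fun _ => true) n) hξeq
  replace hηeq := congrArg (coef (fun _ => true) n) hηeq
  replace hζeq := congrArg (coef (fun _ => true) n) hζeq
  replace hueq := congrArg (coef (fun _ => true) n) hueq
  rw [coef_sub] at hx hy hz
  simp only [coef_add, coef_sub, coef_smul, coef_zero, hlap, hx, hy, hz]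
    at hξeq hηeq hζeq hueq
  rw [coef_sub, stepSymbol, Fin.prod_univ_three]
  rw [lapSymbol, Fin.sum_univ_three] at hξeq ⊢
  refine douglas_eliminate (Ξ := coef (fun _ => true) n (ξ j)) (E := coef (fun _ => true) n (η j))
    (W := coef (fun _ => true) n (ζ j)) hτ ?_ ?_ ?_ ?_
  · rw [← hξeq]; ring
  · rw [← hηeq, freqSq]; ring
  · rw [← hζeq, freqSq]; ring
  · rw [← hueq, freqSq]; ring

theorem VelocityUpdate.coef_eq (hd : d = 2 ∨ d = 3) {τ : ℝ} (hτ : τ ≠ 0) {F u u' : Fin d → L2 d}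
    {ps : L2 d} (hu : ∀ j, MemH10 (u j)) (h : VelocityUpdate d τ F ps u u') (j : Fin d) :
    ∃ grad, HasWeakDeriv [j] ps grad ∧ ∀ n,
      stepSymbol τ n * (coef (fun _ => true) n (u' j) - coef (fun _ => true) n (u j))
        + lapSymbol n * coef (fun _ => true) n (u j) = coef (fun _ => true) n (F j - grad) := by
  rcases hd with rfl | rfl
  · exact h.coef_eq_two hτ hu j
  · exact h.coef_eq_three hτ hu j

namespace SpectralOperators

variable {τ : ℝ} (O : SpectralOperators d τ)

theorem exists_emb_eq (hτ : 0 < τ) {v : Fin d → L2 d} (hv : ∀ k, IsStepRegular τ (v k)) :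
    ∃ w : VelSpace d, ∀ k, O.emb w k = v k := by
  choose g hg using hv
  refine ⟨O.emb (WithLp.toLp 2 g), fun k => eq_of_coef_eq (σ := fun _ => true) fun n => ?_⟩
  have hpos := stepSymbol_pos hτ n
  rw [O.coef_emb, O.coef_emb, ← mul_assoc, ← mul_inv, Real.mul_self_sqrt hpos.le, hg,
    inv_mul_cancel_left₀ hpos.ne']

theorem _root_.DirSplit.IsStepRegular.memH10 (hτ : 0 < τ) {v : L2 d} (hv : IsStepRegular τ v) :
    MemH10 v := fun i => by
  obtain ⟨O⟩ := SpectralOperators.nonempty d hτ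
  obtain ⟨w, hw⟩ := O.exists_emb_eq hτ fun _ => hv
  exact ⟨_, hw i ▸ O.hasDerivZeroTrace w i i⟩

theorem coef_eq_mul_coef_emb (hτ : 0 < τ) (w : VelSpace d) (k : Fin d) (n : Fin d → ℕ) :
    coef (fun _ => true) n (w k) = √(stepSymbol τ n) * coef (fun _ => true) n (O.emb w k) := by
  rw [O.coef_emb, mul_inv_cancel_left₀ (Real.sqrt_pos.2 (stepSymbol_pos hτ n)).ne']

theorem inner_add_inner_grad_of_step (hτ : 0 < τ) {e e' : VelSpace d} {F : VelSpace d}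
    (h : ∀ k n, stepSymbol τ n
        * (coef (fun _ => true) n (O.emb e' k) - coef (fun _ => true) n (O.emb e k))
      + lapSymbol n * coef (fun _ => true) n (O.emb e k) = coef (fun _ => true) n (F k))
    (w : VelSpace d) :
    inner ℝ (e' - e) w + inner ℝ (O.grad e) (O.grad w) = inner ℝ F (O.emb w) := by
  simp only [PiLp.inner_apply]
  rw [Fintype.sum_prod_type, Finset.sum_comm, ← Finset.sum_add_distrib]
  refine Finset.sum_congr rfl fun k _ => ?_
  have hvel := hasSum_coef_mul_coef (fun _ => true) ((e' - e) k) (w k)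
  have hgrad := hasSum_sum fun i (_ : i ∈ Finset.univ) =>
    hasSum_coef_mul_coef (Function.update (fun _ => true) i false)
      (O.grad e (i, k)) (O.grad w (i, k))
  refine (hvel.add hgrad).unique
    ((hasSum_coef_mul_coef (fun _ => true) (F k) (O.emb w k)).congr_fun fun n => ?_)
  rw [O.sum_coef_grad_mul_coef_grad, PiLp.sub_apply, coef_sub, O.coef_eq_mul_coef_emb hτ e',
    O.coef_eq_mul_coef_emb hτ e, O.coef_eq_mul_coef_emb hτ w, ← h k n]
  linear_combination (coef (fun _ => true) n (O.emb e' k) - coef (fun _ => true) n (O.emb e k))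
    * coef (fun _ => true) n (O.emb w k) * Real.mul_self_sqrt (stepSymbol_pos hτ n).le

theorem inner_div_eq {q : L2 d} {g : Fin d → L2 d} (hg : ∀ k, HasWeakDeriv [k] q (g k))
    (w : VelSpace d) : inner ℝ q (O.div w) = -inner ℝ (WithLp.toLp 2 g) (O.emb w) := by
  rw [O.div_apply, inner_sum, PiLp.inner_apply, ← Finset.sum_neg_distrib]
  refine Finset.sum_congr rfl fun k _ => ?_
  rw [real_inner_comm (O.emb w k), (O.hasDerivZeroTrace w k k).inner_eq (hg k), neg_neg,
    real_inner_comm]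

theorem momentum_of_step (hτ : 0 < τ) {e e' R : VelSpace d} {q : L2 d} {g : Fin d → L2 d}
    (hg : ∀ k, HasWeakDeriv [k] q (g k))
    (h : ∀ k n, stepSymbol τ n
        * (coef (fun _ => true) n (O.emb e' k) - coef (fun _ => true) n (O.emb e k))
      + lapSymbol n * coef (fun _ => true) n (O.emb e k) = coef (fun _ => true) n (R k - g k))
    (w : VelSpace d) :
    τ⁻¹ * inner ℝ (O.emb (e' - e)) (O.emb w) + 1 / 2 * inner ℝ (O.grad (e' + e)) (O.grad w)
      + τ / 4 * inner ℝ (O.split (e' - e)) (O.split w) - inner ℝ q (O.div w)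
      = inner ℝ R (O.emb w) := by
  have hstep := O.inner_add_inner_grad_of_step hτ (F := R - WithLp.toLp 2 g) h w
  have henergy : inner ℝ (e' - e) w = τ⁻¹ * inner ℝ (O.emb (e' - e)) (O.emb w)
      + 1 / 2 * inner ℝ (O.grad (e' - e)) (O.grad w)
      + τ / 4 * inner ℝ (O.split (e' - e)) (O.split w) := (O.splittingOperators hτ).inner_eq _ _
  rw [inner_sub_left] at hstep
  rw [O.inner_div_eq hg]
  simp only [map_add, map_sub, inner_add_left, inner_sub_left] at henergy hstep ⊢
  linear_combination hstep - henergy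

theorem hasWeakDiv (w : VelSpace d) : HasWeakDiv (fun k => O.emb w k) (O.div w) := by
  rw [O.div_apply]
  exact HasWeakDeriv.hasWeakDiv fun i => (O.hasDerivZeroTrace w i i).hasWeakDeriv

theorem inner_press_left (ψ θ : L2 d) : inner ℝ (O.press ψ) θ = inner ℝ ψ (O.press θ) :=
  (hasSum_coef_mul_coef (fun _ => false) (O.press ψ) θ).unique
    ((hasSum_coef_mul_coef (fun _ => false) ψ (O.press θ)).congr_fun fun n => by
      rw [O.coef_press, O.coef_press]; ring)

theorem press_press_of_hasA (hd : d = 2 ∨ d = 3) {q g : L2 d} (h : HasA q g) :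
    O.press (O.press g) = q :=
  eq_of_coef_eq (σ := fun _ => false) fun n => by
    have hpos := pressSymbol_pos n
    rw [O.coef_press, O.coef_press, ← mul_assoc, ← mul_inv, Real.mul_self_sqrt hpos.le,
      h.coef_eq hd, inv_mul_cancel_left₀ hpos.ne']

-- The product `∏ᵢ (1 + (n i π)²)` expands into the squared symbols of the mixed derivatives.
theorem hasSum_pressSymbol_mul_sq {ψ : L2 d} {g : Finset (Fin d) → L2 d}
    (hg : ∀ S : Finset (Fin d), HasWeakDeriv S.toList ψ (g S)) :
    HasSum (fun n => pressSymbol n * coef (fun _ => false) n ψ ^ 2) (∑ S, ‖g S‖ ^ 2) := by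
  refine (hasSum_sum fun S (_ : S ∈ Finset.univ) =>
    hasSum_coef_sq (fun i => decide (i ∈ S)) (g S)).congr_fun fun n => ?_
  rw [pressSymbol, Finset.prod_one_add, Finset.sum_mul, Finset.powerset_univ]
  refine Finset.sum_congr rfl fun S _ => ?_
  have hσ : (fun i => if i ∈ S.toList then false else decide (i ∈ S)) = fun _ => false := by
    funext i
    by_cases hi : i ∈ S <;> simp [hi]
  rw [(hg S).coef_eq S.nodup_toList (by simp), hσ, Finset.toList_toFinset, mul_pow, mul_pow,
    ← pow_mul, mul_comm _ 2, pow_mul, ← Finset.prod_pow]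
  simp [freqSq]

theorem exists_press_eq {ψ : L2 d} {g : Finset (Fin d) → L2 d}
    (hg : ∀ S : Finset (Fin d), HasWeakDeriv S.toList ψ (g S)) : ∃ y, O.press y = ψ := by
  obtain ⟨y, hy⟩ := exists_coef_eq (d := d) (fun _ => false)
    (a := fun n => √(pressSymbol n) * coef (fun _ => false) n ψ)
    ((hasSum_pressSymbol_mul_sq hg).summable.congr fun n => by
      rw [mul_pow, Real.sq_sqrt (pressSymbol_pos n).le]) (fun n i h => by simp at h)
  refine ⟨y, eq_of_coef_eq (σ := fun _ => false) fun n => ?_⟩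
  rw [O.coef_press, hy, inv_mul_cancel_left₀ (Real.sqrt_pos.2 (pressSymbol_pos n)).ne']

theorem norm_le_sum_of_press {y : L2 d} {g : Finset (Fin d) → L2 d}
    (hg : ∀ S : Finset (Fin d), HasWeakDeriv S.toList (O.press y) (g S)) :
    ‖y‖ ≤ ∑ S, ‖g S‖ := by
  have hnorm : ‖y‖ ^ 2 = ∑ S, ‖g S‖ ^ 2 :=
    (hasSum_coef_sq (fun _ => false) y).unique
      ((hasSum_pressSymbol_mul_sq hg).congr_fun fun n => by
        have hpos := pressSymbol_pos n
        rw [O.coef_press, mul_pow, inv_pow, Real.sq_sqrt hpos.le, mul_inv_cancel_left₀ hpos.ne'])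
  refine abs_le_of_sq_le_sq' ?_ (Finset.sum_nonneg fun _ _ => norm_nonneg _) |>.2
  rw [hnorm]
  exact Finset.sum_sq_le_sq_sum_of_nonneg fun _ _ => norm_nonneg _

end SpectralOperators

end Lifts

/-! ### Regularity in time -/

section TimeRegularity

variable {d : ℕ} {T : ℝ}

/-- The centred second differences of `w` in `[0,T]` with step `h` are bounded by `C h²`: the
difference version of `w ∈ W^{2,∞}(0,T)`. -/
def SecondDiffBound {E : Type*} [NormedAddCommGroup E] [NormedSpace ℝ E] (T : ℝ) (C : ℝ≥0)
    (w : ℝ → E) : Prop :=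
  ∀ m h, 0 ≤ h → 0 ≤ m - h → m + h ≤ T → ‖w (m + h) + w (m - h) - (2 : ℝ) • w m‖ ≤ C * h ^ 2

theorem TimeSobolev.integrableOn {w : ℝ → L2 d} (h : TimeSobolev T 0 w) :
    IntegrableOn w (Ioo 0 T) :=
  MemLp.integrable le_top h

theorem TimeSobolev.exists_ae_norm_le {w : ℝ → L2 d} (h : TimeSobolev T 0 w) :
    ∃ C : ℝ≥0, ∀ᵐ t ∂volume, t ∈ Ioc 0 T → ‖w t‖ ≤ C := by
  have finite : eLpNormEssSup w (volume.restrict (Ioo 0 T)) ≠ ⊤ := by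
    rw [← eLpNorm_exponent_top]
    exact MemLp.eLpNorm_ne_top h
  refine ⟨(eLpNormEssSup w (volume.restrict (Ioo 0 T))).toNNReal, ?_⟩
  rw [← ae_restrict_iff' measurableSet_Ioc, ← Measure.restrict_congr_set Ioo_ae_eq_Ioc]
  filter_upwards [ae_le_eLpNormEssSup (f := w)] with t ht
  exact (toReal_enorm (w t)).ge.trans (ENNReal.toReal_mono finite ht)

theorem sub_eq_integral_of_eq_primitive {E : Type*} [NormedAddCommGroup E] [NormedSpace ℝ E]
    {w w' : ℝ → E} (hint : IntegrableOn w' (Ioo 0 T))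
    (h : ∀ t ∈ Icc 0 T, w t = w 0 + ∫ r in (0 : ℝ)..t, w' r) {s t : ℝ} (hs : s ∈ Icc 0 T)
    (ht : t ∈ Icc 0 T) : w t - w s = ∫ r in s..t, w' r := by
  have interval (a : ℝ) (ha : a ∈ Icc 0 T) : IntervalIntegrable w' volume 0 a := by
    rw [intervalIntegrable_iff_integrableOn_Ioo_of_le ha.1]
    exact hint.mono_set (Ioo_subset_Ioo_right ha.2)
  rw [h t ht, h s hs, add_sub_add_left_eq_sub,
    intervalIntegral.integral_interval_sub_left (interval t ht) (interval s hs)]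

theorem TimeSobolev.exists_lipschitzOnWith {w : ℝ → L2 d} (h : TimeSobolev T 1 w) :
    ∃ C, LipschitzOnWith C w (Icc 0 T) := by
  obtain ⟨w', hw', h⟩ := h
  obtain ⟨C, hC⟩ := hw'.exists_ae_norm_le
  refine ⟨C, LipschitzOnWith.of_dist_le_mul fun t ht s hs => ?_⟩
  rw [dist_eq_norm, Real.dist_eq, sub_eq_integral_of_eq_primitive hw'.integrableOn h hs ht]
  refine intervalIntegral.norm_integral_le_of_norm_le_const_ae ?_
  filter_upwards [hC] with r hr hmem
  exact hr ⟨(le_min hs.1 ht.1).trans_lt hmem.1, hmem.2.trans (max_le hs.2 ht.2)⟩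

theorem TimeSobolev.exists_taylor {w : ℝ → L2 d} (h : TimeSobolev T 2 w) :
    ∃ (g : ℝ → L2 d) (L M : ℝ≥0), (∀ s ∈ Icc 0 T, ‖g s‖ ≤ M) ∧
      ∀ s ∈ Icc 0 T, ∀ t ∈ Icc 0 T, ‖w t - w s - (t - s) • g s‖ ≤ L * |t - s| ^ 2 := by
  obtain ⟨g, hg, h⟩ := h
  obtain ⟨L, lipschitz⟩ := TimeSobolev.exists_lipschitzOnWith hg
  have cont := lipschitz.continuousOn
  obtain ⟨M, hM⟩ := isCompact_Icc.exists_bound_of_continuousOn cont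
  refine ⟨g, L, M.toNNReal, fun s hs => (hM s hs).trans (Real.le_coe_toNNReal M),
    fun s hs t ht => ?_⟩
  have remainder : w t - w s - (t - s) • g s = ∫ r in s..t, (g r - g s) := by
    rw [sub_eq_integral_of_eq_primitive
        (cont.integrableOn_Icc.mono_set Ioo_subset_Icc_self) h hs ht,
      intervalIntegral.integral_sub
        (cont.mono (uIcc_subset_Icc hs ht)).intervalIntegrable intervalIntegrable_const,
      intervalIntegral.integral_const]
  rw [remainder, sq, ← mul_assoc]
  refine intervalIntegral.norm_integral_le_of_norm_le_const fun r hr => ?_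
  have hr := uIoc_subset_uIcc hr
  refine (lipschitz.norm_sub_le (uIcc_subset_Icc hs ht hr) hs).trans ?_
  gcongr
  exact abs_sub_left_of_mem_uIcc hr

theorem TimeSobolev.exists_lipschitzOnWith_two {w : ℝ → L2 d} (h : TimeSobolev T 2 w) :
    ∃ C, LipschitzOnWith C w (Icc 0 T) := by
  obtain ⟨g, L, M, hM, taylor⟩ := h.exists_taylor
  refine ⟨M + L * T.toNNReal, LipschitzOnWith.of_dist_le_mul fun t ht s hs => ?_⟩
  have hT : (T.toNNReal : ℝ) = T := Real.coe_toNNReal T (hs.1.trans hs.2)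
  have abs_sub_le : |t - s| ≤ T := abs_le.2 ⟨by linarith [hs.2, ht.1], by linarith [hs.1, ht.2]⟩
  rw [dist_eq_norm, Real.dist_eq, NNReal.coe_add, NNReal.coe_mul, hT]
  calc ‖w t - w s‖ = ‖(w t - w s - (t - s) • g s) + (t - s) • g s‖ := by rw [sub_add_cancel]
    _ ≤ L * |t - s| ^ 2 + |t - s| * ‖g s‖ := by
      refine norm_add_le_of_le (taylor s hs t ht) ?_
      rw [norm_smul, Real.norm_eq_abs]
    _ ≤ L * (T * |t - s|) + |t - s| * M := by
      rw [sq]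
      gcongr
      exact hM s hs
    _ = (M + L * T) * |t - s| := by ring

theorem TimeSobolev.exists_secondDiffBound {w : ℝ → L2 d} (h : TimeSobolev T 2 w) :
    ∃ C, SecondDiffBound T C w := by
  obtain ⟨g, L, M, -, taylor⟩ := h.exists_taylor
  refine ⟨2 * L, fun m h hh hleft hright => ?_⟩
  have hm : m ∈ Icc 0 T := ⟨by linarith, by linarith⟩
  have forward := taylor m hm (m + h) ⟨by linarith, hright⟩
  have backward := taylor m hm (m - h) ⟨hleft, by linarith⟩
  rw [add_sub_cancel_left, sq_abs] at forward
  rw [sub_sub_cancel_left, sq_abs, neg_sq] at backward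
  have split : w (m + h) + w (m - h) - (2 : ℝ) • w m
      = (w (m + h) - w m - h • g m) + (w (m - h) - w m - (-h) • g m) := by module
  rw [split]
  refine (norm_add_le_of_le forward backward).trans_eq ?_
  push_cast
  ring

section

variable {E : Type*} [NormedAddCommGroup E] [NormedSpace ℝ E] {C C' : ℝ≥0} {w w' : ℝ → E}

theorem SecondDiffBound.add (h : SecondDiffBound T C w) (h' : SecondDiffBound T C' w') :
    SecondDiffBound T (C + C') fun t => w t + w' t := fun m s hs hleft hright => by
  have split : w (m + s) + w' (m + s) + (w (m - s) + w' (m - s)) - (2 : ℝ) • (w m + w' m)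
      = (w (m + s) + w (m - s) - (2 : ℝ) • w m)
        + (w' (m + s) + w' (m - s) - (2 : ℝ) • w' m) := by module
  rw [split, NNReal.coe_add, add_mul]
  exact norm_add_le_of_le (h m s hs hleft hright) (h' m s hs hleft hright)

theorem SecondDiffBound.neg (h : SecondDiffBound T C w) : SecondDiffBound T C fun t => -w t :=
  fun m s hs hleft hright => by
    have : -w (m + s) + -w (m - s) - (2 : ℝ) • -w m
        = -(w (m + s) + w (m - s) - (2 : ℝ) • w m) := by module
    rw [this, norm_neg]
    exact h m s hs hleft hright

theorem SecondDiffBound.mono (h : SecondDiffBound T C w) (hC : C ≤ C') :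
    SecondDiffBound T C' w := fun m s hs hleft hright =>
  (h m s hs hleft hright).trans (by gcongr)

theorem SecondDiffBound.sum {ι : Type*} {s : Finset ι} {C : ι → ℝ≥0} {w : ι → ℝ → E}
    (h : ∀ i ∈ s, SecondDiffBound T (C i) (w i)) :
    SecondDiffBound T (∑ i ∈ s, C i) fun t => ∑ i ∈ s, w i t := by
  classical
  induction s using Finset.induction_on with
  | empty => intro m h _ _ _; simp
  | insert i s hi ih =>
    simp only [Finset.sum_insert hi]
    exact (h i (Finset.mem_insert_self i s)).add
      (ih fun k hk => h k (Finset.mem_insert_of_mem hk))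

theorem norm_sub_sub_smul_midpoint_le (hw : ContinuousOn w (Icc 0 T))
    (hderiv : ∀ t ∈ Ioo 0 T, HasDerivAt w (w' t) t) (hw' : SecondDiffBound T C w')
    {m h : ℝ} (hh : 0 ≤ h) (hleft : 0 ≤ m - h) (hright : m + h ≤ T) :
    ‖w (m + h) - w (m - h) - (2 * h) • w' m‖ ≤ C * h ^ 3 := by
  have mvt := norm_image_sub_le_of_norm_deriv_right_le_segment (a := 0) (b := h) (C := C * h ^ 2)
    (f := fun s => w (m + s) - w (m - s) - (2 * s) • w' m)
    (f' := fun s => w' (m + s) + w' (m - s) - (2 : ℝ) • w' m) ?_ ?_ ?_ h ⟨hh, le_rfl⟩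
  · simp only [add_zero, sub_zero, sub_self, mul_zero, zero_smul] at mvt
    exact mvt.trans_eq (by ring)
  · refine ((hw.comp (by fun_prop) fun s hs => ⟨?_, ?_⟩).sub
      (hw.comp (by fun_prop) fun s hs => ⟨?_, ?_⟩)).sub (by fun_prop) <;>
      linarith [hs.1, hs.2]
  · intro s hs
    have right : HasDerivAt (fun s => w (m + s)) (w' (m + s)) s :=
      (hderiv (m + s) ⟨by linarith [hs.1, hs.2], by linarith [hs.2]⟩).comp_const_add m s
    have left : HasDerivAt (fun s => w (m - s)) (-w' (m - s)) s :=
      (hderiv (m - s) ⟨by linarith [hs.2], by linarith [hs.1, hs.2]⟩).comp_const_sub m s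
    have linear : HasDerivAt (fun s : ℝ => (2 * s) • w' m) ((2 * 1 : ℝ) • w' m) s :=
      ((hasDerivAt_id s).const_mul 2).smul_const _
    have deriv := ((right.sub left).sub linear).hasDerivWithinAt (s := Ici s)
    rwa [sub_neg_eq_add, mul_one] at deriv
  · intro s hs
    refine (hw' m s hs.1 (by linarith [hs.2]) (by linarith [hs.2])).trans ?_
    have := hs.1
    have := hs.2.le
    gcongr

/-- The residual left by exact data in the step in which the intermediate velocities have been
eliminated; `v`, `lap`, `b`, `grad`, `g` stand for one component of the velocity, its Laplacian,
its image under `B_τ`, the pressure derivative and the source. -/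
noncomputable def truncationError (τ : ℝ) (v lap b grad g : ℝ → E) (t : ℝ) : E :=
  τ⁻¹ • (v (t + τ) - v t) - (1 / 2 : ℝ) • (lap (t + τ) + lap t) + (τ / 4) • (b (t + τ) - b t)
    + grad (t + τ / 2) - g (t + τ / 2)

theorem truncationError_eq {τ : ℝ} (hτ : τ ≠ 0) (v lap b grad g : ℝ → E) (t : ℝ) :
    truncationError τ v lap b grad g t
      = τ⁻¹ • (v (t + τ) - v t
          - (2 * (τ / 2)) • (g (t + τ / 2) + lap (t + τ / 2) + -grad (t + τ / 2)))
        - (1 / 2 : ℝ) • (lap (t + τ) + lap t - (2 : ℝ) • lap (t + τ / 2))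
        + (τ / 4) • (b (t + τ) - b t) := by
  have cancel (x : E) : τ⁻¹ • (2 * (τ / 2)) • x = x := by
    rw [smul_smul, mul_div_cancel₀ _ two_ne_zero, inv_mul_cancel₀ hτ, one_smul]
  rw [truncationError, smul_sub τ⁻¹ (_ - _) _, cancel]
  module

theorem norm_truncationError_le {v lap b grad g : ℝ → E} {Cl Cg Cf Cb : ℝ≥0}
    (hv : ContinuousOn v (Icc 0 T))
    (hderiv : ∀ t ∈ Ioo 0 T, HasDerivAt v (g t + lap t + -grad t) t)
    (hg : SecondDiffBound T Cf g) (hlap : SecondDiffBound T Cl lap)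
    (hgrad : SecondDiffBound T Cg grad) (hb : LipschitzOnWith Cb b (Icc 0 T))
    {τ t : ℝ} (hτ : 0 < τ) (ht : 0 ≤ t) (htT : t + τ ≤ T) :
    ‖truncationError τ v lap b grad g t‖ ≤ (Cf + Cl + Cg + Cl + Cb : ℝ≥0) * τ ^ 2 := by
  have midpoint := norm_sub_sub_smul_midpoint_le hv hderiv ((hg.add hlap).add hgrad.neg)
    (m := t + τ / 2) (h := τ / 2) (by positivity) (by linarith) (by linarith)
  have average := hlap (t + τ / 2) (τ / 2) (by positivity) (by linarith) (by linarith)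
  rw [add_assoc t, add_halves, add_sub_cancel_right] at midpoint average
  have perturbation := hb.norm_sub_le (x := t + τ) (y := t) ⟨by linarith, htT⟩ ⟨ht, by linarith⟩
  rw [add_sub_cancel_left, Real.norm_of_nonneg hτ.le] at perturbation
  push_cast at midpoint ⊢
  set C : ℝ := Cf + Cl + Cg
  have hC : 0 ≤ C := by positivity
  rw [truncationError_eq hτ.ne']
  calc _ ≤ τ⁻¹ * (C * (τ / 2) ^ 3) + 1 / 2 * (Cl * (τ / 2) ^ 2) + τ / 4 * (Cb * τ) := by
        refine norm_add_le_of_le (norm_sub_le_of_le ?_ ?_) ?_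
        all_goals rw [norm_smul, Real.norm_of_nonneg (by positivity)]; gcongr
    _ = (C / 8 + Cl / 8 + Cb / 4) * τ ^ 2 := by field_simp; ring
    _ ≤ (C + Cl + Cb) * τ ^ 2 := by gcongr <;> linarith [NNReal.coe_nonneg Cl, NNReal.coe_nonneg Cb]

end

theorem splitSymbol_affine (hd : d = 2 ∨ d = 3) {τ : ℝ} (hτ : τ ≠ 0) (n : Fin d → ℕ) :
    splitSymbol τ n = (2 - τ) * splitSymbol 1 n + (τ - 1) * splitSymbol 2 n := by
  rcases hd with rfl | rfl
  · rw [splitSymbol_two hτ, splitSymbol_two one_ne_zero, splitSymbol_two two_ne_zero]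
    ring
  · rw [splitSymbol_three hτ, splitSymbol_three one_ne_zero, splitSymbol_three two_ne_zero]
    ring

-- `B_τ` is affine in `τ`, so `B_1` and `B_2` control it uniformly for `τ ∈ [0,T]`.
theorem exists_split_lipschitzOnWith (hd : d = 2 ∨ d = 3) {v : ℝ → L2 d}
    (hv : ∀ τ > 0, TimeDB T 1 τ v) :
    ∃ (b : ℝ → ℝ → L2 d) (C : ℝ≥0),
      (∀ τ, τ ≠ 0 → ∀ t ∈ Icc 0 T, ∀ n,
        coef (fun _ => true) n (b τ t) = splitSymbol τ n * coef (fun _ => true) n (v t)) ∧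
      ∀ τ ∈ Icc 0 T, LipschitzOnWith C (b τ) (Icc 0 T) := by
  obtain ⟨-, w₁, hB₁, hw₁⟩ := hv 1 one_pos
  obtain ⟨-, w₂, hB₂, hw₂⟩ := hv 2 two_pos
  obtain ⟨C₁, lipschitz₁⟩ := hw₁.exists_lipschitzOnWith
  obtain ⟨C₂, lipschitz₂⟩ := hw₂.exists_lipschitzOnWith
  refine ⟨fun τ t => (2 - τ) • w₁ t + (τ - 1) • w₂ t,
    (2 + T.toNNReal) * C₁ + (1 + T.toNNReal) * C₂, fun τ hτ t ht n => ?_, fun τ hτ => ?_⟩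
  · rw [coef_add, coef_smul, coef_smul, (hB₁ t ht).coef_eq hd one_ne_zero,
      (hB₂ t ht).coef_eq hd two_ne_zero, splitSymbol_affine hd hτ]
    ring
  · refine LipschitzOnWith.of_dist_le_mul fun t ht s hs => ?_
    have hT : (T.toNNReal : ℝ) = T := Real.coe_toNNReal T (hτ.1.trans hτ.2)
    have split : (2 - τ) • w₁ t + (τ - 1) • w₂ t - ((2 - τ) • w₁ s + (τ - 1) • w₂ s)
        = (2 - τ) • (w₁ t - w₁ s) + (τ - 1) • (w₂ t - w₂ s) := by module
    have abs_two_sub : |2 - τ| ≤ 2 + T := abs_le.2 ⟨by linarith [hτ.2], by linarith [hτ.1, hτ.2]⟩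
    have abs_sub_one : |τ - 1| ≤ 1 + T := abs_le.2 ⟨by linarith [hτ.1, hτ.2], by linarith [hτ.2]⟩
    rw [dist_eq_norm, dist_eq_norm, split]
    push_cast
    rw [hT, add_mul, mul_assoc, mul_assoc]
    refine norm_add_le_of_le ?_ ?_ <;> rw [norm_smul, Real.norm_eq_abs]
    · gcongr
      · exact (abs_nonneg _).trans abs_two_sub
      · exact lipschitz₁.norm_sub_le ht hs
    · gcongr
      · exact (abs_nonneg _).trans abs_sub_one
      · exact lipschitz₂.norm_sub_le ht hs

theorem IsStokesSolution.hasDerivAt {f u : ℝ → Fin d → L2 d} {p : ℝ → L2 d}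
    (h : IsStokesSolution T f u p) {j : Fin d} {second : Fin d → ℝ → L2 d} {grad : ℝ → L2 d}
    (hsecond : ∀ i, ∀ t ∈ Icc 0 T, HasWeakDeriv [i, i] (u t j) (second i t))
    (hgrad : ∀ t ∈ Icc 0 T, HasWeakDeriv [j] (p t) (grad t)) {t : ℝ} (ht : t ∈ Ioo 0 T) :
    HasDerivAt (fun s => u s j) (f t j + ∑ i, second i t + -grad t) t := by
  obtain ⟨_, _, ⟨_, hpart, rfl⟩, hpress, hderiv⟩ := h.momentum t (Ioo_subset_Ioc_self ht) j
  have ht' := Ioo_subset_Icc_self ht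
  rw [hpress.unique (hgrad t ht'),
    Finset.sum_congr rfl fun i _ => (hpart i).unique (hsecond i t ht'), sub_eq_add_neg] at hderiv
  exact hderiv.hasDerivAt (Icc_mem_nhds ht.1 ht.2)

theorem exists_norm_truncationError_le (hd : d = 2 ∨ d = 3) {f u : ℝ → Fin d → L2 d}
    {p : ℝ → L2 d} (hf : ∀ j, TimeSobolev T 2 fun t => f t j) (hsol : IsStokesSolution T f u p)
    (hu : ∀ j, TimeH2 T 2 fun t => u t j) (huB : ∀ τ > 0, ∀ j, TimeDB T 1 τ fun t => u t j)
    (hp : TimeY T 2 p) (j : Fin d) :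
    ∃ (lap grad : ℝ → L2 d) (b : ℝ → ℝ → L2 d) (C : ℝ≥0),
      (∀ t ∈ Icc 0 T, HasLaplacian (u t j) (lap t)) ∧
      (∀ t ∈ Icc 0 T, HasWeakDeriv [j] (p t) (grad t)) ∧
      (∀ τ, τ ≠ 0 → ∀ t ∈ Icc 0 T, ∀ n,
        coef (fun _ => true) n (b τ t) = splitSymbol τ n * coef (fun _ => true) n (u t j)) ∧
      ∀ τ > 0, ∀ t, 0 ≤ t → t + τ ≤ T →
        ‖truncationError τ (fun s => u s j) lap (b τ) grad (fun s => f s j) t‖ ≤ C * τ ^ 2 := by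
  choose second hsecond second_regular using fun i : Fin d => hu j [i, i] (by simp)
  choose Cl second_diff using fun i => (second_regular i).exists_secondDiffBound
  obtain ⟨grad, hgrad, grad_regular⟩ := hp.1 [j] (by simp)
  obtain ⟨Cg, grad_diff⟩ := grad_regular.exists_secondDiffBound
  obtain ⟨b, Cb, hb, b_lipschitz⟩ := exists_split_lipschitzOnWith hd fun τ hτ => huB τ hτ j
  obtain ⟨Cf, f_diff⟩ := (hf j).exists_secondDiffBound
  obtain ⟨Cu, u_lipschitz⟩ := (huB 1 one_pos j).1.exists_lipschitzOnWith
  exact ⟨fun t => ∑ i, second i t, grad, b, _, fun t ht => ⟨_, fun i => hsecond i t ht, rfl⟩,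
    hgrad, hb, fun τ hτ t ht htT => norm_truncationError_le u_lipschitz.continuousOn
      (fun _ => hsol.hasDerivAt hsecond hgrad) f_diff (SecondDiffBound.sum fun i _ => second_diff i)
      grad_diff (b_lipschitz τ ⟨hτ.le, by linarith⟩) hτ ht htT⟩

theorem SpectralOperators.lipschitzOnWith_of_press {τ : ℝ} (O : SpectralOperators d τ)
    {Q : ℝ → L2 d} {g : Finset (Fin d) → ℝ → L2 d} {C : Finset (Fin d) → ℝ≥0}
    (hg : ∀ S, ∀ t ∈ Icc 0 T, HasWeakDeriv S.toList (O.press (Q t)) (g S t))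
    (hC : ∀ S, LipschitzOnWith (C S) (g S) (Icc 0 T)) :
    LipschitzOnWith (∑ S, C S) Q (Icc 0 T) :=
  LipschitzOnWith.of_dist_le_mul fun t ht s hs => by
    have deriv_sub (S : Finset (Fin d)) :
        HasWeakDeriv S.toList (O.press (Q t - Q s)) (g S t - g S s) := by
      rw [map_sub]
      exact (hg S t ht).sub (hg S s hs)
    rw [dist_eq_norm, dist_eq_norm, NNReal.coe_sum, Finset.sum_mul]
    exact (O.norm_le_sum_of_press deriv_sub).trans
      (Finset.sum_le_sum fun S _ => (hC S).norm_sub_le ht hs)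

theorem SpectralOperators.secondDiffBound_of_press {τ : ℝ} (O : SpectralOperators d τ)
    {Q : ℝ → L2 d} {g : Finset (Fin d) → ℝ → L2 d} {C : Finset (Fin d) → ℝ≥0}
    (hg : ∀ S, ∀ t ∈ Icc 0 T, HasWeakDeriv S.toList (O.press (Q t)) (g S t))
    (hC : ∀ S, SecondDiffBound T (C S) (g S)) : SecondDiffBound T (∑ S, C S) Q := by
  intro m h hh hleft hright
  have eq_sub_sub (q : ℝ → L2 d) : q (m + h) + q (m - h) - (2 : ℝ) • q m
      = (q (m + h) - q m) - (q m - q (m - h)) := by module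
  have deriv_diff (S : Finset (Fin d)) :
      HasWeakDeriv S.toList (O.press (Q (m + h) + Q (m - h) - (2 : ℝ) • Q m))
        (g S (m + h) + g S (m - h) - (2 : ℝ) • g S m) := by
    have hm := hg S m ⟨by linarith, by linarith⟩
    rw [eq_sub_sub, eq_sub_sub, map_sub, map_sub, map_sub]
    exact ((hg S _ ⟨by linarith, hright⟩).sub hm).sub (hm.sub (hg S _ ⟨hleft, by linarith⟩))
  rw [NNReal.coe_sum, Finset.sum_mul]
  exact (O.norm_le_sum_of_press deriv_diff).trans
    (Finset.sum_le_sum fun S _ => hC S m h hh hleft hright)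

-- The constants only see the norm of `Y`, hence do not depend on `τ`.
theorem TimeY.exists_press_eq {p : ℝ → L2 d} (hp : TimeY T 2 p) :
    ∃ C : ℝ≥0, ∀ (τ : ℝ) (O : SpectralOperators d τ), ∃ Q : ℝ → L2 d,
      (∀ t ∈ Icc 0 T, O.press (Q t) = p t) ∧ LipschitzOnWith C Q (Icc 0 T)
        ∧ SecondDiffBound T C Q := by
  choose g hg hgT using fun S : Finset (Fin d) => hp.1 S.toList S.nodup_toList
  choose C lipschitz using fun S => (hgT S).exists_lipschitzOnWith_two
  choose C' second_diff using fun S => (hgT S).exists_secondDiffBound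
  refine ⟨max (∑ S, C S) (∑ S, C' S), fun τ O => ?_⟩
  have hQ : ∀ t, ∃ y, t ∈ Icc 0 T → O.press y = p t := fun t => by
    by_cases ht : t ∈ Icc 0 T
    · obtain ⟨y, hy⟩ := O.exists_press_eq fun S => hg S t ht
      exact ⟨y, fun _ => hy⟩
    · exact ⟨0, fun h => absurd h ht⟩
  choose Q hQ using hQ
  have deriv_press (S : Finset (Fin d)) (t : ℝ) (ht : t ∈ Icc 0 T) :
      HasWeakDeriv S.toList (O.press (Q t)) (g S t) := by
    rw [hQ t ht]
    exact hg S t ht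
  exact ⟨Q, hQ, (O.lipschitzOnWith_of_press deriv_press lipschitz).weaken (le_max_left _ _),
    (O.secondDiffBound_of_press deriv_press second_diff).mono (le_max_right _ _)⟩

end TimeRegularity

/-! ### The error equations of the scheme -/

section Sampling

variable {E : Type*} [NormedAddCommGroup E] {T τ : ℝ}

/-- The samples `w 0, w (3τ/2), w (5τ/2), …`: the scheme starts from the initial pressure and
then approximates the pressure at the midpoints of the time steps. -/
noncomputable def staggered (τ : ℝ) (w : ℝ → E) : ℕ → E
  | 0 => w 0
  | i + 1 => w ((i + 1 : ℕ) * τ + τ / 2)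

/-- The increments `q k - q (k - 1)`, frozen from the index `M` on, so that no sample after the
final time enters the increments or their differences. -/
def frozenIncrements {E : Type*} [Sub E] (M : ℕ) (q : ℕ → E) (k : ℕ) : E :=
  q (min k M) - q (min k M - 1)

theorem midpoint_mem_Icc (hτ : 0 ≤ τ) {i : ℕ} (hi : (i + 1) * τ ≤ T) :
    i * τ + τ / 2 ∈ Icc 0 T :=
  ⟨by positivity, by linarith⟩

theorem norm_staggered_sub_le (hτ : 0 ≤ τ) {w : ℝ → E} {C : ℝ≥0}
    (hw : LipschitzOnWith C w (Icc 0 T)) {i : ℕ} (hi : ((i + 1 : ℕ) + 1) * τ ≤ T) :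
    ‖staggered τ w (i + 1) - staggered τ w i‖ ≤ 2 * C * τ := by
  have step_le : (i + 1) * τ ≤ T := by push_cast at hi; linarith
  have bound {s : ℝ} (hs : s ∈ Icc 0 T) (hdist : |((i + 1 : ℕ) * τ + τ / 2) - s| ≤ 2 * τ) :
      ‖staggered τ w (i + 1) - w s‖ ≤ 2 * C * τ :=
    calc ‖staggered τ w (i + 1) - w s‖ ≤ C * |((i + 1 : ℕ) * τ + τ / 2) - s| :=
          hw.norm_sub_le (midpoint_mem_Icc hτ hi) hs
      _ ≤ C * (2 * τ) := by gcongr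
      _ = 2 * C * τ := by ring
  cases i with
  | zero =>
    refine bound (s := 0) ⟨le_rfl, le_trans (by positivity) step_le⟩ ?_
    rw [sub_zero, abs_of_nonneg (by positivity)]
    push_cast
    linarith
  | succ i =>
    refine bound (midpoint_mem_Icc hτ step_le) ?_
    rw [add_sub_add_right_eq_sub, ← sub_mul, Nat.cast_succ (i + 1), add_sub_cancel_left, one_mul,
      abs_of_nonneg hτ]
    linarith

theorem norm_staggered_sub_sub_le [NormedSpace ℝ E] (hτ : 0 ≤ τ) {w : ℝ → E} {C : ℝ≥0}
    (hw : SecondDiffBound T C w) {i : ℕ} (hi : ((i + 3 : ℕ) + 1) * τ ≤ T) :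
    ‖staggered τ w (i + 3) - staggered τ w (i + 2)
      - (staggered τ w (i + 2) - staggered τ w (i + 1))‖ ≤ 2 * C * τ ^ 2 := by
  have hi_nonneg : (0 : ℝ) ≤ i * τ := by positivity
  have second_diff := hw ((i + 2 : ℕ) * τ + τ / 2) τ hτ (by push_cast; linarith)
    (by push_cast at hi ⊢; linarith)
  have next : ((i + 2 : ℕ) : ℝ) * τ + τ / 2 + τ = (i + 3 : ℕ) * τ + τ / 2 := by push_cast; ring
  have previous : ((i + 2 : ℕ) : ℝ) * τ + τ / 2 - τ = (i + 1 : ℕ) * τ + τ / 2 := by push_cast; ring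
  have regroup (a b c : E) : a - b - (b - c) = a + c - (2 : ℝ) • b := by module
  rw [next, previous] at second_diff
  rw [regroup]
  refine second_diff.trans ?_
  gcongr
  exact le_mul_of_one_le_left C.coe_nonneg one_le_two

theorem norm_frozenIncrements_le {M : ℕ} {q : ℕ → E} {c : ℝ} (hc : 0 ≤ c)
    (h : ∀ i, i + 1 ≤ M → ‖q (i + 1) - q i‖ ≤ c) (k : ℕ) : ‖frozenIncrements M q k‖ ≤ c := by
  have hle : min k M ≤ M := min_le_right _ _
  rw [frozenIncrements]
  generalize min k M = i at hle ⊢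
  cases i with
  | zero => simpa using hc
  | succ i => exact h i hle

theorem norm_frozenIncrements_sub_le {M : ℕ} {q : ℕ → E} {c : ℝ} (hc : 0 ≤ c) {k : ℕ}
    (h : k + 2 ≤ M → ‖q (k + 2) - q (k + 1) - (q (k + 1) - q k)‖ ≤ c) :
    ‖frozenIncrements M q (k + 2) - frozenIncrements M q (k + 1)‖ ≤ c := by
  by_cases hk : k + 2 ≤ M
  · rw [frozenIncrements, frozenIncrements, min_eq_left hk, min_eq_left (by omega : k + 1 ≤ M)]
    exact h hk
  · rw [frozenIncrements, frozenIncrements, min_eq_right (by omega : M ≤ k + 2),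
      min_eq_right (by omega : M ≤ k + 1), sub_self, norm_zero]
    exact hc

end Sampling

theorem norm_piLp_le_sum {ι : Type*} [Fintype ι] {E : ι → Type*}
    [∀ i, NormedAddCommGroup (E i)] (v : PiLp 2 E) : ‖v‖ ≤ ∑ i, ‖v i‖ := by
  refine abs_le_of_sq_le_sq' ?_ (Finset.sum_nonneg fun _ _ => norm_nonneg _) |>.2
  rw [PiLp.norm_sq_eq_of_L2]
  exact Finset.sum_sq_le_sq_sum_of_nonneg fun _ _ => norm_nonneg _

section Convergence

variable {d : ℕ} {T τ χ : ℝ}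

/-- The exact solution as the convergence proof sees it for one time step `τ`: `lap`, `grad` and
`split` are its images under `Δ`, `∇` and `B_τ`, `lift` is the pressure in the coordinates of the
space of pressure corrections, and `CR`, `Cd` bound the truncation error and the variation of the
pressure. -/
structure ExactData (O : SpectralOperators d τ) (T : ℝ) (f ue : ℝ → Fin d → L2 d) (pe : ℝ → L2 d)
    (CR Cd : ℝ≥0) where
  lap : Fin d → ℝ → L2 d
  grad : Fin d → ℝ → L2 d
  split : Fin d → ℝ → L2 d
  lift : ℝ → L2 d
  isStepRegular : ∀ t ∈ Icc 0 T, ∀ j, IsStepRegular τ (ue t j)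
  hasWeakDiv : ∀ t ∈ Icc 0 T, HasWeakDiv (ue t) 0
  hasLaplacian : ∀ j, ∀ t ∈ Icc 0 T, HasLaplacian (ue t j) (lap j t)
  hasWeakDeriv : ∀ j, ∀ t ∈ Icc 0 T, HasWeakDeriv [j] (pe t) (grad j t)
  coef_split : ∀ j, ∀ t ∈ Icc 0 T, ∀ n,
    coef (fun _ => true) n (split j t) = splitSymbol τ n * coef (fun _ => true) n (ue t j)
  press_lift : ∀ t ∈ Icc 0 T, O.press (lift t) = pe t
  lipschitz : LipschitzOnWith Cd lift (Icc 0 T)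
  secondDiff : SecondDiffBound T Cd lift
  sum_norm_truncationError_le : ∀ t, 0 ≤ t → t + τ ≤ T →
    ∑ j, ‖truncationError τ (fun s => ue s j) (lap j) (split j) (grad j) (fun s => f s j) t‖
      ≤ CR * τ ^ 2

theorem exists_exactData (hd : d = 2 ∨ d = 3) {f ue : ℝ → Fin d → L2 d} {pe : ℝ → L2 d}
    (hf : ∀ j, TimeSobolev T 2 fun t => f t j) (hsol : IsStokesSolution T f ue pe)
    (hu : ∀ j, TimeH2 T 2 fun t => ue t j) (huB : ∀ τ > 0, ∀ j, TimeDB T 1 τ fun t => ue t j)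
    (hp : TimeY T 2 pe) :
    ∃ CR Cd : ℝ≥0, ∀ τ > 0, ∀ O : SpectralOperators d τ,
      Nonempty (ExactData O T f ue pe CR Cd) := by
  choose lap grad split CR hlap hgrad hsplit truncation_le using
    exists_norm_truncationError_le hd hf hsol hu huB hp
  obtain ⟨Cd, hlift⟩ := hp.exists_press_eq
  refine ⟨∑ j, CR j, Cd, fun τ hτ O => ?_⟩
  obtain ⟨lift, press_lift, lipschitz, secondDiff⟩ := hlift τ O
  exact ⟨{
    lap, grad, lift, press_lift, lipschitz, secondDiff
    split := fun j => split j τ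
    isStepRegular := fun t ht j => by
      obtain ⟨-, w, hw, -⟩ := huB τ hτ j
      exact (hw t ht).isStepRegular hd hτ.ne' (hlap j t ht)
    hasWeakDiv := hsol.incompressible
    hasLaplacian := hlap
    hasWeakDeriv := hgrad
    coef_split := fun j => hsplit j τ hτ.ne'
    sum_norm_truncationError_le := fun t ht htT => by
      rw [NNReal.coe_sum, Finset.sum_mul]
      exact Finset.sum_le_sum fun j _ => truncation_le j τ hτ t ht htT }⟩

theorem IsScheme.isStepRegular (hd : d = 2 ∨ d = 3) (hτ : 0 < τ) {f : ℝ → Fin d → L2 d}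
    {u₀ : Fin d → L2 d} {p₀ φs : L2 d} {u : ℕ → Fin d → L2 d} {p φ : ℕ → L2 d}
    (h : IsScheme T τ χ f u₀ p₀ φs u p φ) (h₀ : ∀ j, IsStepRegular τ (u₀ j)) (k : ℕ)
    (hk : k * τ ≤ T) (j : Fin d) : IsStepRegular τ (u k j) := by
  induction k generalizing j with
  | zero => rw [h.init_u]; exact h₀ j
  | succ k ih =>
    rw [Nat.cast_add_one] at hk
    have hprev := ih (by linarith)
    obtain ⟨g, -, hg⟩ := (h.velocity k hk).coef_eq hd hτ.ne' (fun i => (hprev i).memH10 hτ) j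
    exact (hprev j).of_step hτ hg

theorem SpectralOperators.eq_zero_of_emb_eq_zero (O : SpectralOperators d τ) (hτ : 0 < τ)
    {w : VelSpace d} (h : ∀ k, O.emb w k = 0) : w = 0 :=
  PiLp.ext fun k => eq_of_coef_eq (σ := fun _ => true) fun n => by
    rw [O.coef_eq_mul_coef_emb hτ, h, PiLp.zero_apply, coef_zero, mul_zero]

section Errors

variable (O : SpectralOperators d τ) (ue : ℝ → Fin d → L2 d) (u : ℕ → Fin d → L2 d)

/-- The velocity error `u(t_k) - u^k` in the coordinates of the velocity space (a junk value if the
error is not in that space). -/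
noncomputable def velError (k : ℕ) : VelSpace d :=
  Function.invFun (fun w j => O.emb w j) (ue (k * τ) - u k)

/-- The pressure correction `φ^{k-1/2}` in the coordinates of the space of pressure corrections. -/
noncomputable def corrError (k : ℕ) : L2 d := τ⁻¹ • O.press (O.div (velError O ue u k))

/-- The sum of the divergences of the averaged velocity errors, which the rotational update
accumulates in the pressure. -/
noncomputable def divErrorSum (k : ℕ) : L2 d :=
  ∑ l ∈ Finset.range k, (1 / 2 : ℝ) • O.div (velError O ue u (l + 1) + velError O ue u l)

/-- The pressure error without the divergence terms of the rotational update, in the coordinates of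
the space of pressure corrections; `q` are the samples of the exact pressure up to the index `M`. -/
noncomputable def pressError (M : ℕ) (q : ℕ → L2 d) (k : ℕ) : L2 d :=
  ∑ l ∈ Finset.range k, (frozenIncrements M q (l + 1) - corrError O ue u (l + 1))

end Errors

variable {O : SpectralOperators d τ} {f ue : ℝ → Fin d → L2 d} {pe : ℝ → L2 d} {CR Cd : ℝ≥0}

namespace ExactData

variable (X : ExactData O T f ue pe CR Cd)

include X in
theorem press_staggered_lift (hτ : 0 ≤ τ) {i : ℕ} (hi : (i + 1) * τ ≤ T) :
    O.press (staggered τ X.lift i) = staggered τ pe i := by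
  cases i with
  | zero => exact X.press_lift 0 ⟨le_rfl, le_trans (by positivity) hi⟩
  | succ i => exact X.press_lift _ (midpoint_mem_Icc hτ hi)

/-- The truncation error of the scheme in the step starting at the time `t`. -/
noncomputable def residual (t : ℝ) : VelSpace d :=
  WithLp.toLp 2 fun j => truncationError τ (fun s => ue s j) (X.lap j) (X.split j) (X.grad j)
    (fun s => f s j) t

theorem coef_residual (hτ : 0 < τ) {t : ℝ} (ht : 0 ≤ t) (htT : t + τ ≤ T) (j : Fin d)
    (n : Fin d → ℕ) :
    coef (fun _ => true) n (X.residual t j)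
      = stepSymbol τ n
          * (coef (fun _ => true) n (ue (t + τ) j) - coef (fun _ => true) n (ue t j))
        + lapSymbol n * coef (fun _ => true) n (ue t j)
        + coef (fun _ => true) n (X.grad j (t + τ / 2))
        - coef (fun _ => true) n (f (t + τ / 2) j) := by
  have hmem : t ∈ Icc 0 T := ⟨ht, by linarith⟩
  have hmem' : t + τ ∈ Icc 0 T := ⟨by linarith, htT⟩
  simp only [residual, truncationError, coef_sub, coef_add, coef_smul, X.coef_split j _ hmem,
    X.coef_split j _ hmem',
    (X.hasLaplacian j _ hmem).coef_eq ((X.isStepRegular _ hmem j).memH10 hτ),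
    (X.hasLaplacian j _ hmem').coef_eq ((X.isStepRegular _ hmem' j).memH10 hτ),
    stepSymbol_eq hτ.ne']
  ring

theorem norm_residual_le {t : ℝ} (ht : 0 ≤ t) (htT : t + τ ≤ T) :
    ‖X.residual t‖ ≤ CR * τ ^ 2 :=
  (norm_piLp_le_sum _).trans (X.sum_norm_truncationError_le t ht htT)

end ExactData

namespace IsScheme

variable (hd : d = 2 ∨ d = 3) (hτ : 0 < τ) (X : ExactData O T f ue pe CR Cd)
  {φs : L2 d} {u : ℕ → Fin d → L2 d} {p φ : ℕ → L2 d}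
  (h : IsScheme T τ χ f (ue 0) (pe 0) φs u p φ) {i k : ℕ}

include hd hτ X h

theorem emb_velError (hi : i * τ ≤ T) (j : Fin d) :
    O.emb (velError O ue u i) j = ue (i * τ) j - u i j := by
  have htime : (i : ℝ) * τ ∈ Icc 0 T := ⟨by positivity, hi⟩
  have h₀ := X.isStepRegular 0 ⟨le_rfl, htime.1.trans hi⟩
  obtain ⟨w, hw⟩ := O.exists_emb_eq hτ fun j =>
    (X.isStepRegular _ htime j).sub (h.isStepRegular hd hτ h₀ i hi j)
  exact congrFun (Function.invFun_eq (f := fun w j => O.emb w j) ⟨w, funext hw⟩) j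

theorem velError_zero (hT : 0 ≤ T) : velError O ue u 0 = 0 :=
  O.eq_zero_of_emb_eq_zero hτ fun j => by
    rw [h.emb_velError hd hτ X (by simpa using hT), h.init_u, Nat.cast_zero, zero_mul, sub_self]

theorem hasWeakDiv_neg_div_velError (hi : i * τ ≤ T) :
    HasWeakDiv (u i) (-O.div (velError O ue u i)) := by
  have hdiff := (X.hasWeakDiv _ ⟨by positivity, hi⟩).sub (O.hasWeakDiv (velError O ue u i))
  rw [zero_sub] at hdiff
  convert hdiff using 1
  funext j
  rw [Pi.sub_apply, h.emb_velError hd hτ X hi, sub_sub_cancel]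

theorem press_corrError (hi : (i + 1) * τ ≤ T) :
    O.press (corrError O ue u (i + 1)) = φ (i + 1) := by
  obtain ⟨D, hD, hA⟩ := h.penalty i hi
  rw [hD.unique (h.hasWeakDiv_neg_div_velError hd hτ X (by exact_mod_cast hi)), smul_neg, neg_smul,
    neg_neg, one_div] at hA
  rw [corrError, ← map_smul, O.press_press_of_hasA hd hA]

theorem pressure_succ (hi : (i + 1) * τ ≤ T) :
    p (i + 1) = p i + φ (i + 1)
      + χ • (1 / 2 : ℝ) • O.div (velError O ue u (i + 1) + velError O ue u i) := by
  obtain ⟨D, hD, hp⟩ := h.pressure i hi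
  have hprev := h.hasWeakDiv_neg_div_velError hd hτ X (i := i) (by linarith)
  have hnext := h.hasWeakDiv_neg_div_velError hd hτ X (i := i + 1) (by exact_mod_cast hi)
  rw [hp, hD.unique (hnext.midpoint hprev), map_add]
  module

theorem press_pressError (hk : (k + 1) * τ ≤ T) (hi : i ≤ k) :
    O.press (pressError O ue u k (staggered τ X.lift) i) - χ • divErrorSum O ue u i
      = staggered τ pe i - p i := by
  induction i with
  | zero => simp [pressError, divErrorSum, staggered, h.init_p]
  | succ i ih =>
    have hnext : ((i + 1 : ℕ) + 1) * τ ≤ T := le_trans (by gcongr) hk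
    have hprev : (i + 1) * τ ≤ T := by push_cast at hnext; linarith
    have hincr : frozenIncrements k (staggered τ X.lift) (i + 1)
        = staggered τ X.lift (i + 1) - staggered τ X.lift i := by
      rw [frozenIncrements, min_eq_left hi, Nat.add_sub_cancel]
    have step := ih (by omega)
    rw [pressError, divErrorSum] at step ⊢
    rw [Finset.sum_range_succ, Finset.sum_range_succ, h.pressure_succ hd hτ X hprev, hincr, map_add,
      map_sub, map_sub, X.press_staggered_lift hτ.le hnext, X.press_staggered_lift hτ.le hprev,
      h.press_corrError hd hτ X hprev]
    linear_combination (norm := module) step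

theorem press_predicted (hk : (k + 1) * τ ≤ T) (hi : i ≤ k) :
    O.press (pressError O ue u k (staggered τ X.lift) i - corrError O ue u i)
        - χ • divErrorSum O ue u i
        + (Pi.single 0 (pe (τ / 2) - (pe 0 + φs)) : ℕ → L2 d) i
      = pe (i * τ + τ / 2) - (p i + φ i) := by
  have hpress := h.press_pressError hd hτ X hk hi
  rw [map_sub, sub_right_comm, hpress]
  cases i with
  | zero =>
    have hT : 0 ≤ T := le_trans (by positivity) hk
    simp [corrError, h.velError_zero hd hτ X hT, staggered, h.init_p, h.init_φ]
  | succ i =>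
    have hstep : (i + 1) * τ ≤ T := by
      have : ((i + 1 : ℕ) : ℝ) ≤ k := by exact_mod_cast hi
      push_cast at this
      nlinarith
    rw [h.press_corrError hd hτ X hstep, Pi.single_eq_of_ne (Nat.succ_ne_zero i), staggered]
    abel

theorem momentum (hi : (i + 1) * τ ≤ T) (w : VelSpace d) :
    τ⁻¹ * inner ℝ (O.emb (velError O ue u (i + 1) - velError O ue u i)) (O.emb w)
      + 1 / 2 * inner ℝ (O.grad (velError O ue u (i + 1) + velError O ue u i)) (O.grad w)
      + τ / 4 * inner ℝ (O.split (velError O ue u (i + 1) - velError O ue u i)) (O.split w)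
      - inner ℝ (pe (i * τ + τ / 2) - (p i + φ i)) (O.div w)
      = inner ℝ (X.residual (i * τ)) (O.emb w) := by
  have htime : (i : ℝ) * τ ∈ Icc 0 T := ⟨by positivity, by linarith⟩
  have htime' : (i : ℝ) * τ + τ ≤ T := by linarith
  have hreg := h.isStepRegular hd hτ (X.isStepRegular 0 ⟨le_rfl, htime.1.trans htime.2⟩) i htime.2
  choose gs hgs scheme_coef using fun j => (h.velocity i hi).coef_eq hd hτ.ne'
    (fun j => (hreg j).memH10 hτ) j
  refine O.momentum_of_step hτ (g := fun j => X.grad j (i * τ + τ / 2) - gs j)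
    (fun j => (X.hasWeakDeriv j _ (midpoint_mem_Icc hτ.le hi)).sub (hgs j)) (fun j n => ?_) w
  have scheme := scheme_coef j n
  rw [show ((i : ℝ) + 1 / 2) * τ = i * τ + τ / 2 by ring, coef_sub] at scheme
  rw [h.emb_velError hd hτ X htime.2, h.emb_velError hd hτ X (by exact_mod_cast hi),
    Nat.cast_add_one, add_one_mul, coef_sub, coef_sub, coef_sub, coef_sub,
    X.coef_residual hτ htime.1 htime']
  linear_combination -scheme

omit hd hτ X h in
theorem inner_div_velError_press (hτ : τ ≠ 0) (i : ℕ) (q : L2 d) :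
    inner ℝ (O.div (velError O ue u i)) (O.press q) = τ * inner ℝ (corrError O ue u i) q := by
  rw [corrError, inner_smul_left, O.inner_press_left, conj_trivial, mul_inv_cancel_left₀ hτ]

/-- The error equations of the scheme up to the time `t_{k+1}`. -/
noncomputable def errorSystem (hk : (k + 1) * τ ≤ T) :
    ErrorSystem (O.splittingOperators hτ) χ (k + 1) where
  vel := velError O ue u
  corr := corrError O ue u
  press := pressError O ue u k (staggered τ X.lift)
  divSum := divErrorSum O ue u
  incr := frozenIncrements k (staggered τ X.lift)
  defect := Pi.single 0 (pe (τ / 2) - (pe 0 + φs))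
  res i := X.residual (i * τ)
  vel_zero := h.velError_zero hd hτ X (le_trans (by positivity) hk)
  corr_zero := by
    rw [corrError, h.velError_zero hd hτ X (le_trans (by positivity) hk), map_zero, map_zero,
      smul_zero]
  press_zero := Finset.sum_range_zero _
  divSum_zero := Finset.sum_range_zero _
  incr_zero := by simp [frozenIncrements]
  press_succ i _ := by rw [pressError, Finset.sum_range_succ, add_sub_assoc, ← pressError]
  divSum_succ i _ := Finset.sum_range_succ _ _
  momentum i hi w := by
    have hi : i ≤ k := by omega
    change _ - inner ℝ (O.press _ - _ + _) _ = _
    rw [h.press_predicted hd hτ X hk hi]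
    exact h.momentum hd hτ X (le_trans (by gcongr) hk) w
  penalty i _ := inner_div_velError_press hτ.ne' (i + 1)

theorem norm_grad_midVel_le (hχ : 0 < χ) (hχ' : χ ≤ 1) {C₀ : ℝ}
    (h₀ : ‖pe (τ / 2) - (pe 0 + φs)‖ ≤ C₀ * τ) (hk : (k + 1) * τ ≤ T) :
    ‖O.grad ((h.errorSystem hd hτ X hk).midVel k)‖
      ≤ (√(errorConst T CR (2 * Cd)) + 5 * C₀ / χ) * τ := by
  have hstep {i : ℕ} (hi : i ≤ k) : (i + 1) * τ ≤ T := le_trans (by gcongr) hk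
  refine (h.errorSystem hd hτ X hk).norm_grad_midVel_le hχ hχ' (by exact_mod_cast hk)
    CR.coe_nonneg (fun i hi => ?_) (fun i _ => ?_) (fun i _ => ?_) (fun i _ => ?_) ?_
    k.lt_succ_self
  · have := hstep (Nat.lt_succ_iff.1 hi)
    exact X.norm_residual_le (by positivity) (by linarith)
  · exact norm_frozenIncrements_le (by positivity)
      (fun i hi => norm_staggered_sub_le hτ.le X.lipschitz (hstep hi)) i
  · exact norm_frozenIncrements_sub_le (by positivity)
      fun hi => norm_staggered_sub_sub_le hτ.le X.secondDiff (hstep hi)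
  · simp only [errorSystem, Pi.single_eq_of_ne (Nat.succ_ne_zero i)]
  · simpa only [errorSystem, Pi.single_eq_same] using h₀

theorem h10NormLE (hχ : 0 < χ) (hχ' : χ ≤ 1) {C₀ : ℝ}
    (h₀ : ‖pe (τ / 2) - (pe 0 + φs)‖ ≤ C₀ * τ) (hk : (k + 1) * τ ≤ T) :
    H10NormLE (avg (fun n => ue (n * τ)) k - avg u k)
      ((√(errorConst T CR (2 * Cd)) + 5 * C₀ / χ) * τ) := by
  set e := (h.errorSystem hd hτ X hk).midVel k with e_def
  have emb_e (j : Fin d) : O.emb e j = (avg (fun n => ue (n * τ)) k - avg u k) j := by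
    rw [e_def, ErrorSystem.midVel, map_smul, map_add, PiLp.smul_apply, PiLp.add_apply]
    change (1 / 2 : ℝ) • (O.emb (velError O ue u (k + 1)) j + O.emb (velError O ue u k) j) = _
    rw [h.emb_velError hd hτ X (by exact_mod_cast hk), h.emb_velError hd hτ X (by linarith)]
    simp only [avg, Pi.sub_apply]
    module
  refine ⟨fun i j => O.grad e (i, j), fun i j => emb_e j ▸ O.hasDerivZeroTrace e i j, ?_⟩
  rw [← Fintype.sum_prod_type (f := fun x : Fin d × Fin d => ‖O.grad e x‖ ^ 2),
    ← PiLp.norm_sq_eq_of_L2, Real.sqrt_sq (norm_nonneg _)]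
  exact h.norm_grad_midVel_le hd hτ X hχ hχ' h₀ hk

end IsScheme

end Convergence

end DirSplit

theorem mainTheorem6 (d : ℕ) (hd : d = 2 ∨ d = 3) (T : ℝ) (hT : 0 < T)
    (f : ℝ → Fin d → L2 d) (hf : ∀ j, TimeSobolev T 2 fun t => f t j)
    (ue : ℝ → Fin d → L2 d) (pe : ℝ → L2 d)
    (hsol : IsStokesSolution T f ue pe)
    (hu : ∀ j, TimeH2 T 2 fun t => ue t j)
    (huB : ∀ τ > 0, ∀ j, TimeDB T 1 τ fun t => ue t j)
    (hp : TimeY T 2 pe)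
    (χ : ℝ) (hχ : 0 < χ) (hχ' : χ ≤ 1) (C₀ : ℝ) :
    ∃ c : ℝ, ∀ τ > 0, ∀ (φs : L2 d) (u : ℕ → Fin d → L2 d) (p φ : ℕ → L2 d),
      ‖pe (τ / 2) - (pe 0 + φs)‖ ≤ C₀ * τ →
      IsScheme T τ χ f (ue 0) (pe 0) φs u p φ →
      ∀ k : ℕ, (k + 1) * τ ≤ T →
        H10NormLE (avg (fun n => ue (n * τ)) k - avg u k) (c * τ) := by
  obtain ⟨CR, Cd, hdata⟩ := exists_exactData hd hf hsol hu huB hp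
  refine ⟨√(errorConst T CR (2 * Cd)) + 5 * C₀ / χ, fun τ hτ φs u p φ h₀ hs k hk => ?_⟩
  obtain ⟨O⟩ := SpectralOperators.nonempty d hτ
  obtain ⟨X⟩ := hdata τ hτ O
  exact hs.h10NormLE hd hτ X hχ hχ' h₀ hk
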